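/- Let $L,R,\mu>0$ be constants, $\mathcal I=(0,L)$, and $Q_T=(0,T)\times\mathcal I$ for $T>0$. Consider the two-phase thin-film system $$\partial_t f=-\partial_x\Big(f^3\partial_x^3f+\tfrac R2(2f^3+3f^2g)\,\partial_x^3(f+g)\Big),$$ $$\partial_t g=-\partial_x\Big(\tfrac32 f^2g\,\partial_x^3f+\tfrac R2(2\mu g^3+3f^2g+6fg^2)\,\partial_x^3(f+g)\Big)$$ for $(t,x)\in(0,\infty)\times\mathcal I$, with initial conditions $f(0)=f_0$, $g(0)=g_0$ and boundary conditions $\partial_xf=\partial_xg=\partial_x^3f=\partial_x^3g=0$ at $x=0,L$. For $u,v\in H^1(\mathcal I)$ put $$\mathcal E(u,v)=\frac12\int_{\mathcal I}|\partial_xu|^2+R\,|\partial_x(u+v)|^2\,dx .$$ Theorem. Let $f_0,g_0\in H^1(\mathcal I)$ be non-negative. Then the problem has at least one global weak solution $(f,g)$, in the following sense: there are functions $f,g:[0,\infty)\times[0,L]\to\mathbb R$ such that (a) for every $T>0$, $f,g\in L_\infty(0,T;H^1(\mathcal I))$ and $f,g\in C([0,T];C^\alpha([0,L]))$ for every $\alpha\in[0,1/2)$;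 (b) $f(0)=f_0$ and $g(0)=g_0$, and $f\ge0$, $g\ge0$ in $(0,\infty)\times\mathcal I$; (c) $\|f(t)\|_{L_1(\mathcal I)}=\|f_0\|_{L_1(\mathcal I)}$ and $\|g(t)\|_{L_1(\mathcal I)}=\|g_0\|_{L_1(\mathcal I)}$ for every $t>0$; (d) with $\mathcal P_T=\{(t,x)\in Q_T: f(t,x)>0 \text{ and } g(t,x)>0\}$, there are functions $j_f,j_g,j_{f,g}$ on $(0,\infty)\times\mathcal I$ such that for every $T>0$: the distributional derivatives $\partial_x^3f,\partial_x^3g$ on the open set $\mathcal P_T$ belong to $L_{2,\mathrm{loc}}(\mathcal P_T)$; $j_f,j_g,j_{f,g}\in L_2(Q_T)$; almost everywhere in $\mathcal P_T$ $$j_f=f^{1/2}\Big(f\,\partial_x^3f+\tfrac R2(2f+3g)\,\partial_x^3(f+g)\Big),\quad j_g=g^{3/2}\,\partial_x^3(f+g),\quad j_{f,g}=f^{1/2}g\,\partial_x^3(f+g);$$ the functions $$H_f=f^{3/2}j_f,\qquad H_g=\mu R\,g^{3/2}j_g+\tfrac{3R}4f^{1/2}g\,j_{f,g}+\tfrac32f^{1/2}g\,j_f$$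 belong to $L_2(Q_T)$; and for all $\xi\in C^\infty(\overline{Q_T})$ $$\int_{Q_T}f\,\partial_t\xi\,dx\,dt+\int_{Q_T}H_f\,\partial_x\xi\,dx\,dt=\int_{\mathcal I}f(T,x)\,\xi(T,x)\,dx-\int_{\mathcal I}f_0(x)\,\xi(0,x)\,dx,$$ $$\int_{Q_T}g\,\partial_t\xi\,dx\,dt+\int_{Q_T}H_g\,\partial_x\xi\,dx\,dt=\int_{\mathcal I}g(T,x)\,\xi(T,x)\,dx-\int_{\mathcal I}g_0(x)\,\xi(0,x)\,dx;$$ (e) for almost every $T>0$, $f(T),g(T)\in H^1(\mathcal I)$ and $$\mathcal E(f(T),g(T))+\int_{\mathcal P_T}\mu R^2|j_g|^2+\tfrac{3R^2}4|j_{f,g}|^2+|j_f|^2\,dx\,dt\le\mathcal E(f_0,g_0).$$ -/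

import Mathlib

open MeasureTheory Set Filter Topology
open scoped NNReal ENNReal ContDiff

noncomputable section

namespace ThinFilm

/-- Lebesgue measure on the interval `I = (0, L)`. -/
abbrev volI (L : ℝ) : Measure ℝ := volume.restrict (Ioo 0 L)

/-- The space-time cylinder `Q_T = (0, T) × (0, L)`; points are pairs `(t, x)`. -/
def cyl (L T : ℝ) : Set (ℝ × ℝ) := Ioo 0 T ×ˢ Ioo 0 L

/-- `v` is the weak (distributional) derivative of `u` on `(0, L)`. -/
def IsWeakDeriv (L : ℝ) (u v : ℝ → ℝ) : Prop :=
  ∀ φ : ℝ → ℝ, ContDiff ℝ ∞ φ → HasCompactSupport φ → tsupport φ ⊆ Ioo 0 L →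
    ∫ x in Ioo 0 L, u x * deriv φ x = -∫ x in Ioo 0 L, v x * φ x

/-- `u ∈ H¹(0, L)`. -/
def MemH1 (L : ℝ) (u : ℝ → ℝ) : Prop :=
  MemLp u 2 (volI L) ∧ ∃ v : ℝ → ℝ, MemLp v 2 (volI L) ∧ IsWeakDeriv L u v

open Classical in
/-- The weak derivative `∂ₓu ∈ L₂(0, L)` of `u ∈ H¹(0, L)` (unique up to null sets), and `0` if
there is none. -/
def weakDeriv (L : ℝ) (u : ℝ → ℝ) : ℝ → ℝ :=
  if h : ∃ v : ℝ → ℝ, MemLp v 2 (volI L) ∧ IsWeakDeriv L u v then h.choose else 0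

/-- The energy `𝓔(u, v) = ½ ∫_I |∂ₓu|² + R |∂ₓ(u + v)|² dx`, for `u, v ∈ H¹(0, L)`. -/
def energy (L R : ℝ) (u v : ℝ → ℝ) : ℝ :=
  1 / 2 * ∫ x in Ioo 0 L,
    (weakDeriv L u x ^ 2 + R * weakDeriv L (fun y => u y + v y) x ^ 2)

/-- `u ∈ L_∞(0, T; H¹(0, L))`: as a map into `L₂(0, L)`, both `t ↦ u(t)` and `t ↦ ∂ₓu(t)` are
strongly measurable and essentially bounded on `(0, T)`. (The map `w ↦ (w, ∂ₓw)` identifies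
`H¹` with a closed subspace of `L₂ × L₂`.) -/
def MemLinftyH1 (L T : ℝ) (u : ℝ → ℝ → ℝ) : Prop :=
  ∃ U V : ℝ → Lp ℝ 2 (volI L),
    MemLp U ⊤ (volume.restrict (Ioo 0 T)) ∧ MemLp V ⊤ (volume.restrict (Ioo 0 T)) ∧
    ∀ᵐ t ∂(volume.restrict (Ioo 0 T)), u t =ᵐ[volI L] U t ∧ IsWeakDeriv L (u t) (V t)

/-- The norm of `C^α([0, L])`, `sup |u| + [u]_α`, with values in `[0, ∞]`. -/
def holderENorm (L : ℝ) (α : ℝ≥0) (u : ℝ → ℝ) : ℝ≥0∞ :=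
  (⨆ x : Icc (0 : ℝ) L, ‖u x‖ₑ) + eHolderNorm α (fun x : Icc (0 : ℝ) L => u x)

/-- `u ∈ C^α([0, L])`; for `α = 0` this is the space of continuous functions. -/
def MemHolderSpace (L : ℝ) (α : ℝ≥0) (u : ℝ → ℝ) : Prop :=
  ContinuousOn u (Icc 0 L) ∧ holderENorm L α u < ⊤

/-- `u ∈ C([0, T]; C^α([0, L]))`. -/
def MemCHolder (L T : ℝ) (α : ℝ≥0) (u : ℝ → ℝ → ℝ) : Prop :=
  (∀ t ∈ Icc 0 T, MemHolderSpace L α (u t)) ∧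
  ∀ s ∈ Icc 0 T,
    Tendsto (fun t => holderENorm L α (fun x => u t x - u s x)) (𝓝[Icc 0 T] s) (𝓝 0)

/-- `u ∈ L₂(Q_T)`. -/
def MemL2Cyl (L T : ℝ) (u : ℝ → ℝ → ℝ) : Prop :=
  MemLp (fun p : ℝ × ℝ => u p.1 p.2) 2 (volume.restrict (cyl L T))

/-- The set `𝓟_f ∩ 𝓟_g = {(t, x) ∈ Q_T : f(t, x) > 0 and g(t, x) > 0}`. -/
def posSet (L T : ℝ) (f g : ℝ → ℝ → ℝ) : Set (ℝ × ℝ) :=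
  {p | p ∈ cyl L T ∧ 0 < f p.1 p.2 ∧ 0 < g p.1 p.2}

/-- `w ∈ L_{2,loc}(Ω)`. -/
def MemL2Loc (Ω : Set (ℝ × ℝ)) (w : ℝ → ℝ → ℝ) : Prop :=
  ∀ K : Set (ℝ × ℝ), IsCompact K → K ⊆ Ω →
    MemLp (fun p : ℝ × ℝ => w p.1 p.2) 2 (volume.restrict K)

/-- `w = ∂ₓ³u` in the sense of distributions on `Ω ⊆ ℝ_t × ℝ_x`. -/
def IsWeakDerivX3 (Ω : Set (ℝ × ℝ)) (u w : ℝ → ℝ → ℝ) : Prop :=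
  ∀ φ : ℝ × ℝ → ℝ, ContDiff ℝ ∞ φ → HasCompactSupport φ → tsupport φ ⊆ Ω →
    ∫ p in Ω, u p.1 p.2 * iteratedDeriv 3 (fun y => φ (p.1, y)) p.2
      = -∫ p in Ω, w p.1 p.2 * φ p

/-- `H_f = f^{3/2} j_f`. -/
def fluxF (f jf : ℝ → ℝ → ℝ) (t x : ℝ) : ℝ := f t x ^ (3 / 2 : ℝ) * jf t x

/-- `H_g = μ R g^{3/2} j_g + (3R/4) f^{1/2} g j_{f,g} + (3/2) f^{1/2} g j_f`. -/
def fluxG (R μ : ℝ) (f g jf jg jfg : ℝ → ℝ → ℝ) (t x : ℝ) : ℝ :=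
  μ * R * g t x ^ (3 / 2 : ℝ) * jg t x
    + 3 * R / 4 * (f t x ^ (1 / 2 : ℝ) * g t x * jfg t x)
    + 3 / 2 * (f t x ^ (1 / 2 : ℝ) * g t x * jf t x)

/-- The weak formulation of `∂ₜu = -∂ₓH` on `Q_T` with no-flux boundary conditions and initial
datum `u₀`, tested with all `ξ ∈ C^∞` on the closed cylinder. -/
def WeakForm (L T : ℝ) (u H : ℝ → ℝ → ℝ) (u₀ : ℝ → ℝ) : Prop :=
  ∀ ξ : ℝ × ℝ → ℝ, ContDiffOn ℝ ∞ ξ (Icc 0 T ×ˢ Icc 0 L) →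
    (∫ p in cyl L T, u p.1 p.2 * deriv (fun s => ξ (s, p.2)) p.1)
      + (∫ p in cyl L T, H p.1 p.2 * deriv (fun y => ξ (p.1, y)) p.2)
    = (∫ x in Ioo 0 L, u T x * ξ (T, x)) - ∫ x in Ioo 0 L, u₀ x * ξ (0, x)

end ThinFilm

end

open MeasureTheory Set Filter Topology
open scoped NNReal ENNReal ContDiff

noncomputable section

namespace ThinFilm

/-! The heights are approximated by cosine sums in a Galerkin scheme, and the energy does the rest.
Write a, b for the square roots of the heights. The fluxes are linear in the currents j_f, j_g,
j_{f,g}, with coefficients cubic in a and b, and the system is a gradient flow: by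
`flux_mul_eq_dissip`, pairing the fluxes with the x-derivatives of ∂ₓ²(f + R(f+g)) and R∂ₓ²(f+g)
gives a weighted sum of squares of the currents. This is a polynomial identity with no sign
condition on a and b, so both may be replaced by a smooth function of the heights that stays
positive even at negative heights. Second derivatives of cosine sums are again cosine sums, so the
Galerkin system satisfies the energy identity exactly. This makes it solvable on any time interval
(`exists_galerkin`), with bounds that do not depend on the number of modes.

The energy bounds the heights in H¹, hence in C^{1/2} in space. The dissipation bounds the fluxes in
L₂, which gives equicontinuity in time (`abs_trig_le_modulus`). Limits are taken along a free
ultrafilter, so no subsequences or diagonal arguments occur: the heights converge uniformly on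
bounded cylinders (`IsBoundedSeq.exists_limit`) and the currents weakly in L₂
(`exists_current_limit`). A flux is a weakly convergent current times uniformly convergent factors,
so it passes to the limit (`IsWeakLimit.mul`) without any information on third derivatives where a
film vanishes. On compact subsets of the positivity set a and b are bounded below, the third
derivatives are recovered algebraically from the currents, and the formulas for the currents survive
(`ApproxSeq.IsLimit.weak_third`, `ApproxSeq.IsLimit.currents_eq`).

The limit equation is first known for cosine modes only. Completeness of the sines extends it to C¹
functions of x (`IsModeSolution.test`), and slicing in time extends it to functions of (t, x)
(`IsModeSolution.test_cyl`). Non-negativity is not built into the approximation. In the limit each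
flux carries the square root of the positive part of its own height, so it vanishes where that
height is negative; there the height does not change in time, and a negative value could be traced
back to the initial datum (`IsModeSolution.nonneg`). The energy inequality is weak lower
semicontinuity, and it holds at every time because the x-derivatives converge weakly at every time.
-/

/-! ### Ordinary differential equations -/

/-- Solution on `[0, T]` of an autonomous differential equation whose right-hand side, the integral
of a `C¹` parameter-dependent field, is multiplied by a nonnegative cutoff. -/
lemma exists_cutoff_flow {X : Type*} [NormedAddCommGroup X] [NormedSpace ℝ X]
    [FiniteDimensional ℝ X] (G : X × ℝ → X) (hG : ContDiff ℝ 1 G) {L : ℝ} (hL : 0 ≤ L) (x₀ : X)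
    (r : ℝ) {T : ℝ} (hT : 0 ≤ T) :
    ∃ χ : X → ℝ, (∀ x, 0 ≤ χ x) ∧ (∀ x, ‖x‖ ≤ r → χ x = 1) ∧ ∃ y : ℝ → X, y 0 = x₀ ∧
      ∀ t ∈ Icc 0 T,
        HasDerivWithinAt y (χ (y t) • ∫ x in (0)..L, G (y t, x)) (Icc 0 T) t := by
  have : CompleteSpace X := FiniteDimensional.complete ℝ X
  let χ : ContDiffBump (0 : X) := ⟨max r 1, max r 1 + 1, by positivity, by linarith⟩
  let ψ : ContDiffBump (0 : ℝ) := ⟨L + 1, L + 2, by positivity, by linarith⟩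
  -- Cutting off in both variables gives `K` compact support, hence a global Lipschitz constant and
  -- a global bound. The cutoff `ψ` equals 1 on `[0, L]`, so the integral does not see it.
  let K : X × ℝ → X := fun p => (χ p.1 * ψ p.2) • G p
  have hK : ContDiff ℝ 1 K :=
    ((χ.contDiff.comp contDiff_fst).mul (ψ.contDiff.comp contDiff_snd)).smul hG
  have hKs : HasCompactSupport K := by
    refine HasCompactSupport.intro
      ((isCompact_closedBall (0 : X) (max r 1 + 1)).prod (isCompact_closedBall (0 : ℝ) (L + 2)))
      fun p hp => ?_
    rw [mem_prod, not_and_or] at hp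
    rcases hp with hp | hp
    · have : χ p.1 = 0 := χ.zero_of_le_dist (le_of_lt (by simpa using hp))
      simp [K, this]
    · have : ψ p.2 = 0 := ψ.zero_of_le_dist (le_of_lt (by simpa using hp))
      simp [K, this]
  obtain ⟨C, hC⟩ := hK.lipschitzWith_of_hasCompactSupport hKs one_ne_zero
  obtain ⟨B, hB⟩ := hKs.exists_bound_of_continuous hK.continuous
  have hB0 : 0 ≤ B := (norm_nonneg _).trans (hB (0, 0))
  let v : X → X := fun x => ∫ ξ in (0)..L, K (x, ξ)
  have hinteg : ∀ x, IntervalIntegrable (fun ξ => K (x, ξ)) volume 0 L := fun x =>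
    (hK.continuous.comp (by fun_prop)).intervalIntegrable _ _
  have hv : ∀ x, v x = χ x • ∫ ξ in (0)..L, G (x, ξ) := by
    intro x
    rw [← intervalIntegral.integral_smul]
    refine intervalIntegral.integral_congr fun ξ hξ => ?_
    rw [uIcc_of_le hL] at hξ
    have : ψ ξ = 1 := ψ.one_of_mem_closedBall (by
      simp only [Metric.mem_closedBall, dist_zero_right, Real.norm_eq_abs, abs_of_nonneg hξ.1, ψ]
      linarith [hξ.2])
    simp [K, this]
  have hvL : LipschitzWith (C * L.toNNReal) v := by
    refine LipschitzWith.of_dist_le_mul fun x y => ?_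
    rw [dist_eq_norm, ← intervalIntegral.integral_sub (hinteg x) (hinteg y)]
    refine (intervalIntegral.norm_integral_le_of_norm_le_const (C := C * dist x y)
      fun ξ _ => ?_).trans ?_
    · rw [← dist_eq_norm]
      refine (hC.dist_le_mul _ _).trans ?_
      rw [Prod.dist_eq]
      simp
    · rw [sub_zero, abs_of_nonneg hL]
      rw [NNReal.coe_mul, Real.coe_toNNReal L hL]
      exact le_of_eq (by ring)
  have hvB : ∀ x, ‖v x‖ ≤ B * L := fun x => by
    have := intervalIntegral.norm_integral_le_of_norm_le_const (a := 0) (b := L)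
      (f := fun ξ => K (x, ξ)) (C := B) fun ξ _ => hB _
    rwa [sub_zero, abs_of_nonneg hL] at this
  -- The field is bounded by `B * L`, so a solution cannot leave the ball of radius `B * L * T`
  -- before time `T`: a single application of Picard–Lindelöf covers the whole interval.
  have hPL : IsPicardLindelof (fun _ => v) (tmin := 0) (tmax := T) ⟨0, le_rfl, hT⟩ x₀
      (B * L * T).toNNReal 0 (B * L).toNNReal (C * L.toNNReal) := by
    refine IsPicardLindelof.of_time_independent (fun x _ => ?_) hvL.lipschitzOnWith ?_
    · rw [Real.coe_toNNReal _ (by positivity)]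
      exact hvB x
    · rw [Real.coe_toNNReal _ (by positivity), Real.coe_toNNReal _ (by positivity)]
      simp [max_eq_left hT]
  obtain ⟨y, hy0, hy⟩ := hPL.exists_eq_forall_mem_Icc_hasDerivWithinAt₀
  refine ⟨χ, fun x => χ.nonneg, fun x hx => χ.one_of_mem_closedBall ?_, y, hy0, fun t ht => ?_⟩
  · simpa [χ] using Or.inl hx
  · simpa only [hv] using hy t ht

/-! ### Weak convergence -/

/-- Bounded sequences in `L₂` have weak limits along ultrafilters. -/
lemma exists_weak_limit {α : Type*} [MeasurableSpace α] {ν : Measure α} (U : Ultrafilter ℕ)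
    (j : ℕ → α → ℝ) (hj : ∀ n, MemLp (j n) 2 ν) {C : ℝ} (hC : ∀ n, ∫ a, j n a ^ 2 ∂ν ≤ C) :
    ∃ J : α → ℝ, MemLp J 2 ν ∧
      ∀ φ : α → ℝ, MemLp φ 2 ν →
        Tendsto (fun n => ∫ a, j n a * φ a ∂ν) U (𝓝 (∫ a, J a * φ a ∂ν)) := by
  have hinner : ∀ {u v : α → ℝ} (hu : MemLp u 2 ν) (hv : MemLp v 2 ν),
      inner ℝ (hu.toLp u) (hv.toLp v) = ∫ a, u a * v a ∂ν := by
    intro u v hu hv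
    rw [L2.inner_def]
    refine integral_congr_ae ?_
    filter_upwards [hu.coeFn_toLp, hv.coeFn_toLp] with a h1 h2
    rw [h1, h2]
    simp [mul_comm]
  let ℓ : ℕ → WeakDual ℝ (Lp ℝ 2 ν) := fun n =>
    StrongDual.toWeakDual (InnerProductSpace.toDual ℝ _ ((hj n).toLp (j n)))
  have hball : ∀ n, ℓ n ∈ WeakDual.toStrongDual ⁻¹' Metric.closedBall
      (0 : StrongDual ℝ (Lp ℝ 2 ν)) (Real.sqrt C) := by
    intro n
    simp only [mem_preimage, mem_closedBall_zero_iff]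
    change ‖InnerProductSpace.toDual ℝ _ ((hj n).toLp (j n))‖ ≤ _
    rw [LinearIsometryEquiv.norm_map]
    refine Real.le_sqrt_of_sq_le ?_
    rw [← real_inner_self_eq_norm_sq, hinner]
    simpa [sq] using hC n
  -- Banach–Alaoglu, with `L₂` identified with its dual by Riesz. An ultrafilter on a compact set
  -- converges, so neither separability nor a subsequence is needed.
  obtain ⟨J, -, hJ⟩ := (WeakDual.isCompact_closedBall (0 : StrongDual ℝ (Lp ℝ 2 ν))
    (Real.sqrt C)).ultrafilter_le_nhds (U.map ℓ) (by
      rw [le_principal_iff, Ultrafilter.mem_coe, Ultrafilter.mem_map]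
      exact Filter.univ_mem' hball)
  let w : Lp ℝ 2 ν := (InnerProductSpace.toDual ℝ _).symm (WeakDual.toStrongDual J)
  refine ⟨w, Lp.memLp w, fun φ hφ => ?_⟩
  have h1 : Tendsto (fun n => ℓ n (hφ.toLp φ)) U (𝓝 (J (hφ.toLp φ))) :=
    ((WeakDual.eval_continuous (hφ.toLp φ)).tendsto J).comp hJ
  have h2 : J (hφ.toLp φ) = ∫ a, w a * φ a ∂ν := by
    have : J (hφ.toLp φ) = inner ℝ w (hφ.toLp φ) := by
      rw [← InnerProductSpace.toDual_apply_apply]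
      simp [w]
    rw [this, ← hinner (Lp.memLp w) hφ, Lp.toLp_coeFn]
  have h3 : ∀ n, ℓ n (hφ.toLp φ) = ∫ a, j n a * φ a ∂ν := fun n => by
    rw [← hinner (hj n) hφ]
    rfl
  simpa only [h2, h3] using h1

lemma integral_mul_abs_le {α : Type*} [MeasurableSpace α] {ν : Measure α} {u v : α → ℝ}
    (hu : MemLp u 2 ν) (hv : MemLp v 2 ν) :
    ∫ a, |u a * v a| ∂ν ≤ 1 / 2 * (∫ a, u a ^ 2 ∂ν + ∫ a, v a ^ 2 ∂ν) := by
  rw [← integral_add hu.integrable_sq hv.integrable_sq, ← integral_const_mul]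
  refine integral_mono (hu.integrable_mul hv).abs
    ((hu.integrable_sq.add hv.integrable_sq).const_mul _) fun a => ?_
  rw [abs_mul]
  nlinarith [sq_nonneg (|u a| - |v a|), sq_abs (u a), sq_abs (v a)]

/-- The product of a weakly convergent and a uniformly convergent sequence converges. -/
lemma tendsto_integral_mul_of_uniform {α : Type*} [MeasurableSpace α] {ν : Measure α}
    {l : Filter ℕ} {j : ℕ → α → ℝ} {J : α → ℝ} (hj : ∀ᶠ n in l, MemLp (j n) 2 ν)
    {C : ℝ} (hC : ∀ᶠ n in l, ∫ a, j n a ^ 2 ∂ν ≤ C)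
    (hw : ∀ φ : α → ℝ, MemLp φ 2 ν →
      Tendsto (fun n => ∫ a, j n a * φ a ∂ν) l (𝓝 (∫ a, J a * φ a ∂ν)))
    {S : Set α} {b : ℕ → α → ℝ} {β : α → ℝ} (hb : TendstoUniformlyOn b β l S)
    (hbm : ∀ᶠ n in l, AEStronglyMeasurable (b n) ν) {ψ : α → ℝ} (hψ : MemLp ψ 2 ν)
    (hψS : ∀ a, a ∉ S → ψ a = 0) (hβψ : MemLp (fun a => β a * ψ a) 2 ν) :
    Tendsto (fun n => ∫ a, j n a * (b n a * ψ a) ∂ν) l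
      (𝓝 (∫ a, J a * (β a * ψ a) ∂ν)) := by
  refine Metric.tendsto_nhds.2 fun ε hε => ?_
  -- By Young's inequality `D` bounds the integral of `|j n * ψ|` uniformly in `n`; dividing by `|D|
  -- + 1` avoids a zero denominator.
  set D : ℝ := 1 / 2 * (C + ∫ a, ψ a ^ 2 ∂ν) with hD
  have hD1 : 0 < |D| + 1 := by positivity
  have h1 := Metric.tendsto_nhds.1 (hw _ hβψ) (ε / 2) (by positivity)
  have h2 := Metric.tendstoUniformlyOn_iff.1 hb (ε / 2 / (|D| + 1)) (by positivity)
  filter_upwards [h1, h2, hj, hC, hbm] with n hn1 hn2 hj hC hbm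
  set η : ℝ := ε / 2 / (|D| + 1) with hη
  have hη0 : 0 < η := by positivity
  have hbd : ∀ a, ‖b n a * ψ a - β a * ψ a‖ ≤ η * ‖ψ a‖ := fun a => by
    by_cases ha : a ∈ S
    · rw [← sub_mul, norm_mul]
      refine mul_le_mul_of_nonneg_right ?_ (norm_nonneg _)
      rw [← dist_eq_norm, dist_comm]
      exact (hn2 a ha).le
    · simp [hψS a ha]
  have hdm : MemLp (fun a => b n a * ψ a - β a * ψ a) 2 ν :=
    (hψ.norm.const_mul η).of_le ((hbm.mul hψ.1).sub hβψ.1) (.of_forall fun a => by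
      refine (hbd a).trans (le_abs_self _))
  have hbψ : MemLp (fun a => b n a * ψ a) 2 ν := by
    have := hdm.add hβψ
    refine this.congr_norm (hbm.mul hψ.1) (.of_forall fun a => by simp)
  have hkey : |∫ a, j n a * (b n a * ψ a) ∂ν - ∫ a, j n a * (β a * ψ a) ∂ν| ≤ η * |D| := by
    have hsub := integral_sub (hj.integrable_mul hbψ) (hj.integrable_mul hβψ)
    simp only [Pi.mul_apply] at hsub
    rw [← hsub]
    refine (abs_integral_le_integral_abs).trans ?_
    have hle : ∫ a, |j n a * (b n a * ψ a) - j n a * (β a * ψ a)| ∂ν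
        ≤ ∫ a, η * |j n a * ψ a| ∂ν := by
      refine integral_mono_of_nonneg (.of_forall fun a => abs_nonneg _)
        ((hj.integrable_mul hψ).abs.const_mul η) (.of_forall fun a => ?_)
      change |j n a * (b n a * ψ a) - j n a * (β a * ψ a)| ≤ η * |j n a * ψ a|
      rw [← mul_sub, abs_mul, abs_mul]
      have := mul_le_mul_of_nonneg_left (hbd a) (abs_nonneg (j n a))
      simp only [Real.norm_eq_abs] at this
      linarith
    refine hle.trans ?_
    rw [integral_const_mul]
    refine mul_le_mul_of_nonneg_left ?_ hη0.le
    refine ((integral_mul_abs_le hj hψ).trans ?_).trans (le_abs_self D)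
    rw [hD]
    have := hC
    linarith
  rw [dist_eq_norm, Real.norm_eq_abs] at hn1 ⊢
  have hηD : η * |D| ≤ ε / 2 := by
    rw [hη, div_mul_eq_mul_div, div_le_iff₀ hD1]
    nlinarith [abs_nonneg D]
  calc _ ≤ |∫ a, j n a * (b n a * ψ a) ∂ν - ∫ a, j n a * (β a * ψ a) ∂ν|
        + |∫ a, j n a * (β a * ψ a) ∂ν - ∫ a, J a * (β a * ψ a) ∂ν| := abs_sub_le _ _ _
    _ < ε := by linarith

/-! ### Trigonometric modes -/

/-- The frequency `kπ/L`. -/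
def freq (L : ℝ) (k : ℕ) : ℝ := k * Real.pi / L

/-- The mode `cos(kπx/L)`. -/
def cosMode (L : ℝ) (k : ℕ) (x : ℝ) : ℝ := Real.cos (freq L k * x)

/-- The mode `sin(kπx/L)`. -/
def sinMode (L : ℝ) (k : ℕ) (x : ℝ) : ℝ := Real.sin (freq L k * x)

lemma freq_zero (L : ℝ) : freq L 0 = 0 := by simp [freq]

lemma freq_pos {L : ℝ} (hL : 0 < L) {k : ℕ} (hk : k ≠ 0) : 0 < freq L k := by
  have : (0 : ℝ) < k := by positivity
  unfold freq
  positivity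

lemma cosMode_zero (L x : ℝ) : cosMode L 0 x = 1 := by simp [cosMode, freq_zero]

lemma sinMode_zero (L x : ℝ) : sinMode L 0 x = 0 := by simp [sinMode, freq_zero]

lemma sinMode_left (L : ℝ) (k : ℕ) : sinMode L k 0 = 0 := by simp [sinMode]

lemma sinMode_right {L : ℝ} (hL : 0 < L) (k : ℕ) : sinMode L k L = 0 := by
  rw [sinMode, freq, div_mul_cancel₀ _ hL.ne', Real.sin_nat_mul_pi]

@[fun_prop]
lemma contDiff_cosMode (L : ℝ) (k : ℕ) {n : WithTop ℕ∞} : ContDiff ℝ n (cosMode L k) :=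
  Real.contDiff_cos.comp (contDiff_const.mul contDiff_id)

@[fun_prop]
lemma contDiff_sinMode (L : ℝ) (k : ℕ) {n : WithTop ℕ∞} : ContDiff ℝ n (sinMode L k) :=
  Real.contDiff_sin.comp (contDiff_const.mul contDiff_id)

@[fun_prop]
lemma continuous_cosMode (L : ℝ) (k : ℕ) : Continuous (cosMode L k) :=
  (contDiff_cosMode L k (n := 0)).continuous

@[fun_prop]
lemma continuous_sinMode (L : ℝ) (k : ℕ) : Continuous (sinMode L k) :=
  (contDiff_sinMode L k (n := 0)).continuous

lemma hasDerivAt_cosMode (L : ℝ) (k : ℕ) (x : ℝ) :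
    HasDerivAt (cosMode L k) (-(freq L k * sinMode L k x)) x := by
  have := ((hasDerivAt_id x).const_mul (freq L k)).cos
  simp only [id, mul_one] at this
  exact this.congr_deriv (by rw [sinMode]; ring)

lemma hasDerivAt_sinMode (L : ℝ) (k : ℕ) (x : ℝ) :
    HasDerivAt (sinMode L k) (freq L k * cosMode L k x) x := by
  have := ((hasDerivAt_id x).const_mul (freq L k)).sin
  simp only [id, mul_one] at this
  exact this.congr_deriv (by rw [cosMode]; ring)

lemma setIntegral_Ioo_eq {L : ℝ} (hL : 0 ≤ L) (u : ℝ → ℝ) :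
    ∫ x in Ioo 0 L, u x = ∫ x in (0)..L, u x := by
  rw [intervalIntegral.integral_of_le hL, integral_Ioc_eq_integral_Ioo]

lemma integral_cos_int_mul {L : ℝ} (hL : 0 < L) (m : ℤ) :
    ∫ x in (0)..L, Real.cos (m * Real.pi / L * x) = if m = 0 then L else 0 := by
  split_ifs with h
  · simp [h]
  · have hm : (m * Real.pi / L : ℝ) ≠ 0 := by
      have : (m : ℝ) ≠ 0 := by exact_mod_cast h
      positivity
    rw [intervalIntegral.integral_comp_mul_left (fun y => Real.cos y) hm, integral_cos]
    simp [div_mul_cancel₀ _ hL.ne', Real.sin_int_mul_pi]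

lemma integral_sinMode_mul_sinMode {L : ℝ} (hL : 0 < L) (j k : ℕ) :
    ∫ x in (0)..L, sinMode L j x * sinMode L k x =
      if j = k then (if k = 0 then 0 else L / 2) else 0 := by
  have h : ∀ x, sinMode L j x * sinMode L k x =
      1 / 2 * Real.cos (((j : ℤ) - k : ℤ) * Real.pi / L * x)
        - 1 / 2 * Real.cos (((j : ℤ) + k : ℤ) * Real.pi / L * x) := by
    intro x
    have e1 : (((j : ℤ) - k : ℤ) * Real.pi / L * x : ℝ) = freq L j * x - freq L k * x := by
      simp only [freq]; push_cast; ring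
    have e2 : (((j : ℤ) + k : ℤ) * Real.pi / L * x : ℝ) = freq L j * x + freq L k * x := by
      simp only [freq]; push_cast; ring
    rw [e1, e2, Real.cos_sub, Real.cos_add, sinMode, sinMode]
    ring
  simp_rw [h]
  rw [intervalIntegral.integral_sub, intervalIntegral.integral_const_mul,
    intervalIntegral.integral_const_mul, integral_cos_int_mul hL, integral_cos_int_mul hL]
  · by_cases hjk : j = k
    · subst hjk
      by_cases hj : j = 0
      · simp [hj]
      · have : (j : ℤ) + j ≠ 0 := by omega
        simp [hj]
        ring
    · have h1 : (j : ℤ) - k ≠ 0 := by omega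
      have h2 : (j : ℤ) + k ≠ 0 := by omega
      simp [hjk, h1, h2]
  · exact (by fun_prop : Continuous _).intervalIntegrable _ _
  · exact (by fun_prop : Continuous _).intervalIntegrable _ _

lemma integral_cosMode_mul_cosMode {L : ℝ} (hL : 0 < L) (j k : ℕ) :
    ∫ x in (0)..L, cosMode L j x * cosMode L k x =
      if j = k then (if k = 0 then L else L / 2) else 0 := by
  have h : ∀ x, cosMode L j x * cosMode L k x =
      1 / 2 * Real.cos (((j : ℤ) - k : ℤ) * Real.pi / L * x)
        + 1 / 2 * Real.cos (((j : ℤ) + k : ℤ) * Real.pi / L * x) := by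
    intro x
    have e1 : (((j : ℤ) - k : ℤ) * Real.pi / L * x : ℝ) = freq L j * x - freq L k * x := by
      simp only [freq]; push_cast; ring
    have e2 : (((j : ℤ) + k : ℤ) * Real.pi / L * x : ℝ) = freq L j * x + freq L k * x := by
      simp only [freq]; push_cast; ring
    rw [e1, e2, Real.cos_sub, Real.cos_add, cosMode, cosMode]
    ring
  simp_rw [h]
  rw [intervalIntegral.integral_add, intervalIntegral.integral_const_mul,
    intervalIntegral.integral_const_mul, integral_cos_int_mul hL, integral_cos_int_mul hL]
  · by_cases hjk : j = k
    · subst hjk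
      by_cases hj : j = 0
      · simp [hj]; ring
      · have : (j : ℤ) + j ≠ 0 := by omega
        simp [hj]
        ring
    · have h1 : (j : ℤ) - k ≠ 0 := by omega
      have h2 : (j : ℤ) + k ≠ 0 := by omega
      simp [hjk, h1, h2]
  · exact (by fun_prop : Continuous _).intervalIntegrable _ _
  · exact (by fun_prop : Continuous _).intervalIntegrable _ _

lemma integrableOn_mul_of_continuousOn {L : ℝ} {w u : ℝ → ℝ} (hw : IntegrableOn w (Ioo 0 L))
    (hu : ContinuousOn u (Icc 0 L)) : IntegrableOn (fun x => w x * u x) (Ioo 0 L) :=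
  hw.mul_continuousOn_of_subset hu measurableSet_Ioo isCompact_Icc Ioo_subset_Icc_self

/-- Since 2 cos θ sin kθ = sin (k+1)θ + sin (k-1)θ, multiplication by cos θ preserves the span of
the sines, so orthogonality to that span survives multiplication by powers of cos θ. -/
lemma integral_mul_cosMode_pow_mul_sinMode {L : ℝ} {w : ℝ → ℝ}
    (hw : IntegrableOn w (Ioo 0 L)) (h : ∀ k, ∫ x in Ioo 0 L, w x * sinMode L k x = 0) (m : ℕ) :
    ∀ k, ∫ x in Ioo 0 L, w x * (cosMode L 1 x ^ m * sinMode L k x) = 0 := by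
  induction m with
  | zero => simpa using h
  | succ m ih =>
    intro k
    rcases k with _ | k
    · simp [sinMode_zero]
    · have e : ∀ x, w x * (cosMode L 1 x ^ (m + 1) * sinMode L (k + 1) x) =
          1 / 2 * (w x * (cosMode L 1 x ^ m * sinMode L (k + 2) x))
            + 1 / 2 * (w x * (cosMode L 1 x ^ m * sinMode L k x)) := by
        intro x
        have e1 : freq L (k + 2) * x = freq L (k + 1) * x + freq L 1 * x := by
          simp only [freq]; push_cast; ring
        have e2 : freq L k * x = freq L (k + 1) * x - freq L 1 * x := by
          simp only [freq]; push_cast; ring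
        simp only [sinMode, cosMode]
        rw [e1, e2, Real.sin_add, Real.sin_sub, pow_succ]
        ring
      simp_rw [e]
      rw [integral_add, integral_const_mul, integral_const_mul, ih, ih]
      · simp
      · exact (integrableOn_mul_of_continuousOn hw (by fun_prop)).const_mul _
      · exact (integrableOn_mul_of_continuousOn hw (by fun_prop)).const_mul _

/-- The sines are complete in `L₁(0, L)`. -/
lemma ae_eq_zero_of_integral_sinMode {L : ℝ} (hL : 0 < L) {w : ℝ → ℝ}
    (hw : IntegrableOn w (Ioo 0 L)) (h : ∀ k, ∫ x in Ioo 0 L, w x * sinMode L k x = 0) :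
    w =ᵐ[volI L] 0 := by
  -- With θ = πx/L, the function `w` sin θ annihilates every polynomial in cos θ. As cos θ is
  -- injective on `[0, L]`, Weierstrass approximation extends this to all continuous functions.
  -- Finally sin θ > 0 in the interior can be divided out.
  have hpoly : ∀ p : Polynomial ℝ,
      ∫ x in Ioo 0 L, w x * (p.eval (cosMode L 1 x) * sinMode L 1 x) = 0 := by
    intro p
    induction p using Polynomial.induction_on' with
    | add p q hp hq =>
      have : ∀ x, w x * ((p + q).eval (cosMode L 1 x) * sinMode L 1 x) =
          w x * (p.eval (cosMode L 1 x) * sinMode L 1 x)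
            + w x * (q.eval (cosMode L 1 x) * sinMode L 1 x) := fun x => by
        rw [Polynomial.eval_add]; ring
      simp_rw [this]
      rw [integral_add, hp, hq, add_zero]
      · exact integrableOn_mul_of_continuousOn hw
          ((p.continuous.comp (continuous_cosMode L 1)).mul (continuous_sinMode L 1)).continuousOn
      · exact integrableOn_mul_of_continuousOn hw
          ((q.continuous.comp (continuous_cosMode L 1)).mul (continuous_sinMode L 1)).continuousOn
    | monomial m a =>
      have : ∀ x, w x * ((Polynomial.monomial m a).eval (cosMode L 1 x) * sinMode L 1 x) =
          a * (w x * (cosMode L 1 x ^ m * sinMode L 1 x)) := fun x => by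
        rw [Polynomial.eval_monomial]; ring
      simp_rw [this]
      rw [integral_const_mul, integral_mul_cosMode_pow_mul_sinMode hw h, mul_zero]
  have hfreq : ∀ x, freq L 1 * x = Real.pi / L * x := fun x => by simp [freq]
  have hcont : ∀ φ : ℝ → ℝ, Continuous φ →
      ∫ x in Ioo 0 L, w x * sinMode L 1 x * φ x = 0 := by
    intro φ hφ
    have hsm : ∀ ε > 0, |∫ x in Ioo 0 L, w x * sinMode L 1 x * φ x|
        ≤ ε * ∫ x in Ioo 0 L, |w x| := by
      intro ε hε
      -- This is `φ` written in the variable y = cos(πx/L).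
      obtain ⟨p, hp⟩ := exists_polynomial_near_of_continuousOn (-1) 1
        (fun y => φ (Real.arccos y * L / Real.pi))
        (hφ.comp (by fun_prop)).continuousOn ε hε
      have e : ∫ x in Ioo 0 L, w x * sinMode L 1 x * φ x =
          ∫ x in Ioo 0 L, w x * (sinMode L 1 x * (φ x - p.eval (cosMode L 1 x))) := by
        refine Eq.trans ?_ (zero_add _)
        refine Eq.trans ?_ (congrArg (· + _) (hpoly p))
        rw [← integral_add]
        · refine integral_congr_ae (.of_forall fun x => ?_)
          simp only
          ring
        · exact integrableOn_mul_of_continuousOn hw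
            ((p.continuous.comp (continuous_cosMode L 1)).mul
              (continuous_sinMode L 1)).continuousOn
        · exact integrableOn_mul_of_continuousOn hw ((continuous_sinMode L 1).mul
            (hφ.sub (p.continuous.comp (continuous_cosMode L 1)))).continuousOn
      rw [e, ← integral_const_mul]
      refine (abs_integral_le_integral_abs).trans ?_
      refine setIntegral_mono_on ?_ (hw.abs.const_mul ε) measurableSet_Ioo fun x hx => ?_
      · exact (integrableOn_mul_of_continuousOn hw ((continuous_sinMode L 1).mul
          (hφ.sub (p.continuous.comp (continuous_cosMode L 1)))).continuousOn).abs
      · have hx1 : 0 ≤ freq L 1 * x := by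
          rw [hfreq]; have := hx.1; positivity
        have hx2 : freq L 1 * x ≤ Real.pi := by
          rw [hfreq, div_mul_eq_mul_div, div_le_iff₀ hL]
          exact mul_le_mul_of_nonneg_left hx.2.le Real.pi_pos.le
        have h1 := hp (cosMode L 1 x) ⟨Real.neg_one_le_cos _, Real.cos_le_one _⟩
        have h2 : Real.arccos (cosMode L 1 x) * L / Real.pi = x := by
          rw [cosMode, Real.arccos_cos hx1 hx2, hfreq]
          field_simp
        simp only [h2] at h1
        rw [abs_mul, abs_mul, mul_comm ε]
        refine mul_le_mul_of_nonneg_left ?_ (abs_nonneg _)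
        rw [abs_sub_comm]
        calc |sinMode L 1 x| * _ ≤ 1 * ε :=
              mul_le_mul (Real.abs_sin_le_one _) h1.le (abs_nonneg _) zero_le_one
          _ = ε := one_mul _
    by_contra hne
    have hpos : 0 < |∫ x in Ioo 0 L, w x * sinMode L 1 x * φ x| := abs_pos.2 hne
    set A := ∫ x in Ioo 0 L, |w x| with hA
    have hA0 : 0 ≤ A := integral_nonneg fun x => abs_nonneg _
    have := hsm (|∫ x in Ioo 0 L, w x * sinMode L 1 x * φ x| / 2 / (A + 1)) (by positivity)
    rw [div_mul_eq_mul_div, le_div_iff₀ (by positivity)] at this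
    nlinarith
  have hws : IntegrableOn (fun x => w x * sinMode L 1 x) (Ioo 0 L) :=
    integrableOn_mul_of_continuousOn hw (by fun_prop)
  have hz := IsOpen.ae_eq_zero_of_integral_contDiff_smul_eq_zero (μ := volume) isOpen_Ioo
    hws.locallyIntegrableOn (fun φ hφ _ hsupp => by
      rw [← hcont φ hφ.continuous, ← setIntegral_eq_integral_of_forall_compl_eq_zero (s := Ioo 0 L)]
      · refine integral_congr_ae (.of_forall fun x => ?_)
        simp [mul_comm]
      · intro x hx
        rw [image_eq_zero_of_notMem_tsupport fun hx' => hx (hsupp hx'), zero_smul])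
  rw [Filter.EventuallyEq, ae_restrict_iff' measurableSet_Ioo]
  filter_upwards [hz] with x hx hxL
  have h1 := hx hxL
  have h2 : 0 < sinMode L 1 x := by
    refine Real.sin_pos_of_pos_of_lt_pi ?_ ?_
    · rw [hfreq]; have := hxL.1; positivity
    · rw [hfreq, div_mul_eq_mul_div, div_lt_iff₀ hL]
      exact mul_lt_mul_of_pos_left hxL.2 Real.pi_pos
  simpa [h2.ne'] using h1

/-! ### Weak derivatives -/

lemma IsWeakDeriv.ae_eq {L : ℝ} {u v v' : ℝ → ℝ} (hv : IntegrableOn v (Ioo 0 L))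
    (hv' : IntegrableOn v' (Ioo 0 L)) (h : IsWeakDeriv L u v) (h' : IsWeakDeriv L u v') :
    v =ᵐ[volI L] v' := by
  have hz := IsOpen.ae_eq_zero_of_integral_contDiff_smul_eq_zero (μ := volume) isOpen_Ioo
    (hv.sub hv').locallyIntegrableOn (fun φ hφ hc hsupp => by
      rw [← setIntegral_eq_integral_of_forall_compl_eq_zero (s := Ioo 0 L)]
      · have h1 := h φ hφ hc hsupp
        rw [h' φ hφ hc hsupp, neg_inj] at h1
        have h2 : ∀ x, φ x • (v - v') x = v x * φ x - v' x * φ x := fun x => by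
          simp only [Pi.sub_apply, smul_eq_mul]; ring
        simp_rw [h2]
        rw [integral_sub, h1, sub_self]
        · exact integrableOn_mul_of_continuousOn hv hφ.continuous.continuousOn
        · exact integrableOn_mul_of_continuousOn hv' hφ.continuous.continuousOn
      · intro x hx
        rw [image_eq_zero_of_notMem_tsupport fun hx' => hx (hsupp hx'), zero_smul])
  rw [Filter.EventuallyEq, ae_restrict_iff' measurableSet_Ioo]
  filter_upwards [hz] with x hx hxL
  exact sub_eq_zero.1 (hx hxL)

lemma integrableOn_of_memLp {L : ℝ} {u : ℝ → ℝ} (hu : MemLp u 2 (volI L)) :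
    IntegrableOn u (Ioo 0 L) :=
  hu.integrable (by norm_num)

lemma weakDeriv_ae_eq {L : ℝ} {u v : ℝ → ℝ} (hv : MemLp v 2 (volI L)) (h : IsWeakDeriv L u v) :
    weakDeriv L u =ᵐ[volI L] v := by
  have hex : ∃ v : ℝ → ℝ, MemLp v 2 (volI L) ∧ IsWeakDeriv L u v := ⟨v, hv, h⟩
  rw [weakDeriv, dif_pos hex]
  exact IsWeakDeriv.ae_eq (integrableOn_of_memLp hex.choose_spec.1)
    (integrableOn_of_memLp hv) hex.choose_spec.2 h

lemma IsWeakDeriv.add {L : ℝ} {u u' v v' : ℝ → ℝ} (hu : IntegrableOn u (Ioo 0 L))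
    (hu' : IntegrableOn u' (Ioo 0 L)) (hv : IntegrableOn v (Ioo 0 L))
    (hv' : IntegrableOn v' (Ioo 0 L)) (h : IsWeakDeriv L u v) (h' : IsWeakDeriv L u' v') :
    IsWeakDeriv L (fun x => u x + u' x) (fun x => v x + v' x) := by
  intro φ hφ hc hs
  have hφ' : Continuous (deriv φ) := hφ.continuous_deriv (by simp)
  simp_rw [add_mul]
  rw [integral_add, integral_add, h φ hφ hc hs, h' φ hφ hc hs]
  · ring
  · exact integrableOn_mul_of_continuousOn hv hφ.continuous.continuousOn
  · exact integrableOn_mul_of_continuousOn hv' hφ.continuous.continuousOn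
  · exact integrableOn_mul_of_continuousOn hu hφ'.continuousOn
  · exact integrableOn_mul_of_continuousOn hu' hφ'.continuousOn

/-- The definition of `energy` goes through chosen weak derivatives of `u` and of `u + v`; by
uniqueness up to null sets any representatives may be used instead. -/
lemma energy_eq {L : ℝ} (R : ℝ) {u v u₁ v₁ : ℝ → ℝ} (hu : MemLp u 2 (volI L))
    (hv : MemLp v 2 (volI L)) (hu₁ : MemLp u₁ 2 (volI L)) (hv₁ : MemLp v₁ 2 (volI L))
    (h : IsWeakDeriv L u u₁) (h' : IsWeakDeriv L v v₁) :
    energy L R u v = 1 / 2 * ∫ x in Ioo 0 L, (u₁ x ^ 2 + R * (u₁ x + v₁ x) ^ 2) := by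
  rw [energy]
  congr 1
  refine integral_congr_ae ?_
  have hadd := weakDeriv_ae_eq (hu₁.add hv₁) (IsWeakDeriv.add (integrableOn_of_memLp hu)
    (integrableOn_of_memLp hv) (integrableOn_of_memLp hu₁) (integrableOn_of_memLp hv₁) h h')
  filter_upwards [weakDeriv_ae_eq hu₁ h, hadd] with x h1 h2
  rw [h1, h2]
  rfl

/-- A function with vanishing weak derivative is constant. -/
lemma ae_eq_const_of_isWeakDeriv_zero {L : ℝ} (hL : 0 < L) {u : ℝ → ℝ}
    (hu : IntegrableOn u (Ioo 0 L)) (h : IsWeakDeriv L u 0) :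
    ∃ c : ℝ, u =ᵐ[volI L] fun _ => c := by
  -- A normalized bump in the middle of the interval; the constant will be the average of `u`
  -- against it.
  let ρ₀ : ContDiffBump (L / 2) := ⟨L / 8, L / 4, by positivity, by linarith⟩
  let ρ : ℝ → ℝ := ρ₀.normed volume
  have hρ : ContDiff ℝ ∞ ρ := ρ₀.contDiff_normed
  have hρI : ∫ x, ρ x = 1 := ρ₀.integral_normed
  have hρs : tsupport ρ ⊆ Icc (L / 4) (3 * L / 4) := by
    rw [ρ₀.tsupport_normed_eq, Real.closedBall_eq_Icc]
    refine Icc_subset_Icc ?_ ?_ <;> simp only [ρ₀] <;> linarith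
  have hρc : HasCompactSupport ρ := ρ₀.hasCompactSupport_normed
  refine ⟨∫ x in Ioo 0 L, u x * ρ x, ?_⟩
  set c := ∫ x in Ioo 0 L, u x * ρ x with hc
  have hz := IsOpen.ae_eq_zero_of_integral_contDiff_smul_eq_zero (μ := volume) isOpen_Ioo
    (hu.sub (integrableOn_const (C := c) (by simp))).locallyIntegrableOn
    (fun ψ hψ hψc hsupp => by
      obtain ⟨a, b, ha0, hbL, hab⟩ : ∃ a b, 0 < a ∧ b < L ∧
          tsupport ψ ∪ Icc (L / 4) (3 * L / 4) ⊆ Icc a b := by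
        have hK : IsCompact (tsupport ψ ∪ Icc (L / 4) (3 * L / 4)) :=
          hψc.isCompact.union isCompact_Icc
        have hne : (tsupport ψ ∪ Icc (L / 4) (3 * L / 4)).Nonempty :=
          ⟨L / 2, Or.inr ⟨by linarith, by linarith⟩⟩
        have hsub : tsupport ψ ∪ Icc (L / 4) (3 * L / 4) ⊆ Ioo 0 L :=
          union_subset hsupp fun x hx => ⟨by linarith [hx.1], by linarith [hx.2]⟩
        exact ⟨_, _, (hsub (hK.sInf_mem hne)).1, (hsub (hK.sSup_mem hne)).2, fun x hx =>
          ⟨csInf_le hK.bddBelow hx, le_csSup hK.bddAbove hx⟩⟩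
      set m := ∫ x, ψ x with hm
      -- Subtracting the right multiple of `ρ` makes the mean vanish, so the primitive `φ` of `η` is
      -- zero outside `[a, b]` and is an admissible test function with derivative `η`.
      let η : ℝ → ℝ := fun x => ψ x - m * ρ x
      have hη : ContDiff ℝ ∞ η := hψ.sub (contDiff_const.mul hρ)
      have hη0 : ∀ x, x ∉ Icc a b → η x = 0 := fun x hx => by
        have h1 : ψ x = 0 := image_eq_zero_of_notMem_tsupport fun h => hx (hab (Or.inl h))
        have h2 : ρ x = 0 := image_eq_zero_of_notMem_tsupport fun h => hx (hab (Or.inr (hρs h)))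
        simp [η, h1, h2]
      have hηI : ∫ x, η x = 0 := by
        have h1 : Integrable ψ := hψ.continuous.integrable_of_hasCompactSupport hψc
        have h2 : Integrable ρ := hρ.continuous.integrable_of_hasCompactSupport hρc
        rw [integral_sub h1 (h2.const_mul m), integral_const_mul, hρI, mul_one, hm, sub_self]
      let φ : ℝ → ℝ := fun x => ∫ y in (0)..x, η y
      have hφd : ∀ x, HasDerivAt φ (η x) x := fun x =>
        intervalIntegral.integral_hasDerivAt_right (hη.continuous.intervalIntegrable _ _)
          hη.continuous.stronglyMeasurable.stronglyMeasurableAtFilter hη.continuous.continuousAt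
      have hφ' : deriv φ = η := funext fun x => (hφd x).deriv
      have hφ : ContDiff ℝ ∞ φ := by
        rw [contDiff_infty_iff_deriv]
        exact ⟨fun x => (hφd x).differentiableAt, hφ' ▸ hη⟩
      have hφ0 : ∀ x, x ∉ Icc a b → φ x = 0 := by
        intro x hx
        rcases lt_or_ge x a with hxa | hxa
        · have h0 : ∀ y ∈ uIcc 0 x, η y = 0 := fun y hy =>
            hη0 y fun hy' => by
              rcases mem_uIcc.1 hy with h | h <;> linarith [hy'.1]
          change ∫ y in (0)..x, η y = 0
          rw [intervalIntegral.integral_congr (g := fun _ => 0) h0]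
          simp
        · have hxb : b < x := not_le.1 fun h => hx ⟨hxa, h⟩
          have hx0 : 0 ≤ x := by linarith
          change ∫ y in (0)..x, η y = 0
          rw [intervalIntegral.integral_of_le hx0,
            setIntegral_eq_integral_of_forall_compl_eq_zero, hηI]
          intro y hy
          exact hη0 y fun hy' => hy ⟨by linarith [hy'.1], by linarith [hy'.2]⟩
      have hφs : tsupport φ ⊆ Icc a b := closure_minimal
        (fun x hx => by_contra fun h => hx (hφ0 x h)) isClosed_Icc
      have hφc : HasCompactSupport φ := HasCompactSupport.intro isCompact_Icc hφ0
      have key := h φ hφ hφc (hφs.trans fun x hx => ⟨by linarith [hx.1], by linarith [hx.2]⟩)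
      rw [hφ'] at key
      simp only [Pi.zero_apply, zero_mul, integral_zero, neg_zero] at key
      have e1 : ∫ x in Ioo 0 L, u x * η x = (∫ x in Ioo 0 L, u x * ψ x) - m * c := by
        rw [hc, ← integral_const_mul, ← integral_sub]
        · refine integral_congr_ae (.of_forall fun x => ?_)
          simp only [η]
          ring
        · exact integrableOn_mul_of_continuousOn hu hψ.continuous.continuousOn
        · exact (integrableOn_mul_of_continuousOn hu hρ.continuous.continuousOn).const_mul _
      have hψm : m = ∫ x in Ioo 0 L, ψ x := by
        rw [hm, setIntegral_eq_integral_of_forall_compl_eq_zero]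
        intro x hx
        exact image_eq_zero_of_notMem_tsupport fun hx' => hx (hsupp hx')
      rw [← setIntegral_eq_integral_of_forall_compl_eq_zero (s := Ioo 0 L)]
      · have h2 : ∀ x, ψ x • (u x - c) = u x * ψ x - ψ x * c := fun x => by
          simp only [smul_eq_mul]; ring
        simp only [Pi.sub_apply, h2]
        rw [integral_sub, integral_mul_const, ← hψm]
        · linarith
        · exact integrableOn_mul_of_continuousOn hu hψ.continuous.continuousOn
        · exact ((hψ.continuous.integrable_of_hasCompactSupport hψc).mul_const c).integrableOn
      · intro x hx
        rw [image_eq_zero_of_notMem_tsupport fun hx' => hx (hsupp hx'), zero_smul])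
  rw [Filter.EventuallyEq, ae_restrict_iff' measurableSet_Ioo]
  filter_upwards [hz] with x hx hxL
  exact sub_eq_zero.1 (hx hxL)

/-! ### Currents and fluxes

The mobilities are written in terms of `a` and `b`, the square roots of the two film heights, and
`y`, `z` stand for the third derivatives of the heights. -/

/-- The current `j_f`. -/
def curF (R a b y z : ℝ) : ℝ := a * (a ^ 2 * y + R / 2 * (2 * a ^ 2 + 3 * b ^ 2) * (y + z))

/-- The current `j_g`. -/
def curG (b y z : ℝ) : ℝ := b ^ 3 * (y + z)

/-- The current `j_{f,g}`. -/
def curFG (a b y z : ℝ) : ℝ := a * b ^ 2 * (y + z)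

/-- The flux `H_f` as a function of the currents. -/
def hF (a jf : ℝ) : ℝ := a ^ 3 * jf

/-- The flux `H_g` as a function of the currents. -/
def hG (R μ a b jf jg jfg : ℝ) : ℝ :=
  μ * R * b ^ 3 * jg + 3 * R / 4 * (a * b ^ 2 * jfg) + 3 / 2 * (a * b ^ 2 * jf)

/-- The density of the energy dissipation. -/
def dissip (R μ jf jg jfg : ℝ) : ℝ := μ * R ^ 2 * jg ^ 2 + 3 * R ^ 2 / 4 * jfg ^ 2 + jf ^ 2

lemma dissip_nonneg {R μ : ℝ} (hμ : 0 < μ) (jf jg jfg : ℝ) :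
    0 ≤ dissip R μ jf jg jfg := by
  unfold dissip
  positivity

/-- The identity behind all estimates. The factors `y + R * (y + z)` and `R * (y + z)` are minus the
x-derivatives of the variational derivatives of the energy. Being polynomial in `a` and `b`, it
holds whatever stands in for the square roots. It works because `a ^ 3 * (y + R * (y + z))` and the
`jf` part of the second product add up to exactly the current `jf`. -/
lemma flux_mul_eq_dissip (R μ a b y z : ℝ) :
    hF a (curF R a b y z) * (y + R * (y + z))
      + hG R μ a b (curF R a b y z) (curG b y z) (curFG a b y z) * (R * (y + z))
      = dissip R μ (curF R a b y z) (curG b y z) (curFG a b y z) := by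
  simp only [hF, hG, dissip, curF, curG, curFG]
  ring

/-! ### Cosine sums -/

/-- The cosine sum with coefficients `c`. -/
def trig (L : ℝ) {N : ℕ} (c : Fin N → ℝ) (x : ℝ) : ℝ := ∑ k, c k * cosMode L k x

/-- The first derivative of `trig`. -/
def trig₁ (L : ℝ) {N : ℕ} (c : Fin N → ℝ) (x : ℝ) : ℝ := ∑ k, -(c k * freq L k * sinMode L k x)

/-- The second derivative of `trig`. -/
def trig₂ (L : ℝ) {N : ℕ} (c : Fin N → ℝ) (x : ℝ) : ℝ :=
  ∑ k, -(c k * freq L k ^ 2 * cosMode L k x)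

/-- The third derivative of `trig`. -/
def trig₃ (L : ℝ) {N : ℕ} (c : Fin N → ℝ) (x : ℝ) : ℝ := ∑ k, c k * freq L k ^ 3 * sinMode L k x

lemma hasDerivAt_trig (L : ℝ) {N : ℕ} (c : Fin N → ℝ) (x : ℝ) :
    HasDerivAt (trig L c) (trig₁ L c x) x :=
  HasDerivAt.fun_sum fun k _ => ((hasDerivAt_cosMode L k x).const_mul (c k)).congr_deriv (by ring)

lemma hasDerivAt_trig₁ (L : ℝ) {N : ℕ} (c : Fin N → ℝ) (x : ℝ) :
    HasDerivAt (trig₁ L c) (trig₂ L c x) x :=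
  HasDerivAt.fun_sum fun k _ =>
    (((hasDerivAt_sinMode L k x).const_mul (c k * freq L k)).neg).congr_deriv (by ring)

lemma hasDerivAt_trig₂ (L : ℝ) {N : ℕ} (c : Fin N → ℝ) (x : ℝ) :
    HasDerivAt (trig₂ L c) (trig₃ L c x) x :=
  HasDerivAt.fun_sum fun k _ =>
    (((hasDerivAt_cosMode L k x).const_mul (c k * freq L k ^ 2)).neg).congr_deriv (by ring)

lemma contDiff_trig (L : ℝ) (N : ℕ) {n : WithTop ℕ∞} :
    ContDiff ℝ n (fun p : (Fin N → ℝ) × ℝ => trig L p.1 p.2) := by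
  unfold trig
  fun_prop

lemma contDiff_trig₁ (L : ℝ) (N : ℕ) {n : WithTop ℕ∞} :
    ContDiff ℝ n (fun p : (Fin N → ℝ) × ℝ => trig₁ L p.1 p.2) := by
  unfold trig₁
  fun_prop

lemma contDiff_trig₂ (L : ℝ) (N : ℕ) {n : WithTop ℕ∞} :
    ContDiff ℝ n (fun p : (Fin N → ℝ) × ℝ => trig₂ L p.1 p.2) := by
  unfold trig₂
  fun_prop

lemma contDiff_trig₃ (L : ℝ) (N : ℕ) {n : WithTop ℕ∞} :
    ContDiff ℝ n (fun p : (Fin N → ℝ) × ℝ => trig₃ L p.1 p.2) := by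
  unfold trig₃
  fun_prop

lemma trig_sub (L : ℝ) {N : ℕ} (c d : Fin N → ℝ) (x : ℝ) :
    trig L (c - d) x = trig L c x - trig L d x := by
  simp [trig, sub_mul, Finset.sum_sub_distrib]

lemma trig₁_sub (L : ℝ) {N : ℕ} (c d : Fin N → ℝ) (x : ℝ) :
    trig₁ L (c - d) x = trig₁ L c x - trig₁ L d x := by
  simp only [trig₁, ← Finset.sum_sub_distrib]
  exact Finset.sum_congr rfl fun k _ => by simp only [Pi.sub_apply]; ring

lemma trig₁_add (L : ℝ) {N : ℕ} (c d : Fin N → ℝ) (x : ℝ) :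
    trig₁ L (c + d) x = trig₁ L c x + trig₁ L d x := by
  simp only [trig₁, ← Finset.sum_add_distrib]
  exact Finset.sum_congr rfl fun k _ => by simp only [Pi.add_apply]; ring

@[fun_prop]
lemma continuous_trig (L : ℝ) {N : ℕ} (c : Fin N → ℝ) : Continuous (trig L c) := by
  unfold trig
  fun_prop

@[fun_prop]
lemma continuous_trig₁ (L : ℝ) {N : ℕ} (c : Fin N → ℝ) : Continuous (trig₁ L c) := by
  unfold trig₁
  fun_prop

lemma integral_trig_mul_cosMode {L : ℝ} (hL : 0 < L) {N : ℕ} (c : Fin N → ℝ) (j : Fin N) :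
    ∫ x in (0)..L, trig L c x * cosMode L j x = c j * (if (j : ℕ) = 0 then L else L / 2) := by
  simp only [trig, Finset.sum_mul]
  rw [intervalIntegral.integral_finsetSum fun k _ =>
    (by fun_prop : Continuous _).intervalIntegrable _ _]
  simp_rw [mul_assoc, intervalIntegral.integral_const_mul, integral_cosMode_mul_cosMode hL]
  rw [Finset.sum_eq_single j]
  · simp
  · intro k _ hk
    rw [if_neg (fun h => hk (Fin.ext h)), mul_zero]
  · simp

lemma integral_trig₁_mul_sinMode {L : ℝ} (hL : 0 < L) {N : ℕ} (c : Fin N → ℝ) (j : Fin N) :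
    ∫ x in (0)..L, trig₁ L c x * sinMode L j x = -(c j * freq L j * (L / 2)) := by
  simp only [trig₁, Finset.sum_mul, neg_mul]
  rw [intervalIntegral.integral_finsetSum fun k _ =>
    (by fun_prop : Continuous _).intervalIntegrable _ _]
  simp_rw [intervalIntegral.integral_neg, mul_assoc, intervalIntegral.integral_const_mul,
    integral_sinMode_mul_sinMode hL]
  rw [Finset.sum_eq_single j]
  · by_cases h : (j : ℕ) = 0
    · simp [h, freq_zero]
    · simp [h]
  · intro k _ hk
    rw [if_neg (fun h => hk (Fin.ext h)), mul_zero, mul_zero, neg_zero]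
  · simp

lemma integral_trig_sq {L : ℝ} (hL : 0 < L) {N : ℕ} (c : Fin N → ℝ) :
    ∫ x in (0)..L, trig L c x ^ 2 = ∑ k, c k ^ 2 * (if (k : ℕ) = 0 then L else L / 2) := by
  have : ∀ x, trig L c x ^ 2 = ∑ k, c k * (trig L c x * cosMode L k x) := fun x => by
    rw [sq]
    nth_rw 2 [trig]
    rw [Finset.mul_sum]
    exact Finset.sum_congr rfl fun k _ => by ring
  simp_rw [this]
  rw [intervalIntegral.integral_finsetSum fun k _ =>
    (by fun_prop : Continuous _).intervalIntegrable _ _]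
  simp_rw [intervalIntegral.integral_const_mul, integral_trig_mul_cosMode hL]
  exact Finset.sum_congr rfl fun k _ => by ring

lemma integral_trig₁_sq {L : ℝ} (hL : 0 < L) {N : ℕ} (c : Fin N → ℝ) :
    ∫ x in (0)..L, trig₁ L c x ^ 2 = ∑ k : Fin N, L / 2 * (freq L k ^ 2 * c k ^ 2) := by
  have : ∀ x, trig₁ L c x ^ 2 =
      ∑ k : Fin N, -(c k * freq L k) * (trig₁ L c x * sinMode L k x) := fun x => by
    rw [sq]
    nth_rw 2 [trig₁]
    rw [Finset.mul_sum]
    exact Finset.sum_congr rfl fun k _ => by ring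
  simp_rw [this]
  rw [intervalIntegral.integral_finsetSum fun k _ =>
    (by fun_prop : Continuous _).intervalIntegrable _ _]
  simp_rw [intervalIntegral.integral_const_mul, integral_trig₁_mul_sinMode hL]
  exact Finset.sum_congr rfl fun k _ => by ring

/-- The energy of a pair of cosine sums, in terms of the coefficients. -/
def trigEnergy (L R : ℝ) {N : ℕ} (c d : Fin N → ℝ) : ℝ :=
  L / 4 * ∑ k : Fin N, freq L k ^ 2 * (c k ^ 2 + R * (c k + d k) ^ 2)

lemma trigEnergy_eq {L : ℝ} (hL : 0 < L) (R : ℝ) {N : ℕ} (c d : Fin N → ℝ) :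
    trigEnergy L R c d =
      1 / 2 * ((∫ x in (0)..L, trig₁ L c x ^ 2) + R * ∫ x in (0)..L, trig₁ L (c + d) x ^ 2) := by
  rw [integral_trig₁_sq hL, integral_trig₁_sq hL, trigEnergy, Finset.mul_sum, Finset.mul_sum,
    ← Finset.sum_add_distrib, Finset.mul_sum]
  exact Finset.sum_congr rfl fun k _ => by simp only [Pi.add_apply]; ring

/-! ### Galerkin approximations -/

/-- The flux `H_f` of a pair of cosine sums; `A` is a regularization of the square root. -/
def galF (L R : ℝ) (A : ℝ → ℝ) {N : ℕ} (c d : Fin N → ℝ) (x : ℝ) : ℝ :=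
  hF (A (trig L c x)) (curF R (A (trig L c x)) (A (trig L d x)) (trig₃ L c x) (trig₃ L d x))

/-- The flux `H_g` of a pair of cosine sums. -/
def galG (L R μ : ℝ) (A : ℝ → ℝ) {N : ℕ} (c d : Fin N → ℝ) (x : ℝ) : ℝ :=
  hG R μ (A (trig L c x)) (A (trig L d x))
    (curF R (A (trig L c x)) (A (trig L d x)) (trig₃ L c x) (trig₃ L d x))
    (curG (A (trig L d x)) (trig₃ L c x) (trig₃ L d x))
    (curFG (A (trig L c x)) (A (trig L d x)) (trig₃ L c x) (trig₃ L d x))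

/-- The energy dissipation of a pair of cosine sums. -/
def galD (L R μ : ℝ) (A : ℝ → ℝ) {N : ℕ} (c d : Fin N → ℝ) (x : ℝ) : ℝ :=
  dissip R μ (curF R (A (trig L c x)) (A (trig L d x)) (trig₃ L c x) (trig₃ L d x))
    (curG (A (trig L d x)) (trig₃ L c x) (trig₃ L d x))
    (curFG (A (trig L c x)) (A (trig L d x)) (trig₃ L c x) (trig₃ L d x))

lemma contDiff_galF (L R : ℝ) {A : ℝ → ℝ} (hA : ContDiff ℝ 1 A) (N : ℕ) :
    ContDiff ℝ 1 (fun p : ((Fin N → ℝ) × (Fin N → ℝ)) × ℝ => galF L R A p.1.1 p.1.2 p.2) := by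
  have h1 : ContDiff ℝ 1 (fun p : ((Fin N → ℝ) × (Fin N → ℝ)) × ℝ => trig L p.1.1 p.2) :=
    (contDiff_trig L N).comp (contDiff_fst.fst.prodMk contDiff_snd)
  have h2 : ContDiff ℝ 1 (fun p : ((Fin N → ℝ) × (Fin N → ℝ)) × ℝ => trig L p.1.2 p.2) :=
    (contDiff_trig L N).comp (contDiff_fst.snd.prodMk contDiff_snd)
  have h3 : ContDiff ℝ 1 (fun p : ((Fin N → ℝ) × (Fin N → ℝ)) × ℝ => trig₃ L p.1.1 p.2) :=
    (contDiff_trig₃ L N).comp (contDiff_fst.fst.prodMk contDiff_snd)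
  have h4 : ContDiff ℝ 1 (fun p : ((Fin N → ℝ) × (Fin N → ℝ)) × ℝ => trig₃ L p.1.2 p.2) :=
    (contDiff_trig₃ L N).comp (contDiff_fst.snd.prodMk contDiff_snd)
  have h5 := hA.comp h1
  have h6 := hA.comp h2
  simp only [Function.comp_def] at h5 h6
  unfold galF hF curF
  fun_prop

lemma contDiff_galG (L R μ : ℝ) {A : ℝ → ℝ} (hA : ContDiff ℝ 1 A) (N : ℕ) :
    ContDiff ℝ 1 (fun p : ((Fin N → ℝ) × (Fin N → ℝ)) × ℝ => galG L R μ A p.1.1 p.1.2 p.2) := by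
  have h1 : ContDiff ℝ 1 (fun p : ((Fin N → ℝ) × (Fin N → ℝ)) × ℝ => trig L p.1.1 p.2) :=
    (contDiff_trig L N).comp (contDiff_fst.fst.prodMk contDiff_snd)
  have h2 : ContDiff ℝ 1 (fun p : ((Fin N → ℝ) × (Fin N → ℝ)) × ℝ => trig L p.1.2 p.2) :=
    (contDiff_trig L N).comp (contDiff_fst.snd.prodMk contDiff_snd)
  have h3 : ContDiff ℝ 1 (fun p : ((Fin N → ℝ) × (Fin N → ℝ)) × ℝ => trig₃ L p.1.1 p.2) :=
    (contDiff_trig₃ L N).comp (contDiff_fst.fst.prodMk contDiff_snd)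
  have h4 : ContDiff ℝ 1 (fun p : ((Fin N → ℝ) × (Fin N → ℝ)) × ℝ => trig₃ L p.1.2 p.2) :=
    (contDiff_trig₃ L N).comp (contDiff_fst.snd.prodMk contDiff_snd)
  have h5 := hA.comp h1
  have h6 := hA.comp h2
  simp only [Function.comp_def] at h5 h6
  unfold galG hG curF curG curFG
  fun_prop

lemma continuous_galD (L R μ : ℝ) {A : ℝ → ℝ} (hA : Continuous A) (N : ℕ) :
    Continuous (fun p : ((Fin N → ℝ) × (Fin N → ℝ)) × ℝ => galD L R μ A p.1.1 p.1.2 p.2) := by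
  have h1 : Continuous (fun p : ((Fin N → ℝ) × (Fin N → ℝ)) × ℝ => trig L p.1.1 p.2) :=
    ((contDiff_trig L N (n := 0)).comp (contDiff_fst.fst.prodMk contDiff_snd)).continuous
  have h2 : Continuous (fun p : ((Fin N → ℝ) × (Fin N → ℝ)) × ℝ => trig L p.1.2 p.2) :=
    ((contDiff_trig L N (n := 0)).comp (contDiff_fst.snd.prodMk contDiff_snd)).continuous
  have h3 : Continuous (fun p : ((Fin N → ℝ) × (Fin N → ℝ)) × ℝ => trig₃ L p.1.1 p.2) :=
    ((contDiff_trig₃ L N (n := 0)).comp (contDiff_fst.fst.prodMk contDiff_snd)).continuous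
  have h4 : Continuous (fun p : ((Fin N → ℝ) × (Fin N → ℝ)) × ℝ => trig₃ L p.1.2 p.2) :=
    ((contDiff_trig₃ L N (n := 0)).comp (contDiff_fst.snd.prodMk contDiff_snd)).continuous
  unfold galD dissip curF curG curFG
  fun_prop

lemma sub_eq_integral_of_hasDerivWithinAt {T : ℝ} {u u' : ℝ → ℝ}
    (hu : ∀ t ∈ Icc 0 T, HasDerivWithinAt u (u' t) (Icc 0 T) t) (hu' : ContinuousOn u' (Icc 0 T))
    {s t : ℝ} (hs : s ∈ Icc 0 T) (ht : t ∈ Icc 0 T) : u t - u s = ∫ τ in s..t, u' τ := by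
  have hsub : uIcc s t ⊆ Icc 0 T := uIcc_subset_Icc hs ht
  refine (intervalIntegral.integral_eq_sub_of_hasDeriv_right
    (fun x hx => ((hu x (hsub hx)).continuousWithinAt).mono hsub) (fun x hx => ?_)
    (hu'.mono hsub).intervalIntegrable).symm
  have hx' : x ∈ uIcc s t := Ioo_subset_Icc_self hx
  have hlo : 0 < x := (le_min hs.1 ht.1).trans_lt hx.1
  have hhi : x < T := hx.2.trans_le (max_le hs.2 ht.2)
  exact ((hu x (hsub hx')).hasDerivAt (Icc_mem_nhds hlo hhi)).hasDerivWithinAt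

/-- The Galerkin energy identity is exact because the third derivatives paired with the fluxes lie
in the span of the sines used as test functions. The factor `χ` is carried along so that the
identity also covers the cut-off system. The coefficient `2 / L` is the normalization of the modes
with k ≥ 1; it is harmless for k = 0, where the frequency vanishes. -/
lemma hasDerivWithinAt_trigEnergy {L : ℝ} (hL : 0 < L) (R μ : ℝ) {A : ℝ → ℝ}
    (hA : ContDiff ℝ 1 A) {N : ℕ} {c d : ℝ → Fin N → ℝ} {s : Set ℝ} {t χ : ℝ}
    (hc : ∀ k, HasDerivWithinAt (fun t => c t k)
      (χ * ∫ x in (0)..L, -(2 / L) * (galF L R A (c t) (d t) x * (freq L k * sinMode L k x))) s t)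
    (hd : ∀ k, HasDerivWithinAt (fun t => d t k)
      (χ * ∫ x in (0)..L, -(2 / L) * (galG L R μ A (c t) (d t) x * (freq L k * sinMode L k x)))
        s t) :
    HasDerivWithinAt (fun t => trigEnergy L R (c t) (d t))
      (-(χ * ∫ x in (0)..L, galD L R μ A (c t) (d t) x)) s t := by
  have hpair : Continuous fun x : ℝ => ((c t, d t), x) := by fun_prop
  have hcF : Continuous (galF L R A (c t) (d t)) := by
    have h := (contDiff_galF L R hA N).continuous.comp hpair
    simp only [Function.comp_def] at h
    exact h
  have hcG : Continuous (galG L R μ A (c t) (d t)) := by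
    have h := (contDiff_galG L R μ hA N).continuous.comp hpair
    simp only [Function.comp_def] at h
    exact h
  have hterm : ∀ k : Fin N, HasDerivWithinAt
      (fun t => freq L k ^ 2 * (c t k ^ 2 + R * (c t k + d t k) ^ 2)) _ s t := fun k =>
    ((((hc k).fun_pow 2).fun_add ((((hc k).fun_add (hd k)).fun_pow 2).const_mul R)).const_mul
      (freq L k ^ 2))
  have hsum := HasDerivWithinAt.fun_sum (u := Finset.univ) fun (k : Fin N) _ => hterm k
  refine (hsum.const_mul (L / 4)).congr_deriv ?_
  -- Expand the two third derivatives in sines after replacing the dissipation by the paired fluxes.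
  have e : ∀ x, galD L R μ A (c t) (d t) x = ∑ k : Fin N,
      (freq L k ^ 2 * (c t k + R * (c t k + d t k))
          * (galF L R A (c t) (d t) x * (freq L k * sinMode L k x))
        + freq L k ^ 2 * (R * (c t k + d t k))
          * (galG L R μ A (c t) (d t) x * (freq L k * sinMode L k x))) := by
    intro x
    rw [galD, ← flux_mul_eq_dissip]
    change galF L R A (c t) (d t) x * _ + galG L R μ A (c t) (d t) x * _ = _
    have e3 : trig₃ L (c t) x + trig₃ L (d t) x
        = ∑ k : Fin N, (c t k + d t k) * freq L k ^ 3 * sinMode L k x := by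
      simp only [trig₃, ← Finset.sum_add_distrib]
      exact Finset.sum_congr rfl fun k _ => by ring
    rw [e3, trig₃, Finset.mul_sum, ← Finset.sum_add_distrib, Finset.mul_sum, Finset.mul_sum,
      ← Finset.sum_add_distrib]
    exact Finset.sum_congr rfl fun k _ => by ring
  simp_rw [e]
  rw [intervalIntegral.integral_finsetSum fun k _ =>
    (by fun_prop : Continuous _).intervalIntegrable _ _, Finset.mul_sum, Finset.mul_sum,
    ← Finset.sum_neg_distrib]
  refine Finset.sum_congr rfl fun k _ => ?_
  rw [intervalIntegral.integral_add ((by fun_prop : Continuous _).intervalIntegrable _ _)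
    ((by fun_prop : Continuous _).intervalIntegrable _ _)]
  simp only [intervalIntegral.integral_const_mul]
  field_simp
  ring

/-- Every nonconstant mode has frequency at least `freq L 1`, so the energy controls `c k` and `c k
+ d k`. The constant mode is invisible to the energy and is treated separately, by conservation of
mass. -/
lemma abs_coeff_le_of_trigEnergy_le {L R E : ℝ} (hL : 0 < L) (hR : 0 < R) {N : ℕ}
    {c d : Fin N → ℝ} (h : trigEnergy L R c d ≤ E) {k : Fin N} (hk : (k : ℕ) ≠ 0) :
    |c k| ≤ Real.sqrt (4 * E / (L * freq L 1 ^ 2)) ∧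
      |c k + d k| ≤ Real.sqrt (4 * E / (L * freq L 1 ^ 2) / R) := by
  have hf1 : 0 < freq L 1 := freq_pos hL one_ne_zero
  have hfk : freq L 1 ≤ freq L k := by
    have : (1 : ℝ) ≤ (k : ℕ) := by exact_mod_cast Nat.one_le_iff_ne_zero.2 hk
    unfold freq
    gcongr
    simpa using this
  have hterm : freq L k ^ 2 * (c k ^ 2 + R * (c k + d k) ^ 2) ≤
      ∑ k : Fin N, freq L k ^ 2 * (c k ^ 2 + R * (c k + d k) ^ 2) :=
    Finset.single_le_sum (f := fun k : Fin N => freq L k ^ 2 * (c k ^ 2 + R * (c k + d k) ^ 2))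
      (fun j _ => by positivity) (Finset.mem_univ k)
  have h1 : freq L 1 ^ 2 * (c k ^ 2 + R * (c k + d k) ^ 2) ≤
      freq L k ^ 2 * (c k ^ 2 + R * (c k + d k) ^ 2) := by gcongr
  have h2 : L * freq L 1 ^ 2 * (c k ^ 2 + R * (c k + d k) ^ 2) ≤ 4 * E := by
    unfold trigEnergy at h
    have := mul_le_mul_of_nonneg_left (h1.trans hterm) hL.le
    nlinarith
  have h3 : c k ^ 2 + R * (c k + d k) ^ 2 ≤ 4 * E / (L * freq L 1 ^ 2) := by
    rw [le_div_iff₀ (by positivity)]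
    linarith
  refine ⟨Real.abs_le_sqrt (le_trans ?_ h3), Real.abs_le_sqrt ?_⟩
  · nlinarith [mul_nonneg hR.le (sq_nonneg (c k + d k))]
  · rw [le_div_iff₀ hR]
    nlinarith [sq_nonneg (c k)]

/-- Galerkin approximations on `[0, T]`, extended to all times by constants. -/
lemma exists_galerkin {L R μ : ℝ} (hL : 0 < L) (hR : 0 < R) (hμ : 0 < μ) {A : ℝ → ℝ}
    (hA : ContDiff ℝ 1 A) {N : ℕ} (c₀ d₀ : Fin N → ℝ) {T : ℝ} (hT : 0 ≤ T) :
    ∃ c d : ℝ → Fin N → ℝ, Continuous c ∧ Continuous d ∧ c 0 = c₀ ∧ d 0 = d₀ ∧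
      (∀ t, c t = c (projIcc 0 T hT t) ∧ d t = d (projIcc 0 T hT t)) ∧
      (∀ t ∈ Icc 0 T, trigEnergy L R (c t) (d t)
        + ∫ τ in (0)..t, ∫ x in (0)..L, galD L R μ A (c τ) (d τ) x = trigEnergy L R c₀ d₀) ∧
      ∀ s ∈ Icc 0 T, ∀ t ∈ Icc 0 T, ∀ k,
        c t k - c s k = ∫ τ in s..t, ∫ x in (0)..L,
          -(2 / L) * (galF L R A (c τ) (d τ) x * (freq L k * sinMode L k x)) ∧
        d t k - d s k = ∫ τ in s..t, ∫ x in (0)..L,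
          -(2 / L) * (galG L R μ A (c τ) (d τ) x * (freq L k * sinMode L k x)) := by
  let G : ((Fin N → ℝ) × (Fin N → ℝ)) × ℝ → (Fin N → ℝ) × (Fin N → ℝ) := fun p =>
    (fun k => -(2 / L) * (galF L R A p.1.1 p.1.2 p.2 * (freq L k * sinMode L k p.2)),
      fun k => -(2 / L) * (galG L R μ A p.1.1 p.1.2 p.2 * (freq L k * sinMode L k p.2)))
  have hGF := contDiff_galF L R hA N
  have hGG := contDiff_galG L R μ hA N
  have hG : ContDiff ℝ 1 G :=
    (contDiff_pi.2 fun k => by fun_prop).prodMk (contDiff_pi.2 fun k => by fun_prop)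
  set E := trigEnergy L R c₀ d₀ with hE
  set ρ₁ := Real.sqrt (4 * E / (L * freq L 1 ^ 2)) with hρ₁
  set ρ₂ := Real.sqrt (4 * E / (L * freq L 1 ^ 2) / R) with hρ₂
  have hρ₁0 : 0 ≤ ρ₁ := Real.sqrt_nonneg _
  have hρ₂0 : 0 ≤ ρ₂ := Real.sqrt_nonneg _
  -- The radius depends on the initial data only: `ρ₁` and `ρ₁ + ρ₂` bound the nonconstant
  -- coefficients of the two components at energy at most `E`, and the norms bound the constant
  -- modes, which are conserved.
  obtain ⟨χ, hχ0, hχ1, y, hy0, hy⟩ := exists_cutoff_flow G hG hL.le (c₀, d₀)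
    (ρ₁ + ρ₂ + ‖c₀‖ + ‖d₀‖) hT
  have hinteg : ∀ p, IntervalIntegrable (fun x => G (p, x)) volume 0 L := fun p =>
    (hG.continuous.comp (by fun_prop)).intervalIntegrable _ _
  have hcomp₁ : ∀ p k, (∫ x in (0)..L, G (p, x)).1 k =
      ∫ x in (0)..L, -(2 / L) * (galF L R A p.1 p.2 x * (freq L k * sinMode L k x)) := fun p k =>
    (((ContinuousLinearMap.proj (R := ℝ) (φ := fun _ : Fin N => ℝ) k).comp
      (ContinuousLinearMap.fst ℝ (Fin N → ℝ) (Fin N → ℝ))).intervalIntegral_comp_comm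
        (hinteg p)).symm
  have hcomp₂ : ∀ p k, (∫ x in (0)..L, G (p, x)).2 k =
      ∫ x in (0)..L, -(2 / L) * (galG L R μ A p.1 p.2 x * (freq L k * sinMode L k x)) := fun p k =>
    (((ContinuousLinearMap.proj (R := ℝ) (φ := fun _ : Fin N => ℝ) k).comp
      (ContinuousLinearMap.snd ℝ (Fin N → ℝ) (Fin N → ℝ))).intervalIntegral_comp_comm
        (hinteg p)).symm
  have hyc : ContinuousOn y (Icc 0 T) := fun t ht => (hy t ht).continuousWithinAt
  have hc : ∀ t ∈ Icc 0 T, ∀ k, HasDerivWithinAt (fun t => (y t).1 k)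
      (χ (y t) * ∫ x in (0)..L,
        -(2 / L) * (galF L R A (y t).1 (y t).2 x * (freq L k * sinMode L k x))) (Icc 0 T) t := by
    intro t ht k
    rw [← hcomp₁]
    exact ((ContinuousLinearMap.proj (R := ℝ) (φ := fun _ : Fin N => ℝ) k).comp
      (ContinuousLinearMap.fst ℝ (Fin N → ℝ) (Fin N → ℝ))).hasFDerivAt.comp_hasDerivWithinAt t
        (hy t ht)
  have hd : ∀ t ∈ Icc 0 T, ∀ k, HasDerivWithinAt (fun t => (y t).2 k)
      (χ (y t) * ∫ x in (0)..L,
        -(2 / L) * (galG L R μ A (y t).1 (y t).2 x * (freq L k * sinMode L k x)))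
        (Icc 0 T) t := by
    intro t ht k
    rw [← hcomp₂]
    exact ((ContinuousLinearMap.proj (R := ℝ) (φ := fun _ : Fin N => ℝ) k).comp
      (ContinuousLinearMap.snd ℝ (Fin N → ℝ) (Fin N → ℝ))).hasFDerivAt.comp_hasDerivWithinAt t
        (hy t ht)
  have hen : ∀ t ∈ Icc 0 T, HasDerivWithinAt (fun t => trigEnergy L R (y t).1 (y t).2)
      (-(χ (y t) * ∫ x in (0)..L, galD L R μ A (y t).1 (y t).2 x)) (Icc 0 T) t := fun t ht =>
    hasDerivWithinAt_trigEnergy hL R μ hA (c := fun t => (y t).1) (d := fun t => (y t).2)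
      (hc t ht) (hd t ht)
  have h0T : (0 : ℝ) ∈ Icc 0 T := ⟨le_rfl, hT⟩
  -- The energy decreases for any nonnegative cutoff, so the a priori bound is available before the
  -- cutoff is known to be inactive.
  have hanti : AntitoneOn (fun t => trigEnergy L R (y t).1 (y t).2) (Icc 0 T) := by
    refine antitoneOn_of_hasDerivWithinAt_nonpos (convex_Icc 0 T)
      (fun t ht => (hen t ht).continuousWithinAt)
      (fun t ht => (hen t (interior_subset ht)).mono interior_subset) fun t ht => ?_
    rw [neg_nonpos]
    exact mul_nonneg (hχ0 _) (intervalIntegral.integral_nonneg hL.le fun x _ =>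
      dissip_nonneg hμ _ _ _)
  have hEle : ∀ t ∈ Icc 0 T, trigEnergy L R (y t).1 (y t).2 ≤ E := fun t ht => by
    have := hanti h0T ht ht.1
    simpa only [hy0] using this
  have hzero : ∀ t ∈ Icc 0 T, ∀ k : Fin N, (k : ℕ) = 0 →
      (y t).1 k = c₀ k ∧ (y t).2 k = d₀ k := by
    intro t ht k hk
    constructor
    · have := sub_eq_integral_of_hasDerivWithinAt (u := fun t => (y t).1 k) (u' := fun _ => 0)
        (fun t ht => (hc t ht k).congr_deriv (by simp [hk, freq_zero])) continuousOn_const h0T ht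
      simp only [hy0, intervalIntegral.integral_zero, sub_eq_zero] at this
      exact this
    · have := sub_eq_integral_of_hasDerivWithinAt (u := fun t => (y t).2 k) (u' := fun _ => 0)
        (fun t ht => (hd t ht k).congr_deriv (by simp [hk, freq_zero])) continuousOn_const h0T ht
      simp only [hy0, intervalIntegral.integral_zero, sub_eq_zero] at this
      exact this
  -- The solution stays in the ball where the cutoff equals 1, so it solves the original system.
  have hχ : ∀ t ∈ Icc 0 T, χ (y t) = 1 := by
    intro t ht
    refine hχ1 _ ?_
    rw [Prod.norm_def]
    refine max_le ?_ ?_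
    · refine (pi_norm_le_iff_of_nonneg (by positivity)).2 fun k => ?_
      by_cases hk : (k : ℕ) = 0
      · rw [(hzero t ht k hk).1]
        linarith [norm_le_pi_norm c₀ k, norm_nonneg d₀]
      · rw [Real.norm_eq_abs]
        linarith [(abs_coeff_le_of_trigEnergy_le hL hR (hEle t ht) hk).1, norm_nonneg c₀,
          norm_nonneg d₀]
    · refine (pi_norm_le_iff_of_nonneg (by positivity)).2 fun k => ?_
      by_cases hk : (k : ℕ) = 0
      · rw [(hzero t ht k hk).2]
        linarith [norm_le_pi_norm d₀ k, norm_nonneg c₀]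
      · obtain ⟨h1, h2⟩ := abs_coeff_le_of_trigEnergy_le hL hR (hEle t ht) hk
        have h3 : |(y t).2 k| ≤ |(y t).1 k + (y t).2 k| + |(y t).1 k| := by
          have := abs_sub ((y t).1 k + (y t).2 k) ((y t).1 k)
          simpa using this
        rw [Real.norm_eq_abs]
        linarith [norm_nonneg c₀, norm_nonneg d₀]
  -- Clamping time to `[0, T]` makes the coefficients continuous on the whole line; the equations
  -- are claimed only inside the interval.
  let π : ℝ → ℝ := fun t => projIcc 0 T hT t
  have hπ : Continuous π := continuous_subtype_val.comp continuous_projIcc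
  have hπmem : ∀ t, π t ∈ Icc 0 T := fun t => (projIcc 0 T hT t).2
  have hπid : ∀ t ∈ Icc 0 T, π t = t := fun t ht => by
    simp only [π, projIcc_of_mem hT ht]
  have hyπ : Continuous fun t => y (π t) := hyc.comp_continuous hπ hπmem
  have hcc : Continuous fun t => (y (π t)).1 := hyπ.fst
  have hdc : Continuous fun t => (y (π t)).2 := hyπ.snd
  have hinner : ∀ {Φ : ((Fin N → ℝ) × (Fin N → ℝ)) × ℝ → ℝ}, Continuous Φ →
      Continuous fun τ => ∫ x in (0)..L, Φ (y (π τ), x) := fun {Φ} hΦ =>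
    intervalIntegral.continuous_parametric_intervalIntegral_of_continuous'
      (f := fun τ x => Φ (y (π τ), x))
      (hΦ.comp ((hyπ.comp continuous_fst).prodMk continuous_snd)) 0 L
  refine ⟨fun t => (y (π t)).1, fun t => (y (π t)).2, hcc, hdc, ?_, ?_, fun t => ?_,
    fun t ht => ?_, fun s hs t ht k => ⟨?_, ?_⟩⟩
  · simp only [hπid 0 h0T, hy0]
  · simp only [hπid 0 h0T, hy0]
  · simp only [hπid _ (projIcc 0 T hT t).2]
    exact ⟨rfl, rfl⟩
  · have := sub_eq_integral_of_hasDerivWithinAt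
      (u := fun t => trigEnergy L R (y (π t)).1 (y (π t)).2)
      (u' := fun t => -∫ x in (0)..L, galD L R μ A (y (π t)).1 (y (π t)).2 x)
      (fun t ht => ((hen t ht).congr_deriv (by rw [hχ t ht, one_mul, hπid t ht])).congr
        (fun s hs => by simp only [hπid s hs]) (by simp only [hπid t ht]))
      (hinner (continuous_galD L R μ hA.continuous N)).neg.continuousOn h0T ht
    simp only [intervalIntegral.integral_neg, hπid 0 h0T, hy0] at this
    linarith
  · exact sub_eq_integral_of_hasDerivWithinAt (u := fun t => (y (π t)).1 k)
      (fun t ht => ((hc t ht k).congr_deriv (by rw [hχ t ht, one_mul, hπid t ht])).congr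
        (fun s hs => by simp only [hπid s hs]) (by simp only [hπid t ht]))
      (hinner (Φ := fun p => -(2 / L) * (galF L R A p.1.1 p.1.2 p.2 *
        (freq L k * sinMode L k p.2))) (by fun_prop)).continuousOn hs ht
  · exact sub_eq_integral_of_hasDerivWithinAt (u := fun t => (y (π t)).2 k)
      (fun t ht => ((hd t ht k).congr_deriv (by rw [hχ t ht, one_mul, hπid t ht])).congr
        (fun s hs => by simp only [hπid s hs]) (by simp only [hπid t ht]))
      (hinner (Φ := fun p => -(2 / L) * (galG L R μ A p.1.1 p.1.2 p.2 *
        (freq L k * sinMode L k p.2))) (by fun_prop)).continuousOn hs ht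

/-! ### One-dimensional inequalities -/

/-- The embedding of H¹ into C^{1/2}. Cauchy–Schwarz appears as Young's inequality with the optimal
weight σ/K, where σ is the square root of the distance. -/
lemma abs_sub_le_of_integral_sq_le {L K : ℝ} (hK : 0 < K) {u u₁ : ℝ → ℝ}
    (hu : ∀ x, HasDerivAt u (u₁ x) x) (hu₁ : Continuous u₁)
    (h : ∫ x in (0)..L, u₁ x ^ 2 ≤ K ^ 2) {x y : ℝ} (hx : x ∈ Icc 0 L) (hy : y ∈ Icc 0 L) :
    |u x - u y| ≤ K * Real.sqrt |x - y| := by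
  wlog hxy : y ≤ x generalizing x y
  · rw [abs_sub_comm, abs_sub_comm x y]
    exact this hy hx (le_of_not_ge hxy)
  rcases hxy.eq_or_lt with rfl | hlt
  · simp
  rw [abs_of_nonneg (sub_nonneg.2 hxy)]
  set σ := Real.sqrt (x - y) with hσ
  have hσ0 : 0 < σ := Real.sqrt_pos.2 (sub_pos.2 hlt)
  have hσ2 : σ ^ 2 = x - y := Real.sq_sqrt (sub_nonneg.2 hxy)
  have hle : ∫ z in y..x, u₁ z ^ 2 ≤ K ^ 2 :=
    (intervalIntegral.integral_mono_interval hy.1 hxy hx.2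
      (.of_forall fun z => sq_nonneg _) ((hu₁.pow 2).intervalIntegrable _ _)).trans h
  have hftc : u x - u y = ∫ z in y..x, u₁ z :=
    (intervalIntegral.integral_eq_sub_of_hasDerivAt (fun z _ => hu z)
      (hu₁.intervalIntegrable _ _)).symm
  rw [hftc]
  calc |∫ z in y..x, u₁ z| ≤ ∫ z in y..x, |u₁ z| :=
        intervalIntegral.abs_integral_le_integral_abs hxy
    _ ≤ ∫ z in y..x, (σ / (2 * K) * u₁ z ^ 2 + K / (2 * σ)) := by
        refine intervalIntegral.integral_mono_on hxy (hu₁.abs.intervalIntegrable _ _)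
          ((by fun_prop : Continuous _).intervalIntegrable _ _) fun z _ => ?_
        have h1 : 0 ≤ σ / (2 * K) * (|u₁ z| - K / σ) ^ 2 := by positivity
        have h2 : σ / (2 * K) * (|u₁ z| - K / σ) ^ 2 =
            σ / (2 * K) * |u₁ z| ^ 2 + K / (2 * σ) - |u₁ z| := by
          field_simp
          ring
        rw [sq_abs] at h2
        linarith
    _ = σ / (2 * K) * (∫ z in y..x, u₁ z ^ 2) + K / (2 * σ) * (x - y) := by
        rw [intervalIntegral.integral_add ((by fun_prop : Continuous _).intervalIntegrable _ _)
          (by simp), intervalIntegral.integral_const_mul, intervalIntegral.integral_const]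
        simp only [smul_eq_mul]
        ring
    _ ≤ σ / (2 * K) * K ^ 2 + K / (2 * σ) * σ ^ 2 := by
        rw [hσ2]
        gcongr
    _ = K * σ := by
        field_simp
        ring

lemma mul_le_integral_add {L a b : ℝ} (hL : 0 < L) {h : ℝ → ℝ} (hh : Continuous h)
    (H : ∀ y ∈ Icc 0 L, a ≤ h y + b) : L * a ≤ (∫ y in (0)..L, h y) + L * b := by
  have := intervalIntegral.integral_mono_on (f := fun _ => a) (g := fun y => h y + b) hL.le
    (intervalIntegrable_const (μ := volume)) ((by fun_prop : Continuous _).intervalIntegrable _ _) H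
  rw [intervalIntegral.integral_add (hh.intervalIntegrable _ _) intervalIntegrable_const] at this
  simpa using this

/-- Averaging the Hölder estimate over the second point compares `u x` with the mean of `u`. -/
lemma abs_le_of_integral_sq_le {L K : ℝ} (hL : 0 < L) (hK : 0 < K) {u u₁ : ℝ → ℝ}
    (hu : ∀ x, HasDerivAt u (u₁ x) x) (hu₁ : Continuous u₁)
    (h : ∫ x in (0)..L, u₁ x ^ 2 ≤ K ^ 2) {x : ℝ} (hx : x ∈ Icc 0 L) :
    |u x| ≤ |∫ y in (0)..L, u y| / L + K * Real.sqrt L := by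
  have huc : Continuous u := continuous_iff_continuousAt.2 fun x => (hu x).continuousAt
  have hd : ∀ y ∈ Icc 0 L, |u x - u y| ≤ K * Real.sqrt L := fun y hy =>
    (abs_sub_le_of_integral_sq_le hK hu hu₁ h hx hy).trans (by
      gcongr
      rw [abs_le]
      constructor <;> linarith [hx.1, hx.2, hy.1, hy.2])
  have h1 := mul_le_integral_add hL huc (a := u x) (b := K * Real.sqrt L) fun y hy => by
    linarith [(abs_le.1 (hd y hy)).2]
  have h2 := mul_le_integral_add hL huc.neg (a := -u x) (b := K * Real.sqrt L) fun y hy => by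
    simp only [Pi.neg_apply]
    linarith [(abs_le.1 (hd y hy)).1]
  simp only [Pi.neg_apply, intervalIntegral.integral_neg] at h2
  have h3 : |∫ y in (0)..L, u y| / L * L = |∫ y in (0)..L, u y| := div_mul_cancel₀ _ hL.ne'
  refine abs_le.2 ⟨?_, ?_⟩ <;> refine le_of_mul_le_mul_left ?_ hL
  · nlinarith [neg_abs_le (∫ y in (0)..L, u y)]
  · nlinarith [le_abs_self (∫ y in (0)..L, u y)]

/-- Write u(x)² - u(y)² as the integral of 2uu', apply Young's inequality with weight κ, and average
over y. Since κ is free, a small L₂ norm together with a bounded derivative forces a small supremum.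
-/
lemma sq_le_of_integral_sq {L κ : ℝ} (hL : 0 < L) (hκ : 0 < κ) {u u₁ : ℝ → ℝ}
    (hu : ∀ x, HasDerivAt u (u₁ x) x) (hu₁ : Continuous u₁) {x : ℝ} (hx : x ∈ Icc 0 L) :
    u x ^ 2 ≤ (1 / L + 1 / κ) * (∫ y in (0)..L, u y ^ 2) + κ * ∫ y in (0)..L, u₁ y ^ 2 := by
  have huc : Continuous u := continuous_iff_continuousAt.2 fun x => (hu x).continuousAt
  set b := 1 / κ * (∫ y in (0)..L, u y ^ 2) + κ * ∫ y in (0)..L, u₁ y ^ 2 with hb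
  have hd : ∀ y ∈ Icc 0 L, u x ^ 2 ≤ u y ^ 2 + b := by
    intro y hy
    have hftc : u x ^ 2 - u y ^ 2 = ∫ z in y..x, 2 * u z * u₁ z :=
      (intervalIntegral.integral_eq_sub_of_hasDerivAt (f := fun z => u z ^ 2)
        (fun z _ => ((hu z).fun_pow 2).congr_deriv (by ring))
        ((by fun_prop : Continuous _).intervalIntegrable _ _)).symm
    have hle : ∫ z in y..x, 2 * u z * u₁ z ≤ b := by
      refine (le_abs_self _).trans ?_
      rw [intervalIntegral.abs_integral_eq_abs_integral_uIoc]
      refine abs_integral_le_integral_abs.trans ?_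
      have hb' : b = ∫ z in Ioc 0 L, (1 / κ * u z ^ 2 + κ * u₁ z ^ 2) := by
        rw [hb, ← intervalIntegral.integral_of_le hL.le, intervalIntegral.integral_add
          ((by fun_prop : Continuous _).intervalIntegrable _ _)
          ((by fun_prop : Continuous _).intervalIntegrable _ _),
          intervalIntegral.integral_const_mul, intervalIntegral.integral_const_mul]
      have hcI : ∀ {h : ℝ → ℝ}, Continuous h → IntegrableOn h (Ioc 0 L) := fun hh =>
        (hh.integrableOn_Icc).mono_set Ioc_subset_Icc_self
      have hsub : uIoc y x ⊆ Ioc 0 L := fun z hz =>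
        ⟨(le_min hy.1 hx.1).trans_lt hz.1, hz.2.trans (max_le hy.2 hx.2)⟩
      rw [hb']
      refine (setIntegral_mono_set (t := Ioc 0 L)
        (hcI (by fun_prop : Continuous fun z => |2 * u z * u₁ z|))
        (.of_forall fun z => abs_nonneg _) hsub.eventuallyLE).trans ?_
      refine integral_mono (hcI (by fun_prop)) (hcI (by fun_prop)) fun z => ?_
      have h1 : 0 ≤ κ * (|u₁ z| - 1 / κ * |u z|) ^ 2 := by positivity
      have h2 : κ * (|u₁ z| - 1 / κ * |u z|) ^ 2 =
          κ * |u₁ z| ^ 2 + 1 / κ * |u z| ^ 2 - 2 * |u z| * |u₁ z| := by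
        field_simp
        ring
      simp only [sq_abs] at h2
      simp only [abs_mul, abs_two]
      linarith
    linarith
  have := mul_le_integral_add hL (huc.pow 2) hd
  have h3 : 1 / L * L = 1 := by field_simp
  refine le_of_mul_le_mul_left ?_ hL
  rw [hb] at this
  simp only [Pi.pow_apply] at this
  have e : L * ((1 / L + 1 / κ) * (∫ y in (0)..L, u y ^ 2) + κ * ∫ y in (0)..L, u₁ y ^ 2)
      = (1 / L * L) * (∫ y in (0)..L, u y ^ 2) + L * (1 / κ * (∫ y in (0)..L, u y ^ 2)
        + κ * ∫ y in (0)..L, u₁ y ^ 2) := by ring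
  rw [e, h3, one_mul]
  exact this

/-! ### Bounds for the fluxes -/

/-- A flux is a current times a cubic monomial in the square roots, whence `M ^ 6`. The numerical
constant is not optimal; it is chosen to serve `hG_sq_le` as well. -/
lemma hF_sq_le {R μ M a jf jg jfg : ℝ} (hμ : 0 < μ) (ha : |a| ≤ M) :
    hF a jf ^ 2 ≤ M ^ 6 * (9 * (μ + 1)) * dissip R μ jf jg jfg := by
  have hM : 0 ≤ M := (abs_nonneg a).trans ha
  have h1 : (a ^ 3) ^ 2 ≤ M ^ 6 := by
    have := pow_le_pow_left₀ (abs_nonneg a) ha 6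
    rwa [← abs_pow, abs_of_nonneg (by positivity : 0 ≤ a ^ 6), show a ^ 6 = (a ^ 3) ^ 2 by ring]
      at this
  have h2 : jf ^ 2 ≤ 9 * (μ + 1) * dissip R μ jf jg jfg := by
    have h3 : jf ^ 2 ≤ dissip R μ jf jg jfg := by
      unfold dissip
      nlinarith [mul_nonneg hμ.le (sq_nonneg (R * jg)), sq_nonneg (R * jfg)]
    nlinarith [dissip_nonneg (R := R) hμ jf jg jfg]
  rw [hF, mul_pow, mul_assoc]
  exact mul_le_mul h1 h2 (sq_nonneg _) (by positivity)

lemma hG_sq_le {R μ M a b jf jg jfg : ℝ} (hμ : 0 < μ) (ha : |a| ≤ M) (hb : |b| ≤ M) :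
    hG R μ a b jf jg jfg ^ 2 ≤ M ^ 6 * (9 * (μ + 1)) * dissip R μ jf jg jfg := by
  have hM : 0 ≤ M := (abs_nonneg a).trans ha
  have h1 : (b ^ 3) ^ 2 ≤ M ^ 6 := by
    have := pow_le_pow_left₀ (abs_nonneg b) hb 6
    rwa [← abs_pow, abs_of_nonneg (by positivity : 0 ≤ b ^ 6), show b ^ 6 = (b ^ 3) ^ 2 by ring]
      at this
  have h2 : (a * b ^ 2) ^ 2 ≤ M ^ 6 := by
    have h3 := pow_le_pow_left₀ (abs_nonneg b) hb 4
    have h4 := pow_le_pow_left₀ (abs_nonneg a) ha 2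
    rw [← abs_pow, abs_of_nonneg (by positivity : 0 ≤ b ^ 4)] at h3
    rw [sq_abs] at h4
    calc (a * b ^ 2) ^ 2 = a ^ 2 * b ^ 4 := by ring
      _ ≤ M ^ 2 * M ^ 4 := mul_le_mul h4 h3 (by positivity) (by positivity)
      _ = M ^ 6 := by ring
  have h5 : hG R μ a b jf jg jfg ^ 2 ≤ 3 * ((b ^ 3) ^ 2 * (μ * R * jg) ^ 2
      + (a * b ^ 2) ^ 2 * (3 * R / 4 * jfg) ^ 2 + (a * b ^ 2) ^ 2 * (3 / 2 * jf) ^ 2) := by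
    have : ∀ x y z : ℝ, (x + y + z) ^ 2 ≤ 3 * (x ^ 2 + y ^ 2 + z ^ 2) := fun x y z => by
      nlinarith [sq_nonneg (x - y), sq_nonneg (y - z), sq_nonneg (x - z)]
    refine (this _ _ _).trans (le_of_eq ?_)
    ring
  refine h5.trans ?_
  have h6 : (b ^ 3) ^ 2 * (μ * R * jg) ^ 2
      + (a * b ^ 2) ^ 2 * (3 * R / 4 * jfg) ^ 2 + (a * b ^ 2) ^ 2 * (3 / 2 * jf) ^ 2
      ≤ M ^ 6 * ((μ * R * jg) ^ 2 + (3 * R / 4 * jfg) ^ 2 + (3 / 2 * jf) ^ 2) := by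
    rw [mul_add, mul_add]
    gcongr
  have h7 : (μ * R * jg) ^ 2 + (3 * R / 4 * jfg) ^ 2 + (3 / 2 * jf) ^ 2
      ≤ 3 * (μ + 1) * dissip R μ jf jg jfg := by
    unfold dissip
    have e1 : 0 ≤ μ * R ^ 2 * jg ^ 2 := by positivity
    have e2 : 0 ≤ R ^ 2 * jfg ^ 2 := by positivity
    have e3 : 0 ≤ jf ^ 2 := by positivity
    nlinarith [mul_nonneg hμ.le e1, mul_nonneg hμ.le e2, mul_nonneg hμ.le e3]
  have h8 := mul_le_mul_of_nonneg_left h7 (by positivity : 0 ≤ M ^ 6)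
  nlinarith

/-! ### A regularized square root -/

/-- A positive smooth approximation of the square root of the positive part. -/
def smoothSqrt (δ z : ℝ) : ℝ := Real.sqrt ((z + Real.sqrt (z ^ 2 + δ ^ 2)) / 2)

lemma add_sqrt_pos {δ : ℝ} (hδ : 0 < δ) (z : ℝ) : 0 < z + Real.sqrt (z ^ 2 + δ ^ 2) := by
  have h1 : |z| < Real.sqrt (z ^ 2 + δ ^ 2) := by
    rw [← Real.sqrt_sq_eq_abs]
    exact Real.sqrt_lt_sqrt (sq_nonneg z) (by nlinarith)
  linarith [neg_abs_le z]

/-- Both radicands are strictly positive for every real argument, so neither square root meets its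
singularity. -/
lemma contDiff_smoothSqrt {δ : ℝ} (hδ : 0 < δ) {n : WithTop ℕ∞} : ContDiff ℝ n (smoothSqrt δ) := by
  unfold smoothSqrt
  refine ContDiff.sqrt ?_ fun z => (div_pos (add_sqrt_pos hδ z) two_pos).ne'
  refine ContDiff.div_const (contDiff_id.add (ContDiff.sqrt (by fun_prop) fun z => ?_)) 2
  positivity

lemma abs_sqrt_sub_sqrt_le (u v : ℝ) : |Real.sqrt u - Real.sqrt v| ≤ Real.sqrt |u - v| := by
  wlog h : v ≤ u generalizing u v
  · rw [abs_sub_comm, abs_sub_comm u v]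
    exact this v u (le_of_not_ge h)
  rw [abs_of_nonneg (sub_nonneg.2 (Real.sqrt_le_sqrt h)), abs_of_nonneg (sub_nonneg.2 h),
    sub_le_iff_le_add]
  rcases le_total v 0 with hv | hv
  · rw [Real.sqrt_eq_zero_of_nonpos hv, add_zero]
    exact Real.sqrt_le_sqrt (by linarith)
  · refine Real.sqrt_le_iff.2 ⟨by positivity, ?_⟩
    have h1 := Real.sq_sqrt (sub_nonneg.2 h)
    have h2 := Real.sq_sqrt hv
    nlinarith [mul_nonneg (Real.sqrt_nonneg (u - v)) (Real.sqrt_nonneg v)]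

/-- The radicand differs from the positive part of `z` by at most `δ`, and the square root is Hölder
continuous of order 1/2. `Real.sqrt` vanishes on negative numbers, so it is already the square root
of the positive part. -/
lemma abs_smoothSqrt_sub_le {δ : ℝ} (hδ : 0 < δ) (z : ℝ) :
    |smoothSqrt δ z - Real.sqrt z| ≤ Real.sqrt δ := by
  have h0 : Real.sqrt z = Real.sqrt (max z 0) := by
    rcases le_total z 0 with h | h
    · rw [max_eq_right h, Real.sqrt_eq_zero_of_nonpos h, Real.sqrt_zero]
    · rw [max_eq_left h]
  rw [h0, smoothSqrt]
  refine (abs_sqrt_sub_sqrt_le _ _).trans (Real.sqrt_le_sqrt ?_)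
  have h1 : |z| ≤ Real.sqrt (z ^ 2 + δ ^ 2) := by
    rw [← Real.sqrt_sq_eq_abs]
    exact Real.sqrt_le_sqrt (by nlinarith)
  have h2 : Real.sqrt (z ^ 2 + δ ^ 2) ≤ |z| + δ := by
    refine Real.sqrt_le_iff.2 ⟨by positivity, ?_⟩
    nlinarith [sq_abs z, mul_nonneg (abs_nonneg z) hδ.le]
  rw [abs_le]
  rcases le_total z 0 with h | h
  · rw [max_eq_right h]
    rw [abs_of_nonpos h] at h1 h2
    constructor <;> linarith
  · rw [max_eq_left h]
    rw [abs_of_nonneg h] at h1 h2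
    constructor <;> linarith

/-! ### Equicontinuity in time -/

/-- The increment of a Galerkin solution is itself an admissible test function: this is the
equation, integrated in time, tested with the increment. The different normalization of mode 0 does
not matter because its increment is zero. -/
lemma integral_trig_sq_eq_flux {L : ℝ} (hL : 0 < L) {N : ℕ} {δ : Fin N → ℝ} {H : ℝ → ℝ → ℝ}
    (hH : Continuous fun p : ℝ × ℝ => H p.1 p.2) {s t : ℝ}
    (h : ∀ k, δ k = ∫ τ in s..t, ∫ x in (0)..L, -(2 / L) * (H τ x * (freq L k * sinMode L k x))) :
    ∫ x in (0)..L, trig L δ x ^ 2 = ∫ τ in s..t, ∫ x in (0)..L, H τ x * trig₁ L δ x := by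
  have hHτ : ∀ τ, Continuous (H τ) := fun τ => hH.comp (by fun_prop : Continuous fun x => (τ, x))
  have hterm : ∀ k : Fin N, Continuous fun τ =>
      ∫ x in (0)..L, -(2 / L) * (H τ x * (freq L k * sinMode L k x)) := fun k =>
    intervalIntegral.continuous_parametric_intervalIntegral_of_continuous'
      (f := fun τ x => -(2 / L) * (H τ x * (freq L k * sinMode L k x)))
      (by simp only [Function.uncurry_def]; fun_prop) 0 L
  have e : ∀ τ, ∫ x in (0)..L, H τ x * trig₁ L δ x = ∑ k : Fin N, L / 2 * δ k *
      ∫ x in (0)..L, -(2 / L) * (H τ x * (freq L k * sinMode L k x)) := by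
    intro τ
    have hHc := hHτ τ
    simp_rw [← intervalIntegral.integral_const_mul]
    rw [← intervalIntegral.integral_finsetSum fun k _ =>
      (by fun_prop : Continuous _).intervalIntegrable _ _]
    refine intervalIntegral.integral_congr fun x _ => ?_
    simp only [trig₁, Finset.mul_sum]
    refine Finset.sum_congr rfl fun k _ => ?_
    field_simp
  simp_rw [e]
  rw [intervalIntegral.integral_finsetSum fun k _ =>
    ((hterm k).const_mul _).intervalIntegrable _ _, integral_trig_sq hL]
  refine Finset.sum_congr rfl fun k _ => ?_
  rw [intervalIntegral.integral_const_mul, ← h k]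
  split_ifs with hk
  · have : δ k = 0 := by
      rw [h k]
      simp [hk, freq_zero]
    simp [this]
  · ring

/-- A modulus of continuity. -/
def modulus (L D h : ℝ) : ℝ :=
  Real.sqrt (D * (Real.sqrt h / L + 2 * Real.sqrt (Real.sqrt h)))

lemma modulus_mono {L D : ℝ} (hL : 0 < L) (hD : 0 ≤ D) {h h' : ℝ} (hh : h ≤ h') :
    modulus L D h ≤ modulus L D h' := by
  unfold modulus
  gcongr

@[fun_prop]
lemma continuous_modulus (L D : ℝ) : Continuous (modulus L D) := by
  unfold modulus
  fun_prop

lemma modulus_zero (L D : ℝ) : modulus L D 0 = 0 := by simp [modulus]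

/-- Testing with the increment and using Young's inequality with weight κ = (t - s)^{1/2} bounds its
squared L₂ norm by κD. The interpolation inequality with parameter η = κ^{1/2} then bounds its
squared supremum by D(κ/L + 2η), which is the square of `modulus`. -/
lemma abs_trig_le_modulus {L D : ℝ} (hL : 0 < L) {N : ℕ} {δ : Fin N → ℝ}
    {H : ℝ → ℝ → ℝ} (hH : Continuous fun p : ℝ × ℝ => H p.1 p.2) {s t : ℝ} (hst : s ≤ t)
    (h : ∀ k, δ k = ∫ τ in s..t, ∫ x in (0)..L, -(2 / L) * (H τ x * (freq L k * sinMode L k x)))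
    (hHD : ∫ τ in s..t, ∫ x in (0)..L, H τ x ^ 2 ≤ D)
    (hδD : ∫ x in (0)..L, trig₁ L δ x ^ 2 ≤ D) {x : ℝ} (hx : x ∈ Icc 0 L) :
    |trig L δ x| ≤ modulus L D (t - s) := by
  rcases hst.eq_or_lt with rfl | hlt
  · have : δ = 0 := funext fun k => by simp [h k]
    simp [this, trig, modulus_zero]
  have hD : 0 ≤ D := le_trans
    (intervalIntegral.integral_nonneg hL.le fun x _ => sq_nonneg (trig₁ L δ x)) hδD
  set κ := Real.sqrt (t - s) with hκ
  have hκ0 : 0 < κ := Real.sqrt_pos.2 (sub_pos.2 hlt)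
  have hκ2 : κ ^ 2 = t - s := Real.sq_sqrt (sub_pos.2 hlt).le
  set η := Real.sqrt κ with hη
  have hη0 : 0 < η := Real.sqrt_pos.2 hκ0
  have hη2 : η ^ 2 = κ := Real.sq_sqrt hκ0.le
  have hHτ : ∀ τ, Continuous (H τ) := fun τ => hH.comp (by fun_prop : Continuous fun x => (τ, x))
  have hcont : ∀ {Φ : ℝ → ℝ → ℝ}, Continuous (fun p : ℝ × ℝ => Φ p.1 p.2) →
      Continuous fun τ => ∫ x in (0)..L, Φ τ x := fun {Φ} hΦ =>
    intervalIntegral.continuous_parametric_intervalIntegral_of_continuous' (f := Φ) hΦ 0 L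
  have hL2 : ∫ x in (0)..L, trig L δ x ^ 2 ≤ κ * D := by
    rw [integral_trig_sq_eq_flux hL hH h]
    have hx : ∀ τ, ∫ x in (0)..L, H τ x * trig₁ L δ x ≤
        κ / 2 * (∫ x in (0)..L, H τ x ^ 2) + 1 / (2 * κ) * D := by
      intro τ
      have hHc := hHτ τ
      have h1 : ∫ x in (0)..L, H τ x * trig₁ L δ x ≤
          ∫ x in (0)..L, (κ / 2 * H τ x ^ 2 + 1 / (2 * κ) * trig₁ L δ x ^ 2) := by
        refine intervalIntegral.integral_mono_on hL.le
          ((by fun_prop : Continuous _).intervalIntegrable _ _)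
          ((by fun_prop : Continuous _).intervalIntegrable _ _) fun x _ => ?_
        have h2 : 0 ≤ κ / 2 * (H τ x - 1 / κ * trig₁ L δ x) ^ 2 := by positivity
        have h3 : κ / 2 * (H τ x - 1 / κ * trig₁ L δ x) ^ 2 =
            κ / 2 * H τ x ^ 2 + 1 / (2 * κ) * trig₁ L δ x ^ 2 - H τ x * trig₁ L δ x := by
          field_simp
          ring
        linarith
      rw [intervalIntegral.integral_add ((by fun_prop : Continuous _).intervalIntegrable _ _)
        ((by fun_prop : Continuous _).intervalIntegrable _ _),
        intervalIntegral.integral_const_mul, intervalIntegral.integral_const_mul] at h1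
      refine h1.trans ?_
      gcongr
    have hc2 : Continuous fun τ => ∫ x in (0)..L, H τ x ^ 2 := hcont (Φ := fun τ x => H τ x ^ 2)
      (hH.pow 2)
    have hc1 : Continuous fun τ => ∫ x in (0)..L, H τ x * trig₁ L δ x :=
      hcont (Φ := fun τ x => H τ x * trig₁ L δ x) (by fun_prop)
    have h4 := intervalIntegral.integral_mono_on (μ := volume) hst (hc1.intervalIntegrable _ _)
      ((by fun_prop : Continuous fun τ => κ / 2 * (∫ x in (0)..L, H τ x ^ 2)
        + 1 / (2 * κ) * D).intervalIntegrable _ _) fun τ _ => hx τ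
    rw [intervalIntegral.integral_add ((by fun_prop : Continuous _).intervalIntegrable _ _)
        ((by fun_prop : Continuous _).intervalIntegrable _ _),
      intervalIntegral.integral_const_mul, intervalIntegral.integral_const] at h4
    refine h4.trans ?_
    calc κ / 2 * (∫ τ in s..t, ∫ x in (0)..L, H τ x ^ 2) + (t - s) • (1 / (2 * κ) * D)
        ≤ κ / 2 * D + κ ^ 2 * (1 / (2 * κ) * D) := by
          rw [hκ2, smul_eq_mul]
          gcongr
      _ = κ * D := by
          field_simp
          ring
  refine Real.abs_le_sqrt ?_
  refine (sq_le_of_integral_sq hL hη0 (hasDerivAt_trig L δ) (continuous_trig₁ L δ) hx).trans ?_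
  calc (1 / L + 1 / η) * (∫ y in (0)..L, trig L δ y ^ 2) + η * ∫ y in (0)..L, trig₁ L δ y ^ 2
      ≤ (1 / L + 1 / η) * (η ^ 2 * D) + η * D := by
        rw [hη2]
        gcongr
    _ = D * (κ / L + 2 * η) := by
        rw [← hη2]
        field_simp
        ring

/-! ### Approximating sequences -/

/-- Uniform bounds for a sequence `u` of functions of `(t, x)` with `x`-derivative `u₁`. -/
structure IsBoundedSeq (L K B D : ℝ) (u u₁ : ℕ → ℝ → ℝ → ℝ) : Prop where
  K_pos : 0 < K
  D_nonneg : 0 ≤ D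
  cont : ∀ n, Continuous fun p : ℝ × ℝ => u n p.1 p.2
  cont₁ : ∀ n, Continuous fun p : ℝ × ℝ => u₁ n p.1 p.2
  deriv : ∀ n t x, HasDerivAt (u n t) (u₁ n t x) x
  bound₁ : ∀ n t, ∫ x in (0)..L, u₁ n t x ^ 2 ≤ K ^ 2
  bound : ∀ n t, ∀ x ∈ Icc 0 L, |u n t x| ≤ B
  time : ∀ n t s, ∀ x ∈ Icc 0 L, |u n t x - u n s x| ≤ modulus L D |t - s|

/-- A sequence of approximate solutions. The weak derivatives of the initial data are `v` and `w`,
their integrals are `m` and `l`, and their energy is at most `E`; `a` and `b` approximate the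
square roots of `f` and `g`. -/
structure ApproxSeq (L R μ : ℝ) (v w : ℝ → ℝ) (m l E : ℝ) where
  (f f₁ f₂ f₃ g g₁ g₂ g₃ a b : ℕ → ℝ → ℝ → ℝ)
  (K B D : ℝ)
  bdd_f : IsBoundedSeq L K B D f f₁
  bdd_g : IsBoundedSeq L K B D g g₁
  cont_f₂ : ∀ n, Continuous fun p : ℝ × ℝ => f₂ n p.1 p.2
  cont_f₃ : ∀ n, Continuous fun p : ℝ × ℝ => f₃ n p.1 p.2
  cont_g₂ : ∀ n, Continuous fun p : ℝ × ℝ => g₂ n p.1 p.2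
  cont_g₃ : ∀ n, Continuous fun p : ℝ × ℝ => g₃ n p.1 p.2
  deriv_f₁ : ∀ n t x, HasDerivAt (f₁ n t) (f₂ n t x) x
  deriv_f₂ : ∀ n t x, HasDerivAt (f₂ n t) (f₃ n t x) x
  deriv_g₁ : ∀ n t x, HasDerivAt (g₁ n t) (g₂ n t x) x
  deriv_g₂ : ∀ n t x, HasDerivAt (g₂ n t) (g₃ n t x) x
  cont_a : ∀ n, Continuous fun p : ℝ × ℝ => a n p.1 p.2
  cont_b : ∀ n, Continuous fun p : ℝ × ℝ => b n p.1 p.2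
  near_a : ∀ n t x, |a n t x - Real.sqrt (f n t x)| ≤ Real.sqrt (1 / (n + 1))
  near_b : ∀ n t x, |b n t x - Real.sqrt (g n t x)| ≤ Real.sqrt (1 / (n + 1))
  -- The approximation with index `n` uses the modes 0, …, n and solves the system on `[0, n]`,
  -- hence the restrictions on `k` and `t` here and below. The bounds in `IsBoundedSeq` hold for all
  -- times.
  energy_le : ∀ n : ℕ, ∀ t ∈ Icc (0 : ℝ) n,
    1 / 2 * ((∫ x in (0)..L, f₁ n t x ^ 2) + R * ∫ x in (0)..L, (f₁ n t x + g₁ n t x) ^ 2)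
      + ∫ τ in (0)..t, ∫ x in (0)..L, dissip R μ
        (curF R (a n τ x) (b n τ x) (f₃ n τ x) (g₃ n τ x)) (curG (b n τ x) (f₃ n τ x) (g₃ n τ x))
        (curFG (a n τ x) (b n τ x) (f₃ n τ x) (g₃ n τ x)) ≤ E
  eq_f : ∀ n k : ℕ, k ≤ n → ∀ t ∈ Icc (0 : ℝ) n,
    ∫ x in (0)..L, (f n t x - f n 0 x) * cosMode L k x =
      ∫ τ in (0)..t, ∫ x in (0)..L,
        hF (a n τ x) (curF R (a n τ x) (b n τ x) (f₃ n τ x) (g₃ n τ x))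
          * -(freq L k * sinMode L k x)
  eq_g : ∀ n k : ℕ, k ≤ n → ∀ t ∈ Icc (0 : ℝ) n,
    ∫ x in (0)..L, (g n t x - g n 0 x) * cosMode L k x =
      ∫ τ in (0)..t, ∫ x in (0)..L,
        hG R μ (a n τ x) (b n τ x) (curF R (a n τ x) (b n τ x) (f₃ n τ x) (g₃ n τ x))
          (curG (b n τ x) (f₃ n τ x) (g₃ n τ x))
          (curFG (a n τ x) (b n τ x) (f₃ n τ x) (g₃ n τ x)) * -(freq L k * sinMode L k x)
  init_f : ∀ n k : ℕ, k ≤ n →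
    ∫ x in (0)..L, f₁ n 0 x * sinMode L k x = ∫ x in Ioo 0 L, v x * sinMode L k x
  init_g : ∀ n k : ℕ, k ≤ n →
    ∫ x in (0)..L, g₁ n 0 x * sinMode L k x = ∫ x in Ioo 0 L, w x * sinMode L k x
  mass_f : ∀ n, ∫ x in (0)..L, f n 0 x = m
  mass_g : ∀ n, ∫ x in (0)..L, g n 0 x = l

/-! ### Existence of approximating sequences -/

/-- Bessel's inequality: with matching sine coefficients, `trig₁ L c` is the L₂ projection of `v`
onto the sines. -/
lemma integral_trig₁_sq_le {L : ℝ} (hL : 0 < L) {N : ℕ} {c : Fin N → ℝ} {v : ℝ → ℝ}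
    (hv : MemLp v 2 (volI L))
    (h : ∀ k : Fin N,
      ∫ x in (0)..L, trig₁ L c x * sinMode L k x = ∫ x in Ioo 0 L, v x * sinMode L k x) :
    ∫ x in (0)..L, trig₁ L c x ^ 2 ≤ ∫ x in Ioo 0 L, v x ^ 2 := by
  have hvi := integrableOn_of_memLp hv
  have e1 : ∫ x in Ioo 0 L, v x * trig₁ L c x = ∫ x in (0)..L, trig₁ L c x ^ 2 := by
    have h1 : ∀ x, v x * trig₁ L c x =
        ∑ k : Fin N, -(c k * freq L k) * (v x * sinMode L k x) := fun x => by
      rw [trig₁, Finset.mul_sum]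
      exact Finset.sum_congr rfl fun k _ => by ring
    have h2 : ∀ x, trig₁ L c x ^ 2 =
        ∑ k : Fin N, -(c k * freq L k) * (trig₁ L c x * sinMode L k x) := fun x => by
      rw [sq]
      nth_rw 2 [trig₁]
      rw [Finset.mul_sum]
      exact Finset.sum_congr rfl fun k _ => by ring
    simp_rw [h1, h2]
    rw [integral_finsetSum _ fun k _ =>
        (integrableOn_mul_of_continuousOn hvi (by fun_prop)).const_mul _,
      intervalIntegral.integral_finsetSum fun k _ =>
        (by fun_prop : Continuous _).intervalIntegrable _ _]
    refine Finset.sum_congr rfl fun k _ => ?_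
    rw [integral_const_mul, intervalIntegral.integral_const_mul, h k]
  have hsq : IntegrableOn (fun x => trig₁ L c x ^ 2) (Ioo 0 L) :=
    ((by fun_prop : Continuous fun x => trig₁ L c x ^ 2).integrableOn_Icc).mono_set
      Ioo_subset_Icc_self
  have h0 : 0 ≤ ∫ x in Ioo 0 L, (v x - trig₁ L c x) ^ 2 := integral_nonneg fun x => sq_nonneg _
  have e2 : ∫ x in Ioo 0 L, (v x - trig₁ L c x) ^ 2 =
      (∫ x in Ioo 0 L, v x ^ 2) - 2 * (∫ x in Ioo 0 L, v x * trig₁ L c x)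
        + ∫ x in Ioo 0 L, trig₁ L c x ^ 2 := by
    have hm : IntegrableOn (fun x => v x * trig₁ L c x) (Ioo 0 L) :=
      integrableOn_mul_of_continuousOn hvi (by fun_prop)
    have h1 := integral_add (hv.integrable_sq.sub (hm.const_mul 2)) hsq
    have h2 := integral_sub hv.integrable_sq (hm.const_mul 2)
    simp only [Pi.sub_apply] at h1 h2
    rw [← integral_const_mul, ← h2, ← h1]
    refine integral_congr_ae (.of_forall fun x => ?_)
    simp only
    ring
  rw [setIntegral_Ioo_eq hL.le (fun x => trig₁ L c x ^ 2)] at e2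
  linarith

/-- Extends the time estimate from `[0, T]` to all times, since clamping does not increase
distances. The condition `4 * K ^ 2 ≤ D` covers the derivative of a difference of two functions
whose derivatives have norm at most `K`. -/
lemma abs_trig_sub_le_modulus {L D K T : ℝ} (hL : 0 < L) (hT : 0 ≤ T) {N : ℕ}
    {c : ℝ → Fin N → ℝ} {H : ℝ → ℝ → ℝ} (hH : Continuous fun p : ℝ × ℝ => H p.1 p.2)
    (hc : ∀ t, c t = c (projIcc 0 T hT t))
    (heq : ∀ s ∈ Icc 0 T, ∀ t ∈ Icc 0 T, ∀ k, c t k - c s k =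
      ∫ τ in s..t, ∫ x in (0)..L, -(2 / L) * (H τ x * (freq L k * sinMode L k x)))
    (hHD : ∀ s ∈ Icc 0 T, ∀ t ∈ Icc 0 T, s ≤ t → ∫ τ in s..t, ∫ x in (0)..L, H τ x ^ 2 ≤ D)
    (hK : ∀ t, ∫ x in (0)..L, trig₁ L (c t) x ^ 2 ≤ K ^ 2) (hKD : 4 * K ^ 2 ≤ D)
    (t s : ℝ) {x : ℝ} (hx : x ∈ Icc 0 L) :
    |trig L (c t) x - trig L (c s) x| ≤ modulus L D |t - s| := by
  wlog hst : s ≤ t generalizing s t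
  · rw [abs_sub_comm, abs_sub_comm t s]
    exact this s t (le_of_not_ge hst)
  have hD : 0 ≤ D := le_trans (by positivity) hKD
  have hmono : (projIcc 0 T hT s : ℝ) ≤ projIcc 0 T hT t := monotone_projIcc hT hst
  have hdist : (projIcc 0 T hT t : ℝ) - projIcc 0 T hT s ≤ |t - s| := by
    rw [abs_of_nonneg (sub_nonneg.2 hst)]
    simp only [coe_projIcc]
    rcases le_total t T with h1 | h1 <;> rcases le_total s T with h2 | h2 <;>
      rcases le_total 0 t with h3 | h3 <;> rcases le_total 0 s with h4 | h4 <;>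
      simp only [min_eq_left, min_eq_right, max_eq_left, max_eq_right, h1, h2, h3, h4, hT] <;>
      linarith
  rw [hc t, hc s, ← trig_sub]
  refine (abs_trig_le_modulus hL hH hmono (fun k => heq _ (projIcc 0 T hT s).2 _
    (projIcc 0 T hT t).2 k) (hHD _ (projIcc 0 T hT s).2 _ (projIcc 0 T hT t).2 hmono) ?_ hx).trans
    (modulus_mono hL hD hdist)
  refine le_trans ?_ hKD
  have h1 := hK (projIcc 0 T hT t)
  have h2 := hK (projIcc 0 T hT s)
  have h3 : ∫ x in (0)..L, trig₁ L (c (projIcc 0 T hT t) - c (projIcc 0 T hT s)) x ^ 2 ≤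
      ∫ x in (0)..L, (2 * trig₁ L (c (projIcc 0 T hT t)) x ^ 2
        + 2 * trig₁ L (c (projIcc 0 T hT s)) x ^ 2) := by
    refine intervalIntegral.integral_mono_on hL.le
      ((by fun_prop : Continuous _).intervalIntegrable _ _)
      ((by fun_prop : Continuous _).intervalIntegrable _ _) fun x _ => ?_
    rw [trig₁_sub]
    nlinarith [sq_nonneg (trig₁ L (c (projIcc 0 T hT t)) x + trig₁ L (c (projIcc 0 T hT s)) x)]
  rw [intervalIntegral.integral_add ((by fun_prop : Continuous _).intervalIntegrable _ _)
    ((by fun_prop : Continuous _).intervalIntegrable _ _), intervalIntegral.integral_const_mul,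
    intervalIntegral.integral_const_mul] at h3
  exact h3.trans (by linarith)

lemma integral_trig_sub_mul_cosMode {L : ℝ} (hL : 0 < L) {N : ℕ} {c c' : Fin N → ℝ}
    {H : ℝ → ℝ → ℝ} {t : ℝ} (k : Fin N)
    (heq : c k - c' k = ∫ τ in (0)..t, ∫ x in (0)..L,
      -(2 / L) * (H τ x * (freq L k * sinMode L k x))) :
    ∫ x in (0)..L, (trig L c x - trig L c' x) * cosMode L k x =
      ∫ τ in (0)..t, ∫ x in (0)..L, H τ x * -(freq L k * sinMode L k x) := by
  simp_rw [← trig_sub]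
  rw [integral_trig_mul_cosMode hL, Pi.sub_apply, heq]
  simp_rw [intervalIntegral.integral_const_mul]
  split_ifs with hk
  · simp [hk, freq_zero]
  · simp only [mul_neg, intervalIntegral.integral_neg]
    rw [mul_comm, ← mul_assoc, mul_neg, show L / 2 * (2 / L) = 1 by field_simp, neg_one_mul]

/-- The initial coefficients of the approximation, given the derivative and the integral of the
initial value. -/
def initCoeff (L : ℝ) (v : ℝ → ℝ) (m : ℝ) (N : ℕ) (k : Fin N) : ℝ :=
  if (k : ℕ) = 0 then m / L else -(2 / L / freq L k * ∫ x in Ioo 0 L, v x * sinMode L k x)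

lemma integral_trig₁_initCoeff {L : ℝ} (hL : 0 < L) (v : ℝ → ℝ) (m : ℝ) (N : ℕ) (k : Fin N) :
    ∫ x in (0)..L, trig₁ L (initCoeff L v m N) x * sinMode L k x =
      ∫ x in Ioo 0 L, v x * sinMode L k x := by
  rw [integral_trig₁_mul_sinMode hL, initCoeff]
  split_ifs with hk
  · simp [hk, freq_zero, sinMode_zero]
  · have := (freq_pos hL hk).ne'
    field_simp

lemma integral_trig {L : ℝ} (hL : 0 < L) {N : ℕ} (c : Fin (N + 1) → ℝ) :
    ∫ x in (0)..L, trig L c x = c 0 * L := by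
  have := integral_trig_mul_cosMode hL c 0
  simpa [cosMode_zero] using this

lemma integral_flux_sq_le {L C E : ℝ} (hL : 0 < L) (hC : 0 ≤ C) {H Δ : ℝ → ℝ → ℝ}
    (hH : Continuous fun p : ℝ × ℝ => H p.1 p.2) (hΔ : Continuous fun p : ℝ × ℝ => Δ p.1 p.2)
    (hle : ∀ τ, ∀ x ∈ Icc 0 L, H τ x ^ 2 ≤ C * Δ τ x) {s t : ℝ} (hst : s ≤ t)
    (hE : ∫ τ in s..t, ∫ x in (0)..L, Δ τ x ≤ E) :
    ∫ τ in s..t, ∫ x in (0)..L, H τ x ^ 2 ≤ C * E := by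
  have h1 : ∀ τ, ∫ x in (0)..L, H τ x ^ 2 ≤ C * ∫ x in (0)..L, Δ τ x := fun τ => by
    rw [← intervalIntegral.integral_const_mul]
    have e1 : Continuous (H τ) := hH.comp (by fun_prop : Continuous fun x => (τ, x))
    have e2 : Continuous (Δ τ) := hΔ.comp (by fun_prop : Continuous fun x => (τ, x))
    exact intervalIntegral.integral_mono_on hL.le ((e1.pow 2).intervalIntegrable _ _)
      ((e2.const_mul _).intervalIntegrable _ _) (hle τ)
  have e3 : Continuous fun τ => ∫ x in (0)..L, H τ x ^ 2 :=
    intervalIntegral.continuous_parametric_intervalIntegral_of_continuous'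
      (f := fun τ x => H τ x ^ 2) (by simp only [Function.uncurry_def]; fun_prop) 0 L
  have e4 : Continuous fun τ => ∫ x in (0)..L, Δ τ x :=
    intervalIntegral.continuous_parametric_intervalIntegral_of_continuous' (f := Δ) hΔ 0 L
  have h2 := intervalIntegral.integral_mono_on (μ := volume) hst (e3.intervalIntegrable _ _)
    ((e4.const_mul C).intervalIntegrable _ _) fun τ _ => h1 τ
  rw [intervalIntegral.integral_const_mul] at h2
  exact h2.trans (mul_le_mul_of_nonneg_left hE hC)

lemma galF_sq_le {L R μ M : ℝ} (hμ : 0 < μ) {A : ℝ → ℝ} {N : ℕ} {c d : Fin N → ℝ} {x : ℝ}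
    (hc : |A (trig L c x)| ≤ M) :
    galF L R A c d x ^ 2 ≤ M ^ 6 * (9 * (μ + 1)) * galD L R μ A c d x := by
  unfold galF galD
  exact hF_sq_le hμ hc

lemma galG_sq_le {L R μ M : ℝ} (hμ : 0 < μ) {A : ℝ → ℝ} {N : ℕ} {c d : Fin N → ℝ} {x : ℝ}
    (hc : |A (trig L c x)| ≤ M) (hd : |A (trig L d x)| ≤ M) :
    galG L R μ A c d x ^ 2 ≤ M ^ 6 * (9 * (μ + 1)) * galD L R μ A c d x := by
  unfold galG galD
  exact hG_sq_le hμ hc hd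

/-- All constants are independent of `n`: `K` comes from the energy, `B` from the mean plus the
Hölder bound, `M` from the size of the regularized root on `[-B, B]`, and `D` from the flux estimate
plus the derivative of an increment. -/
lemma exists_bounded_galerkin {L R μ : ℝ} (hL : 0 < L) (hR : 0 < R) (hμ : 0 < μ) {v w : ℝ → ℝ}
    (hv : MemLp v 2 (volI L)) (hw : MemLp w 2 (volI L)) (m l : ℝ) {A : ℝ → ℝ}
    (hA : ContDiff ℝ 1 A) {E K B M D : ℝ}
    (hE : E = 1 / 2 * ∫ x in Ioo 0 L, (v x ^ 2 + R * (v x + w x) ^ 2)) (hK0 : 0 < K)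
    (hK : 4 * E / R + 4 * E ≤ K ^ 2) (hB : (|m| + |l|) / L + K * Real.sqrt L ≤ B)
    (hM : ∀ z, |z| ≤ B → |A z| ≤ M) (hD : M ^ 6 * (9 * (μ + 1)) * E + 4 * K ^ 2 ≤ D) (n : ℕ) :
    ∃ c d : ℝ → Fin (n + 1) → ℝ, Continuous c ∧ Continuous d ∧
      c 0 = initCoeff L v m (n + 1) ∧ d 0 = initCoeff L w l (n + 1) ∧
      (∀ t ∈ Icc (0 : ℝ) n, trigEnergy L R (c t) (d t)
        + ∫ τ in (0)..t, ∫ x in (0)..L, galD L R μ A (c τ) (d τ) x ≤ E) ∧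
      (∀ t, ∫ x in (0)..L, trig₁ L (c t) x ^ 2 ≤ K ^ 2) ∧
      (∀ t, ∫ x in (0)..L, trig₁ L (d t) x ^ 2 ≤ K ^ 2) ∧
      (∀ t, ∀ x ∈ Icc 0 L, |trig L (c t) x| ≤ B) ∧
      (∀ t, ∀ x ∈ Icc 0 L, |trig L (d t) x| ≤ B) ∧
      (∀ t s, ∀ x ∈ Icc 0 L, |trig L (c t) x - trig L (c s) x| ≤ modulus L D |t - s|) ∧
      (∀ t s, ∀ x ∈ Icc 0 L, |trig L (d t) x - trig L (d s) x| ≤ modulus L D |t - s|) ∧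
      ∀ t ∈ Icc (0 : ℝ) n, ∀ k,
        c t k - c 0 k = ∫ τ in (0)..t, ∫ x in (0)..L,
          -(2 / L) * (galF L R A (c τ) (d τ) x * (freq L k * sinMode L k x)) ∧
        d t k - d 0 k = ∫ τ in (0)..t, ∫ x in (0)..L,
          -(2 / L) * (galG L R μ A (c τ) (d τ) x * (freq L k * sinMode L k x)) := by
  have hn : (0 : ℝ) ≤ n := Nat.cast_nonneg n
  obtain ⟨c, d, hc, hd, hc0, hd0, hproj, hen, heq⟩ := exists_galerkin hL hR hμ hA
    (initCoeff L v m (n + 1)) (initCoeff L w l (n + 1)) hn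
  have h0n : (0 : ℝ) ∈ Icc (0 : ℝ) n := ⟨le_rfl, hn⟩
  have hE0 : 0 ≤ E := by
    rw [hE]
    have : 0 ≤ ∫ x in Ioo 0 L, (v x ^ 2 + R * (v x + w x) ^ 2) :=
      integral_nonneg fun x => by positivity
    positivity
  -- The energy is built from the derivatives of the first component and of the sum, so Bessel's
  -- inequality is applied to these two.
  have hinit : trigEnergy L R (initCoeff L v m (n + 1)) (initCoeff L w l (n + 1)) ≤ E := by
    rw [trigEnergy_eq hL, hE]
    have h1 := integral_trig₁_sq_le hL hv (integral_trig₁_initCoeff hL v m (n + 1))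
    have h2 := integral_trig₁_sq_le hL (hv.add hw)
      (c := initCoeff L v m (n + 1) + initCoeff L w l (n + 1)) fun k => by
        simp_rw [trig₁_add, add_mul, Pi.add_apply, add_mul]
        rw [intervalIntegral.integral_add ((by fun_prop : Continuous _).intervalIntegrable _ _)
          ((by fun_prop : Continuous _).intervalIntegrable _ _),
          integral_trig₁_initCoeff hL, integral_trig₁_initCoeff hL, integral_add]
        · exact integrableOn_mul_of_continuousOn (integrableOn_of_memLp hv) (by fun_prop)
        · exact integrableOn_mul_of_continuousOn (integrableOn_of_memLp hw) (by fun_prop)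
    simp only [Pi.add_apply] at h2
    have h3 := (hv.add hw).integrable_sq
    simp only [Pi.add_apply] at h3
    rw [integral_add hv.integrable_sq (h3.const_mul R), integral_const_mul]
    gcongr
  have hpc : Continuous fun p : ℝ × ℝ => ((c p.1, d p.1), p.2) :=
    ((hc.comp continuous_fst).prodMk (hd.comp continuous_fst)).prodMk continuous_snd
  have hcDD : Continuous fun p : ℝ × ℝ => galD L R μ A (c p.1) (d p.1) p.2 := by
    have h := (continuous_galD L R μ hA.continuous (n + 1)).comp hpc
    simp only [Function.comp_def] at h
    exact h
  have hcD : Continuous fun τ => ∫ x in (0)..L, galD L R μ A (c τ) (d τ) x :=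
    intervalIntegral.continuous_parametric_intervalIntegral_of_continuous'
      (f := fun τ x => galD L R μ A (c τ) (d τ) x) hcDD 0 L
  have hDnn : ∀ τ, 0 ≤ ∫ x in (0)..L, galD L R μ A (c τ) (d τ) x := fun τ =>
    intervalIntegral.integral_nonneg hL.le fun x _ => dissip_nonneg hμ _ _ _
  have henle : ∀ t ∈ Icc (0 : ℝ) n, trigEnergy L R (c t) (d t) ≤ E := fun t ht => by
    have h1 := hen t ht
    have h2 : 0 ≤ ∫ τ in (0)..t, ∫ x in (0)..L, galD L R μ A (c τ) (d τ) x :=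
      intervalIntegral.integral_nonneg ht.1 fun τ _ => hDnn τ
    linarith
  have henle' : ∀ t, trigEnergy L R (c t) (d t) ≤ E := fun t => by
    rw [(hproj t).1, (hproj t).2]
    exact henle _ (projIcc (0 : ℝ) n hn t).2
  have hsq : ∀ t, ∫ x in (0)..L, trig₁ L (c t) x ^ 2 ≤ 2 * E ∧
      ∫ x in (0)..L, trig₁ L (c t + d t) x ^ 2 ≤ 2 * E / R := fun t => by
    have h1 := henle' t
    rw [trigEnergy_eq hL] at h1
    have h2 : 0 ≤ ∫ x in (0)..L, trig₁ L (c t) x ^ 2 :=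
      intervalIntegral.integral_nonneg hL.le fun x _ => sq_nonneg _
    have h3 : 0 ≤ ∫ x in (0)..L, trig₁ L (c t + d t) x ^ 2 :=
      intervalIntegral.integral_nonneg hL.le fun x _ => sq_nonneg _
    have h4 := mul_nonneg hR.le h3
    refine ⟨by linarith, ?_⟩
    rw [le_div_iff₀ hR]
    linarith
  have hER : 0 ≤ E / R := by positivity
  have hKc : ∀ t, ∫ x in (0)..L, trig₁ L (c t) x ^ 2 ≤ K ^ 2 := fun t => by
    have h1 := (hsq t).1
    have h2 : 4 * E / R = 4 * (E / R) := by ring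
    linarith
  -- The energy does not contain the second component by itself; it is the sum minus the first,
  -- which explains `4 * E / R + 4 * E` in the bound for `K`.
  have hKd : ∀ t, ∫ x in (0)..L, trig₁ L (d t) x ^ 2 ≤ K ^ 2 := fun t => by
    obtain ⟨h1, h2⟩ := hsq t
    have h3 : ∫ x in (0)..L, trig₁ L (d t) x ^ 2 ≤
        ∫ x in (0)..L, (2 * trig₁ L (c t + d t) x ^ 2 + 2 * trig₁ L (c t) x ^ 2) := by
      refine intervalIntegral.integral_mono_on hL.le
        ((by fun_prop : Continuous _).intervalIntegrable _ _)
        ((by fun_prop : Continuous _).intervalIntegrable _ _) fun x _ => ?_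
      rw [trig₁_add]
      nlinarith [sq_nonneg (2 * trig₁ L (c t) x + trig₁ L (d t) x)]
    rw [intervalIntegral.integral_add ((by fun_prop : Continuous _).intervalIntegrable _ _)
      ((by fun_prop : Continuous _).intervalIntegrable _ _), intervalIntegral.integral_const_mul,
      intervalIntegral.integral_const_mul] at h3
    have h4 : 4 * E / R = 2 * (2 * E / R) := by ring
    linarith
  have hmass : ∀ t, c t 0 = m / L ∧ d t 0 = l / L := fun t => by
    have h1 := heq 0 h0n _ (projIcc (0 : ℝ) n hn t).2 0
    rw [(hproj t).1, (hproj t).2]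
    simp only [Fin.val_zero, freq_zero, zero_mul, mul_zero, intervalIntegral.integral_zero, hc0,
      hd0, sub_eq_zero] at h1
    rw [h1.1, h1.2]
    simp [initCoeff]
  have hBc : ∀ t, ∀ x ∈ Icc 0 L, |trig L (c t) x| ≤ B := fun t x hx => by
    refine (abs_le_of_integral_sq_le hL hK0 (hasDerivAt_trig L (c t)) (continuous_trig₁ L _)
      (hKc t) hx).trans (le_trans ?_ hB)
    rw [integral_trig hL, (hmass t).1, div_mul_cancel₀ _ hL.ne']
    gcongr
    linarith [abs_nonneg l]
  have hBd : ∀ t, ∀ x ∈ Icc 0 L, |trig L (d t) x| ≤ B := fun t x hx => by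
    refine (abs_le_of_integral_sq_le hL hK0 (hasDerivAt_trig L (d t)) (continuous_trig₁ L _)
      (hKd t) hx).trans (le_trans ?_ hB)
    rw [integral_trig hL, (hmass t).2, div_mul_cancel₀ _ hL.ne']
    gcongr
    linarith [abs_nonneg m]
  have hcF : Continuous fun p : ℝ × ℝ => galF L R A (c p.1) (d p.1) p.2 := by
    have h := (contDiff_galF L R hA (n + 1)).continuous.comp hpc
    simp only [Function.comp_def] at h
    exact h
  have hcG : Continuous fun p : ℝ × ℝ => galG L R μ A (c p.1) (d p.1) p.2 := by
    have h := (contDiff_galG L R μ hA (n + 1)).continuous.comp hpc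
    simp only [Function.comp_def] at h
    exact h
  have hDint : ∀ s ∈ Icc (0 : ℝ) n, ∀ t ∈ Icc (0 : ℝ) n, s ≤ t →
      ∫ τ in s..t, ∫ x in (0)..L, galD L R μ A (c τ) (d τ) x ≤ E := by
    intro s hs t ht hst
    have h4 : ∫ τ in s..t, ∫ x in (0)..L, galD L R μ A (c τ) (d τ) x ≤
        ∫ τ in (0)..t, ∫ x in (0)..L, galD L R μ A (c τ) (d τ) x :=
      intervalIntegral.integral_mono_interval hs.1 hst le_rfl (.of_forall hDnn)
        (hcD.intervalIntegrable _ _)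
    have h5 := hen t ht
    have h6 : 0 ≤ trigEnergy L R (c t) (d t) := by
      unfold trigEnergy
      have : 0 ≤ ∑ k : Fin (n + 1), freq L k ^ 2 * (c t k ^ 2 + R * (c t k + d t k) ^ 2) :=
        Finset.sum_nonneg fun k _ => by positivity
      positivity
    linarith
  have hC0 : 0 ≤ M ^ 6 * (9 * (μ + 1)) := by positivity
  have hCD : M ^ 6 * (9 * (μ + 1)) * E ≤ D := by linarith [sq_nonneg K]
  have hKD : 4 * K ^ 2 ≤ D := by
    have : 0 ≤ M ^ 6 * (9 * (μ + 1)) * E := by positivity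
    linarith
  refine ⟨c, d, hc, hd, hc0, hd0, fun t ht => (hen t ht).trans_le hinit, hKc, hKd, hBc, hBd,
    fun t s x hx => ?_, fun t s x hx => ?_, fun t ht k => heq 0 h0n t ht k⟩
  · exact abs_trig_sub_le_modulus hL hn hcF (fun t => (hproj t).1)
      (fun s hs t ht k => (heq s hs t ht k).1)
      (fun s hs t ht hst => (integral_flux_sq_le hL hC0 hcF hcDD
        (fun τ x hx => galF_sq_le hμ (hM _ (hBc τ x hx))) hst (hDint s hs t ht hst)).trans hCD)
      hKc hKD t s hx
  · exact abs_trig_sub_le_modulus hL hn hcG (fun t => (hproj t).2)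
      (fun s hs t ht k => (heq s hs t ht k).2)
      (fun s hs t ht hst => (integral_flux_sq_le hL hC0 hcG hcDD
        (fun τ x hx => galG_sq_le hμ (hM _ (hBc τ x hx)) (hM _ (hBd τ x hx))) hst
          (hDint s hs t ht hst)).trans hCD)
      hKd hKD t s hx

/-- Approximate solutions exist. -/
lemma exists_approxSeq {L R μ : ℝ} (hL : 0 < L) (hR : 0 < R) (hμ : 0 < μ) {v w : ℝ → ℝ}
    (hv : MemLp v 2 (volI L)) (hw : MemLp w 2 (volI L)) (m l : ℝ) :
    Nonempty (ApproxSeq L R μ v w m l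
      (1 / 2 * ∫ x in Ioo 0 L, (v x ^ 2 + R * (v x + w x) ^ 2))) := by
  set E := 1 / 2 * ∫ x in Ioo 0 L, (v x ^ 2 + R * (v x + w x) ^ 2) with hE
  have hE0 : 0 ≤ E := by
    have : 0 ≤ ∫ x in Ioo 0 L, (v x ^ 2 + R * (v x + w x) ^ 2) :=
      integral_nonneg fun x => by positivity
    positivity
  -- The summand 1 only keeps `K` positive when the energy is zero.
  set K := Real.sqrt (4 * E / R + 4 * E + 1) with hK
  have hK0 : 0 < K := Real.sqrt_pos.2 (by positivity)
  have hK2 : K ^ 2 = 4 * E / R + 4 * E + 1 := Real.sq_sqrt (by positivity)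
  set B := (|m| + |l|) / L + K * Real.sqrt L with hB
  -- The summand 1 absorbs the regularization error, which is at most 1 for every `n`.
  set M := Real.sqrt B + 1 with hM
  set D := M ^ 6 * (9 * (μ + 1)) * E + 4 * K ^ 2 with hD
  have hD0 : 0 ≤ D := by positivity
  let A : ℕ → ℝ → ℝ := fun n => smoothSqrt (1 / (n + 1))
  have hδ : ∀ n : ℕ, (0 : ℝ) < 1 / (n + 1) := fun n => by positivity
  have hA : ∀ n, ContDiff ℝ 1 (A n) := fun n => contDiff_smoothSqrt (hδ n)
  have hAM : ∀ n z, |z| ≤ B → |A n z| ≤ M := fun n z hz => by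
    have h1 := abs_smoothSqrt_sub_le (hδ n) z
    have h2 : Real.sqrt (1 / ((n : ℝ) + 1)) ≤ 1 := by
      rw [Real.sqrt_le_one, div_le_one (by positivity)]
      linarith [(Nat.cast_nonneg n : (0 : ℝ) ≤ n)]
    have h3 : Real.sqrt z ≤ Real.sqrt B := Real.sqrt_le_sqrt ((le_abs_self z).trans hz)
    have h4 := abs_sub_abs_le_abs_sub (A n z) (Real.sqrt z)
    rw [abs_of_nonneg (Real.sqrt_nonneg z)] at h4
    change |A n z - Real.sqrt z| ≤ _ at h1
    linarith
  choose c d hc hd hc0 hd0 hen hKc hKd hBc hBd htc htd heq using fun n =>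
    exists_bounded_galerkin hL hR hμ hv hw m l (hA n) hE hK0 (by linarith) le_rfl (hAM n)
      (le_refl D) n
  have hpc : ∀ n, Continuous fun p : ℝ × ℝ => (c n p.1, p.2) := fun n =>
    ((hc n).comp continuous_fst).prodMk continuous_snd
  have hpd : ∀ n, Continuous fun p : ℝ × ℝ => (d n p.1, p.2) := fun n =>
    ((hd n).comp continuous_fst).prodMk continuous_snd
  have hcf : ∀ n, Continuous fun p : ℝ × ℝ => trig L (c n p.1) p.2 := fun n =>
    (contDiff_trig L (n + 1) (n := 0)).continuous.comp (hpc n)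
  have hcg : ∀ n, Continuous fun p : ℝ × ℝ => trig L (d n p.1) p.2 := fun n =>
    (contDiff_trig L (n + 1) (n := 0)).continuous.comp (hpd n)
  exact ⟨{
    f := fun n t => trig L (c n t)
    f₁ := fun n t => trig₁ L (c n t)
    f₂ := fun n t => trig₂ L (c n t)
    f₃ := fun n t => trig₃ L (c n t)
    g := fun n t => trig L (d n t)
    g₁ := fun n t => trig₁ L (d n t)
    g₂ := fun n t => trig₂ L (d n t)
    g₃ := fun n t => trig₃ L (d n t)
    a := fun n t x => A n (trig L (c n t) x)
    b := fun n t x => A n (trig L (d n t) x)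
    K := K
    B := B
    D := D
    bdd_f := ⟨hK0, hD0, hcf, fun n => (contDiff_trig₁ L (n + 1) (n := 0)).continuous.comp (hpc n),
      fun n t x => hasDerivAt_trig L _ x, hKc, hBc, htc⟩
    bdd_g := ⟨hK0, hD0, hcg, fun n => (contDiff_trig₁ L (n + 1) (n := 0)).continuous.comp (hpd n),
      fun n t x => hasDerivAt_trig L _ x, hKd, hBd, htd⟩
    cont_f₂ := fun n => (contDiff_trig₂ L (n + 1) (n := 0)).continuous.comp (hpc n)
    cont_f₃ := fun n => (contDiff_trig₃ L (n + 1) (n := 0)).continuous.comp (hpc n)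
    cont_g₂ := fun n => (contDiff_trig₂ L (n + 1) (n := 0)).continuous.comp (hpd n)
    cont_g₃ := fun n => (contDiff_trig₃ L (n + 1) (n := 0)).continuous.comp (hpd n)
    deriv_f₁ := fun n t x => hasDerivAt_trig₁ L _ x
    deriv_f₂ := fun n t x => hasDerivAt_trig₂ L _ x
    deriv_g₁ := fun n t x => hasDerivAt_trig₁ L _ x
    deriv_g₂ := fun n t x => hasDerivAt_trig₂ L _ x
    cont_a := fun n => (hA n).continuous.comp (hcf n)
    cont_b := fun n => (hA n).continuous.comp (hcg n)
    near_a := fun n t x => abs_smoothSqrt_sub_le (hδ n) _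
    near_b := fun n t x => abs_smoothSqrt_sub_le (hδ n) _
    energy_le := fun n t ht => by
      have := hen n t ht
      rw [trigEnergy_eq hL] at this
      simp_rw [trig₁_add] at this
      exact this
    eq_f := fun n k hk t ht => integral_trig_sub_mul_cosMode hL
      (⟨k, Nat.lt_succ_of_le hk⟩ : Fin (n + 1)) (heq n t ht _).1
    eq_g := fun n k hk t ht => integral_trig_sub_mul_cosMode hL
      (⟨k, Nat.lt_succ_of_le hk⟩ : Fin (n + 1)) (heq n t ht _).2
    init_f := fun n k hk => by
      rw [hc0]
      exact integral_trig₁_initCoeff hL v m (n + 1) ⟨k, Nat.lt_succ_of_le hk⟩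
    init_g := fun n k hk => by
      rw [hd0]
      exact integral_trig₁_initCoeff hL w l (n + 1) ⟨k, Nat.lt_succ_of_le hk⟩
    mass_f := fun n => by
      rw [hc0, integral_trig hL]
      simp [initCoeff, hL.ne']
    mass_g := fun n => by
      rw [hd0, integral_trig hL]
      simp [hL.ne', initCoeff] }⟩

/-! ### Limits of bounded sequences -/

lemma tendsto_setIntegral_mul_of_tendstoUniformlyOn {α : Type*} [MeasurableSpace α]
    {ν : Measure α} {l : Filter ℕ} {S : Set α} (hS : MeasurableSet S) {F : ℕ → α → ℝ}
    {f ψ : α → ℝ} (h : TendstoUniformlyOn F f l S)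
    (hF : ∀ n, IntegrableOn (fun a => F n a * ψ a) S ν)
    (hf : IntegrableOn (fun a => f a * ψ a) S ν) (hψ : IntegrableOn ψ S ν) :
    Tendsto (fun n => ∫ a in S, F n a * ψ a ∂ν) l (𝓝 (∫ a in S, f a * ψ a ∂ν)) := by
  refine Metric.tendsto_nhds.2 fun ε hε => ?_
  set I := ∫ a in S, |ψ a| ∂ν with hI
  have hI0 : 0 ≤ I := integral_nonneg fun a => abs_nonneg _
  filter_upwards [Metric.tendstoUniformlyOn_iff.1 h (ε / (I + 1)) (by positivity)] with n hn
  rw [dist_eq_norm, ← integral_sub (hF n) hf]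
  refine lt_of_le_of_lt (norm_integral_le_integral_norm _) ?_
  refine lt_of_le_of_lt (b := ∫ a in S, ε / (I + 1) * |ψ a| ∂ν) ?_ ?_
  · refine setIntegral_mono_on ((hF n).sub hf).norm (hψ.abs.const_mul _) hS fun a ha => ?_
    rw [← sub_mul, norm_mul, ← dist_eq_norm, dist_comm, Real.norm_eq_abs]
    exact mul_le_mul_of_nonneg_right (hn a ha).le (abs_nonneg _)
  · rw [integral_const_mul, ← hI, div_mul_eq_mul_div, div_lt_iff₀ (by positivity)]
    nlinarith

/-- Bounds of the norm pass to weak limits. -/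
lemma integral_sq_le_of_weak {α : Type*} [MeasurableSpace α] {ν : Measure α} {l : Filter ℕ}
    [l.NeBot] {j : ℕ → α → ℝ} {J : α → ℝ} (hj : ∀ n, MemLp (j n) 2 ν) (hJ : MemLp J 2 ν)
    (hw : Tendsto (fun n => ∫ a, j n a * J a ∂ν) l (𝓝 (∫ a, J a * J a ∂ν))) {C : ℝ}
    (hC : ∀ᶠ n in l, ∫ a, j n a ^ 2 ∂ν ≤ C) : ∫ a, J a ^ 2 ∂ν ≤ C := by
  have key : ∀ n, 2 * (∫ a, j n a * J a ∂ν) - ∫ a, J a ^ 2 ∂ν ≤ ∫ a, j n a ^ 2 ∂ν := fun n => by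
    have hm := (hj n).integrable_mul hJ
    simp only [Pi.mul_def] at hm
    have h1 : 0 ≤ ∫ a, (j n a - J a) ^ 2 ∂ν := integral_nonneg fun a => sq_nonneg _
    have h2 : ∫ a, (j n a - J a) ^ 2 ∂ν =
        ∫ a, j n a ^ 2 ∂ν - 2 * (∫ a, j n a * J a ∂ν) + ∫ a, J a ^ 2 ∂ν := by
      have e1 := integral_add ((hj n).integrable_sq.sub (hm.const_mul 2)) hJ.integrable_sq
      have e2 := integral_sub (hj n).integrable_sq (hm.const_mul 2)
      simp only [Pi.sub_apply] at e1 e2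
      rw [← integral_const_mul, ← e2, ← e1]
      refine integral_congr_ae (.of_forall fun a => ?_)
      simp only
      ring
    linarith
  have h3 := le_of_tendsto ((hw.const_mul 2).sub_const (∫ a, J a ^ 2 ∂ν))
    (hC.mono fun n hn => (key n).trans hn)
  have h4 : ∫ a, J a * J a ∂ν = ∫ a, J a ^ 2 ∂ν := by simp_rw [sq]
  rw [h4] at h3
  linarith

/-- The limit of a bounded sequence along an ultrafilter. -/
structure IsUniformLimit (L K B D : ℝ) (U : Ultrafilter ℕ) (u : ℕ → ℝ → ℝ → ℝ)
    (v : ℝ → ℝ → ℝ) : Prop where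
  cont : Continuous fun p : ℝ × ℝ => v p.1 p.2
  unif : ∀ T, TendstoUniformlyOn (fun n (p : ℝ × ℝ) => u n p.1 p.2) (fun p => v p.1 p.2) U
    (Icc 0 T ×ˢ Icc 0 L)
  space : ∀ t, ∀ x ∈ Icc 0 L, ∀ y ∈ Icc 0 L, |v t x - v t y| ≤ K * Real.sqrt |x - y|
  time : ∀ t s, ∀ x ∈ Icc 0 L, |v t x - v s x| ≤ modulus L D |t - s|
  bound : ∀ t, ∀ x ∈ Icc 0 L, |v t x| ≤ B

/-- Arzelà–Ascoli along an ultrafilter: pointwise limits exist because all values lie in the compact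
interval `[-B, B]`, and equicontinuity makes the convergence uniform on compact rectangles. The
limit is defined without reference to `T`, so it serves all `T` at once. -/
lemma IsBoundedSeq.exists_limit {L K B D : ℝ} (hL : 0 < L) {u u₁ : ℕ → ℝ → ℝ → ℝ}
    (h : IsBoundedSeq L K B D u u₁) (U : Ultrafilter ℕ) :
    ∃ v, IsUniformLimit L K B D U u v := by
  -- The estimates hold only for `x` in `[0, L]`; clamping `x` yields a limit that is continuous on
  -- the whole plane.
  let q : ℝ → ℝ := fun x => projIcc 0 L hL.le x
  have hq : Continuous q := continuous_subtype_val.comp continuous_projIcc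
  have hqm : ∀ x, q x ∈ Icc 0 L := fun x => (projIcc 0 L hL.le x).2
  have hqi : ∀ x ∈ Icc 0 L, q x = x := fun x hx => by simp only [q, projIcc_of_mem hL.le hx]
  have hex : ∀ t x, ∃ y, Tendsto (fun n => u n t (q x)) U (𝓝 y) := fun t x => by
    obtain ⟨y, -, hy⟩ := (isCompact_Icc (a := -B) (b := B)).ultrafilter_le_nhds
      (U.map fun n => u n t (q x)) (by
        rw [le_principal_iff, Ultrafilter.mem_coe, Ultrafilter.mem_map]
        exact Filter.univ_mem' fun n => abs_le.1 (h.bound n t _ (hqm x)))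
    exact ⟨y, hy⟩
  choose v hv using hex
  have hspace : ∀ n t, ∀ x ∈ Icc 0 L, ∀ y ∈ Icc 0 L,
      |u n t x - u n t y| ≤ K * Real.sqrt |x - y| := fun n t x hx y hy =>
    abs_sub_le_of_integral_sq_le h.K_pos (h.deriv n t)
      ((h.cont₁ n).comp (by fun_prop : Continuous fun x => (t, x))) (h.bound₁ n t) hx hy
  have hvq : ∀ t x, v t (q x) = v t x := fun t x => by
    have h1 := hv t (q x)
    rw [hqi _ (hqm x)] at h1
    exact tendsto_nhds_unique h1 (hv t x)
  have vspace : ∀ t, ∀ x ∈ Icc 0 L, ∀ y ∈ Icc 0 L,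
      |v t x - v t y| ≤ K * Real.sqrt |x - y| := fun t x hx y hy => by
    have h1 := ((hv t x).sub (hv t y)).abs
    rw [hqi x hx, hqi y hy] at h1
    exact le_of_tendsto h1 (.of_forall fun n => hspace n t x hx y hy)
  have vtime : ∀ t s, ∀ x ∈ Icc 0 L, |v t x - v s x| ≤ modulus L D |t - s| := fun t s x hx => by
    have h1 := ((hv t x).sub (hv s x)).abs
    rw [hqi x hx] at h1
    exact le_of_tendsto h1 (.of_forall fun n => h.time n t s x hx)
  refine ⟨v, ?_, ?_, vspace, vtime, fun t x hx => ?_⟩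
  · rw [continuous_iff_continuousAt]
    rintro ⟨s, y⟩
    have hb : Tendsto (fun p : ℝ × ℝ => modulus L D |p.1 - s| + K * Real.sqrt |q p.2 - q y|)
        (𝓝 (s, y)) (𝓝 0) := by
      have : Continuous fun p : ℝ × ℝ => modulus L D |p.1 - s| + K * Real.sqrt |q p.2 - q y| := by
        fun_prop
      have h1 := this.tendsto (s, y)
      simpa [modulus_zero] using h1
    rw [ContinuousAt, tendsto_iff_dist_tendsto_zero]
    refine squeeze_zero (fun _ => dist_nonneg) (fun p => ?_) hb
    rw [Real.dist_eq, ← hvq p.1 p.2, ← hvq s y]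
    calc |v p.1 (q p.2) - v s (q y)|
        ≤ |v p.1 (q p.2) - v s (q p.2)| + |v s (q p.2) - v s (q y)| := abs_sub_le _ _ _
      _ ≤ _ := add_le_add (vtime _ _ _ (hqm _)) (vspace _ _ (hqm _) _ (hqm _))
  · intro T
    have hcomp : CompactSpace ↥(Icc 0 T ×ˢ Icc 0 L) :=
      isCompact_iff_compactSpace.1 (isCompact_Icc.prod isCompact_Icc)
    have heq : Equicontinuous fun n (p : ↥(Icc 0 T ×ˢ Icc 0 L)) => u n p.1.1 p.1.2 := by
      refine Metric.equicontinuous_of_continuity_modulus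
        (fun r => modulus L D r + K * Real.sqrt r) ?_ _ fun p p' n => ?_
      · have : Continuous fun r => modulus L D r + K * Real.sqrt r := by fun_prop
        have h1 := this.tendsto 0
        simpa [modulus_zero] using h1
      · rw [Real.dist_eq]
        have h1 : |p.1.1 - p'.1.1| ≤ dist p p' := by
          rw [← Real.dist_eq, Subtype.dist_eq, Prod.dist_eq]
          exact le_max_left _ _
        have h2 : |p.1.2 - p'.1.2| ≤ dist p p' := by
          rw [← Real.dist_eq, Subtype.dist_eq, Prod.dist_eq]
          exact le_max_right _ _
        calc |u n p.1.1 p.1.2 - u n p'.1.1 p'.1.2|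
            ≤ |u n p.1.1 p.1.2 - u n p'.1.1 p.1.2|
              + |u n p'.1.1 p.1.2 - u n p'.1.1 p'.1.2| := abs_sub_le _ _ _
          _ ≤ modulus L D |p.1.1 - p'.1.1| + K * Real.sqrt |p.1.2 - p'.1.2| :=
              add_le_add (h.time _ _ _ _ p.2.2) (hspace _ _ _ p.2.2 _ p'.2.2)
          _ ≤ _ := add_le_add (modulus_mono hL h.D_nonneg h1)
              (mul_le_mul_of_nonneg_left (Real.sqrt_le_sqrt h2) h.K_pos.le)
    have h1 := (heq.tendsto_uniformFun_iff_pi U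
      (fun p : ↥(Icc 0 T ×ˢ Icc 0 L) => v p.1.1 p.1.2)).2 (by
        rw [tendsto_pi_nhds]
        intro p
        have h2 := hv p.1.1 p.1.2
        rwa [hqi _ p.2.2] at h2)
    rw [UniformFun.tendsto_iff_tendstoUniformly] at h1
    exact tendstoUniformlyOn_iff_restrict.2 h1
  · have h1 := (hv t x).abs
    exact le_of_tendsto h1 (.of_forall fun n => h.bound n t _ (hqm x))

lemma IsUniformLimit.unif_slice {L K B D : ℝ} {U : Ultrafilter ℕ} {u : ℕ → ℝ → ℝ → ℝ}
    {v : ℝ → ℝ → ℝ} (hv : IsUniformLimit L K B D U u v) {t : ℝ} (ht : 0 ≤ t) :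
    TendstoUniformlyOn (fun n => u n t) (v t) U (Ioo 0 L) := by
  have h1 := (hv.unif t).comp (fun x => (t, x))
  refine h1.mono fun x hx => ?_
  exact ⟨⟨ht, le_rfl⟩, Ioo_subset_Icc_self hx⟩

lemma IsUniformLimit.cont_slice {L K B D : ℝ} {U : Ultrafilter ℕ} {u : ℕ → ℝ → ℝ → ℝ}
    {v : ℝ → ℝ → ℝ} (hv : IsUniformLimit L K B D U u v) (t : ℝ) : Continuous (v t) :=
  hv.cont.comp (by fun_prop : Continuous fun x => (t, x))

lemma continuous_integrableOn_Ioo {L : ℝ} {h : ℝ → ℝ} (hh : Continuous h) :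
    IntegrableOn h (Ioo 0 L) :=
  hh.integrableOn_Icc.mono_set Ioo_subset_Icc_self

lemma continuous_memLp_volI {L : ℝ} {h : ℝ → ℝ} (hh : Continuous h) : MemLp h 2 (volI L) := by
  rw [memLp_two_iff_integrable_sq hh.aestronglyMeasurable]
  exact continuous_integrableOn_Ioo (hh.pow 2)

lemma IsUniformLimit.tendsto_integral {L K B D : ℝ} {U : Ultrafilter ℕ}
    {u u₁ : ℕ → ℝ → ℝ → ℝ} {v : ℝ → ℝ → ℝ} (hv : IsUniformLimit L K B D U u v)
    (h : IsBoundedSeq L K B D u u₁) {t : ℝ} (ht : 0 ≤ t) {φ : ℝ → ℝ} (hφ : Continuous φ) :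
    Tendsto (fun n => ∫ x in Ioo 0 L, u n t x * φ x) U (𝓝 (∫ x in Ioo 0 L, v t x * φ x)) := by
  refine tendsto_setIntegral_mul_of_tendstoUniformlyOn measurableSet_Ioo (hv.unif_slice ht)
    (fun n => ?_) ?_ (continuous_integrableOn_Ioo hφ)
  · have : Continuous (u n t) := (h.cont n).comp (by fun_prop : Continuous fun x => (t, x))
    exact continuous_integrableOn_Ioo (this.mul hφ)
  · exact continuous_integrableOn_Ioo ((hv.cont_slice t).mul hφ)

/-- The derivatives converge weakly, at each time, to the weak derivative of the limit. -/
lemma IsUniformLimit.exists_weakDeriv {L K B D : ℝ} (hL : 0 < L) {U : Ultrafilter ℕ}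
    {u u₁ : ℕ → ℝ → ℝ → ℝ} {v : ℝ → ℝ → ℝ} (hv : IsUniformLimit L K B D U u v)
    (h : IsBoundedSeq L K B D u u₁) :
    ∃ v₁ : ℝ → ℝ → ℝ, ∀ t, 0 ≤ t → MemLp (v₁ t) 2 (volI L) ∧ IsWeakDeriv L (v t) (v₁ t) ∧
      (∫ x in Ioo 0 L, v₁ t x ^ 2 ≤ K ^ 2) ∧
      (∀ k, ∫ x in Ioo 0 L, v₁ t x * sinMode L k x =
        -∫ x in Ioo 0 L, v t x * (freq L k * cosMode L k x)) ∧
      ∀ φ : ℝ → ℝ, MemLp φ 2 (volI L) → Tendsto (fun n => ∫ x in Ioo 0 L, u₁ n t x * φ x) U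
        (𝓝 (∫ x in Ioo 0 L, v₁ t x * φ x)) := by
  have hc : ∀ n t, Continuous (u n t) := fun n t =>
    (h.cont n).comp (by fun_prop : Continuous fun x => (t, x))
  have hc₁ : ∀ n t, Continuous (u₁ n t) := fun n t =>
    (h.cont₁ n).comp (by fun_prop : Continuous fun x => (t, x))
  have hm : ∀ n t, MemLp (u₁ n t) 2 (volI L) := fun n t => continuous_memLp_volI (hc₁ n t)
  have hb : ∀ n t, ∫ x in Ioo 0 L, u₁ n t x ^ 2 ≤ K ^ 2 := fun n t => by
    rw [setIntegral_Ioo_eq hL.le (fun x => u₁ n t x ^ 2)]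
    exact h.bound₁ n t
  choose v₁ hv₁m hv₁ using fun t =>
    exists_weak_limit U (fun n => u₁ n t) (fun n => hm n t) (fun n => hb n t)
  have hparts : ∀ n t, ∀ φ φ' : ℝ → ℝ, (∀ x, HasDerivAt φ (φ' x) x) → Continuous φ' →
      φ 0 = 0 → φ L = 0 →
      ∫ x in Ioo 0 L, u₁ n t x * φ x = -∫ x in Ioo 0 L, u n t x * φ' x := by
    intro n t φ φ' hφ hφ' h0 h1
    rw [setIntegral_Ioo_eq hL.le (fun x => u₁ n t x * φ x),
      setIntegral_Ioo_eq hL.le (fun x => u n t x * φ' x),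
      intervalIntegral.integral_mul_deriv_eq_deriv_mul (fun x _ => h.deriv n t x)
        (fun x _ => hφ x) ((hc₁ n t).intervalIntegrable _ _) (hφ'.intervalIntegrable _ _), h0, h1]
    simp
  -- Compactly supported test functions and the sine modes both vanish at the endpoints, so one
  -- integration by parts serves the weak derivative and the sine coefficients.
  have hlim : ∀ t, 0 ≤ t → ∀ φ φ' : ℝ → ℝ, (∀ x, HasDerivAt φ (φ' x) x) → Continuous φ' →
      φ 0 = 0 → φ L = 0 →
      ∫ x in Ioo 0 L, v₁ t x * φ x = -∫ x in Ioo 0 L, v t x * φ' x := by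
    intro t ht φ φ' hφ hφ' h0 h1
    have hφc : Continuous φ := continuous_iff_continuousAt.2 fun x => (hφ x).continuousAt
    have e1 := hv₁ t φ (continuous_memLp_volI hφc)
    simp_rw [hparts _ t φ φ' hφ hφ' h0 h1] at e1
    exact tendsto_nhds_unique e1 (hv.tendsto_integral h ht hφ').neg
  refine ⟨v₁, fun t ht => ⟨hv₁m t, ?_, ?_, fun k => ?_, hv₁ t⟩⟩
  · intro φ hφ _ hs
    have h0 : ∀ x, x ∉ Ioo 0 L → φ x = 0 := fun x hx =>
      image_eq_zero_of_notMem_tsupport fun hx' => hx (hs hx')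
    rw [hlim t ht φ (deriv φ) (fun x => (hφ.differentiable (by simp) x).hasDerivAt)
      (hφ.continuous_deriv (by simp)) (h0 0 (by simp)) (h0 L (by simp)), neg_neg]
  · exact integral_sq_le_of_weak (fun n => hm n t) (hv₁m t) (hv₁ t _ (hv₁m t))
      (.of_forall fun n => hb n t)
  · exact hlim t ht (sinMode L k) _ (hasDerivAt_sinMode L k) (by fun_prop) (sinMode_left L k)
      (sinMode_right hL k)

/-! ### Regularity of the limit -/

lemma inner_toLp_eq {α : Type*} [MeasurableSpace α] {ν : Measure α} {u v : α → ℝ}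
    (hu : MemLp u 2 ν) (hv : MemLp v 2 ν) :
    inner ℝ (hu.toLp u) (hv.toLp v) = ∫ a, v a * u a ∂ν := by
  rw [L2.inner_def]
  refine integral_congr_ae ?_
  filter_upwards [hu.coeFn_toLp, hv.coeFn_toLp] with a h1 h2
  rw [h1, h2]
  simp

/-- The normalized sines form a Hilbert basis of `L₂(0, L)`. -/
lemma exists_sin_hilbertBasis {L : ℝ} (hL : 0 < L) :
    ∃ b : HilbertBasis ℕ ℝ (Lp ℝ 2 (volI L)), ∀ k,
      ∃ h : MemLp (fun x => Real.sqrt (2 / L) * sinMode L (k + 1) x) 2 (volI L),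
        b k = h.toLp _ := by
  have hm : ∀ k, MemLp (fun x => Real.sqrt (2 / L) * sinMode L (k + 1) x) 2 (volI L) := fun k =>
    continuous_memLp_volI (by fun_prop)
  let e : ℕ → Lp ℝ 2 (volI L) := fun k => (hm k).toLp _
  have hs : Real.sqrt (2 / L) * Real.sqrt (2 / L) = 2 / L := Real.mul_self_sqrt (by positivity)
  have hon : Orthonormal ℝ e := by
    rw [orthonormal_iff_ite]
    intro i j
    rw [inner_toLp_eq]
    have e1 : ∀ x, Real.sqrt (2 / L) * sinMode L (j + 1) x *
        (Real.sqrt (2 / L) * sinMode L (i + 1) x) =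
          2 / L * (sinMode L (i + 1) x * sinMode L (j + 1) x) := fun x => by
      linear_combination (sinMode L (i + 1) x * sinMode L (j + 1) x) * hs
    simp_rw [e1]
    rw [integral_const_mul, setIntegral_Ioo_eq hL.le
      (fun x => sinMode L (i + 1) x * sinMode L (j + 1) x), integral_sinMode_mul_sinMode hL]
    by_cases hij : i = j
    · rw [if_pos (by rw [hij]), if_neg (Nat.succ_ne_zero j), if_pos hij]
      field_simp
    · simp [hij]
  have hbot : (Submodule.span ℝ (Set.range e))ᗮ = ⊥ := by
    rw [Submodule.eq_bot_iff]
    intro w hw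
    rw [Submodule.mem_orthogonal] at hw
    have hz : (w : ℝ → ℝ) =ᵐ[volI L] 0 := by
      refine ae_eq_zero_of_integral_sinMode hL (integrableOn_of_memLp (Lp.memLp w)) fun k => ?_
      rcases k with _ | k
      · simp [sinMode_zero]
      · have h1 := hw (e k) (Submodule.subset_span ⟨k, rfl⟩)
        have h2 := inner_toLp_eq (hm k) (Lp.memLp w)
        rw [Lp.toLp_coeFn] at h2
        rw [h2] at h1
        have e1 : ∀ x, w x * (Real.sqrt (2 / L) * sinMode L (k + 1) x) =
            Real.sqrt (2 / L) * (w x * sinMode L (k + 1) x) := fun x => by ring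
        simp_rw [e1] at h1
        rw [integral_const_mul] at h1
        have h3 : Real.sqrt (2 / L) ≠ 0 := (Real.sqrt_pos.2 (by positivity)).ne'
        exact (mul_eq_zero.1 h1).resolve_left h3
    exact (Lp.eq_zero_iff_ae_eq_zero).2 hz
  refine ⟨HilbertBasis.mkOfOrthogonalEqBot hon hbot, fun k => ⟨hm k, ?_⟩⟩
  rw [HilbertBasis.coe_mkOfOrthogonalEqBot]

/-- The map `W` is the pointwise limit of the partial sums of its sine expansion, so continuity in
time of the scalar coefficients is enough. -/
lemma aestronglyMeasurable_of_integral_sinMode {L T : ℝ} (hL : 0 < L) {V : ℝ → ℝ → ℝ}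
    {W : ℝ → Lp ℝ 2 (volI L)} (hV : ∀ t ∈ Ioo 0 T, V t =ᵐ[volI L] W t)
    (h : ∀ k, ContinuousOn (fun t => ∫ x in Ioo 0 L, V t x * sinMode L k x) (Ioo 0 T)) :
    AEStronglyMeasurable W (volume.restrict (Ioo 0 T)) := by
  obtain ⟨b, hb⟩ := exists_sin_hilbertBasis hL
  have hrepr : ∀ k, ∀ t ∈ Ioo 0 T, inner ℝ (b k) (W t) =
      Real.sqrt (2 / L) * ∫ x in Ioo 0 L, V t x * sinMode L (k + 1) x := by
    intro k t ht
    obtain ⟨hm, hbk⟩ := hb k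
    have h2 := inner_toLp_eq hm (Lp.memLp (W t))
    rw [Lp.toLp_coeFn] at h2
    rw [hbk, h2, ← integral_const_mul]
    refine integral_congr_ae ?_
    filter_upwards [hV t ht] with x hx
    rw [hx]
    ring
  refine aestronglyMeasurable_of_tendsto_ae atTop
    (f := fun N t => ∑ k ∈ Finset.range N, (inner ℝ (b k) (W t) : ℝ) • b k) (fun N => ?_) ?_
  · refine Finset.aestronglyMeasurable_fun_sum _ fun k _ => ?_
    refine AEStronglyMeasurable.smul_const ?_ _
    refine ContinuousOn.aestronglyMeasurable ?_ measurableSet_Ioo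
    exact ((h (k + 1)).const_mul (Real.sqrt (2 / L))).congr fun t ht => hrepr k t ht
  · refine .of_forall fun t => ?_
    have := (b.hasSum_repr (W t)).tendsto_sum_nat
    simpa only [HilbertBasis.repr_apply_apply] using this

/-- The weak derivative is chosen separately at each time, so its measurability in time is not
automatic. Its sine coefficients, however, are cosine integrals of `v` up to a factor, and these are
continuous in time. -/
lemma IsUniformLimit.memLinftyH1 {L K B D : ℝ} (hL : 0 < L) {U : Ultrafilter ℕ}
    {u u₁ : ℕ → ℝ → ℝ → ℝ} {v : ℝ → ℝ → ℝ} (hv : IsUniformLimit L K B D U u v)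
    (h : IsBoundedSeq L K B D u u₁) (T : ℝ) : MemLinftyH1 L T v := by
  obtain ⟨v₁, hv₁⟩ := hv.exists_weakDeriv hL h
  have hvm : ∀ t, MemLp (v t) 2 (volI L) := fun t => continuous_memLp_volI (hv.cont_slice t)
  have hcont : ∀ φ : ℝ → ℝ, Continuous φ → Continuous fun t => ∫ x in Ioo 0 L, v t x * φ x := by
    intro φ hφ
    simp_rw [fun t => setIntegral_Ioo_eq hL.le (fun x => v t x * φ x)]
    have hvc := hv.cont
    exact intervalIntegral.continuous_parametric_intervalIntegral_of_continuous'
      (f := fun t x => v t x * φ x) (by simp only [Function.uncurry_def]; fun_prop) 0 L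
  have hnorm : ∀ {w : ℝ → ℝ} (hw : MemLp w 2 (volI L)) {C : ℝ},
      ∫ x in Ioo 0 L, w x ^ 2 ≤ C → ‖hw.toLp w‖ ≤ Real.sqrt C := fun {w} hw {C} hC => by
    refine Real.le_sqrt_of_sq_le ?_
    rw [← real_inner_self_eq_norm_sq, inner_toLp_eq]
    simpa [sq] using hC
  classical
  let W : ℝ → Lp ℝ 2 (volI L) := fun t => if ht : 0 ≤ t then (hv₁ t ht).1.toLp (v₁ t) else 0
  have hW : ∀ t (ht : 0 ≤ t), W t = (hv₁ t ht).1.toLp (v₁ t) := fun t ht => dif_pos ht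
  refine ⟨fun t => (hvm t).toLp (v t), W, ?_, ?_, ?_⟩
  · refine memLp_top_of_bound (aestronglyMeasurable_of_integral_sinMode hL (V := v)
      (fun t _ => (hvm t).coeFn_toLp.symm) fun k => (hcont _ (by fun_prop)).continuousOn)
      (Real.sqrt (B ^ 2 * L)) (.of_forall fun t => hnorm (hvm t) ?_)
    have h1 : ∫ x in Ioo 0 L, v t x ^ 2 ≤ ∫ x in Ioo 0 L, B ^ 2 := by
      refine setIntegral_mono_on (hvm t).integrable_sq (integrableOn_const (by simp))
        measurableSet_Ioo fun x hx => ?_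
      rw [← sq_abs]
      exact pow_le_pow_left₀ (abs_nonneg _) (hv.bound t x (Ioo_subset_Icc_self hx)) 2
    refine h1.trans (le_of_eq ?_)
    rw [setIntegral_const]
    simp [hL.le, mul_comm]
  · refine memLp_top_of_bound (aestronglyMeasurable_of_integral_sinMode hL (V := v₁)
      (fun t ht => ?_) fun k => ?_) (Real.sqrt (K ^ 2)) ?_
    · rw [hW t ht.1.le]
      exact (hv₁ t ht.1.le).1.coeFn_toLp.symm
    · refine ((hcont (fun x => freq L k * cosMode L k x) (by fun_prop)).neg.continuousOn).congr
        fun t ht => ?_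
      exact (hv₁ t ht.1.le).2.2.2.1 k
    · refine (ae_restrict_iff' measurableSet_Ioo).2 (.of_forall fun t ht => ?_)
      rw [hW t ht.1.le]
      exact hnorm _ (hv₁ t ht.1.le).2.2.1
  · refine (ae_restrict_iff' measurableSet_Ioo).2 (.of_forall fun t ht => ?_)
    refine ⟨(hvm t).coeFn_toLp.symm, ?_⟩
    rw [hW t ht.1.le]
    intro φ hφ hφc hs
    rw [(hv₁ t ht.1.le).2.1 φ hφ hφc hs, neg_inj]
    refine integral_congr_ae ?_
    filter_upwards [(hv₁ t ht.1.le).1.coeFn_toLp] with x hx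
    rw [hx]

/-- Interpolation between the supremum norm and the Hölder seminorm of order `1/2`. -/
lemma holderENorm_le {L K ε : ℝ} (hK : 0 ≤ K) {α : ℝ≥0} (hα : α < 1 / 2) {w : ℝ → ℝ}
    (hw : ∀ x ∈ Icc 0 L, |w x| ≤ ε)
    (hwK : ∀ x ∈ Icc 0 L, ∀ y ∈ Icc 0 L, |w x - w y| ≤ K * Real.sqrt |x - y|) :
    holderENorm L α w ≤
      ENNReal.ofReal ε + ENNReal.ofReal (K ^ (2 * (α : ℝ)) * (2 * ε) ^ (1 - 2 * (α : ℝ))) := by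
  have hα' : (α : ℝ) < 1 / 2 := by
    have := NNReal.coe_lt_coe.2 hα
    simpa using this
  have hα0 : 0 ≤ (α : ℝ) := α.2
  refine add_le_add (iSup_le fun x => ?_) ?_
  · rw [Real.enorm_eq_ofReal_abs]
    exact ENNReal.ofReal_le_ofReal (hw x x.2)
  · refine HolderWith.eHolderNorm_le (C := Real.toNNReal _) fun x y => ?_
    have hε : 0 ≤ ε := (abs_nonneg _).trans (hw x x.2)
    rw [edist_dist, edist_dist, Real.dist_eq, ENNReal.ofReal_rpow_of_nonneg dist_nonneg hα0]
    change _ ≤ ENNReal.ofReal _ * _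
    rw [← ENNReal.ofReal_mul (by positivity)]
    refine ENNReal.ofReal_le_ofReal ?_
    set Δ := |w x - w y| with hΔ
    have hΔ0 : 0 ≤ Δ := abs_nonneg _
    have h1 : Δ ≤ K * Real.sqrt (dist x y) := hwK x x.2 y y.2
    have h2 : Δ ≤ 2 * ε := by
      have := abs_sub (w x) (w y)
      linarith [hw x x.2, hw y y.2]
    rcases hΔ0.eq_or_lt with h0 | h0
    · rw [← h0]
      positivity
    -- The first factor is estimated by the Hölder bound of order 1/2, which produces distance to
    -- the power α, and the second by the supremum.
    · calc Δ = Δ ^ (2 * (α : ℝ)) * Δ ^ (1 - 2 * (α : ℝ)) := by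
            rw [← Real.rpow_add h0]
            simp
        _ ≤ (K * Real.sqrt (dist x y)) ^ (2 * (α : ℝ)) * (2 * ε) ^ (1 - 2 * (α : ℝ)) := by
            have h3 : 0 ≤ 1 - 2 * (α : ℝ) := by linarith
            gcongr
        _ = _ := by
            rw [Real.mul_rpow hK (Real.sqrt_nonneg _), Real.rpow_mul (Real.sqrt_nonneg _),
              Real.rpow_two, Real.sq_sqrt dist_nonneg]
            ring

/-- The difference of two time slices has Hölder constant at most `2 * K` of order 1/2 and a
supremum that tends to zero. Interpolation leaves the supremum with the exponent 1 - 2α, which is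
positive exactly because α < 1/2. -/
lemma IsUniformLimit.memCHolder {L K B D : ℝ} (hK : 0 ≤ K) {U : Ultrafilter ℕ}
    {u : ℕ → ℝ → ℝ → ℝ} {v : ℝ → ℝ → ℝ} (hv : IsUniformLimit L K B D U u v) (T : ℝ) {α : ℝ≥0}
    (hα : α < 1 / 2) : MemCHolder L T α v := by
  refine ⟨fun t _ => ⟨(hv.cont_slice t).continuousOn,
    (holderENorm_le hK hα (hv.bound t) (hv.space t)).trans_lt (by simp)⟩, fun s _ => ?_⟩
  have hα' : 0 < 1 - 2 * (α : ℝ) := by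
    have h1 := NNReal.coe_lt_coe.2 hα
    have h2 : ((1 / 2 : ℝ≥0) : ℝ) = 1 / 2 := by simp
    rw [h2] at h1
    linarith
  have hle : ∀ t, holderENorm L α (fun x => v t x - v s x) ≤
      ENNReal.ofReal (modulus L D |t - s|) + ENNReal.ofReal
        ((2 * K) ^ (2 * (α : ℝ)) * (2 * modulus L D |t - s|) ^ (1 - 2 * (α : ℝ))) := fun t => by
    refine holderENorm_le (by positivity) hα (hv.time t s) fun x hx y hy => ?_
    have h1 := hv.space t x hx y hy
    have h2 := hv.space s x hx y hy
    have h3 := abs_sub (v t x - v t y) (v s x - v s y)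
    rw [show v t x - v s x - (v t y - v s y) = v t x - v t y - (v s x - v s y) by ring]
    linarith
  have hlim : Tendsto (fun t => ENNReal.ofReal (modulus L D |t - s|) + ENNReal.ofReal
      ((2 * K) ^ (2 * (α : ℝ)) * (2 * modulus L D |t - s|) ^ (1 - 2 * (α : ℝ)))) (𝓝 s) (𝓝 0) := by
    have h1 : Continuous fun t => modulus L D |t - s| := by fun_prop
    have h2 : Continuous fun t => (2 * K) ^ (2 * (α : ℝ)) *
        (2 * modulus L D |t - s|) ^ (1 - 2 * (α : ℝ)) :=
      continuous_const.mul ((continuous_const.mul h1).rpow_const fun _ => Or.inr hα'.le)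
    have h3 := ((ENNReal.continuous_ofReal.comp h1).add
      (ENNReal.continuous_ofReal.comp h2)).tendsto s
    simp only [Function.comp_apply, Pi.add_apply, sub_self, abs_zero, modulus_zero, mul_zero,
      Real.zero_rpow hα'.ne', ENNReal.ofReal_zero, add_zero] at h3
    exact h3
  exact tendsto_of_tendsto_of_tendsto_of_le_of_le tendsto_const_nhds
    (hlim.mono_left nhdsWithin_le_nhds) (fun _ => zero_le) hle

/-! ### The weak formulation -/

/-- The part of the cylinder between the times `s` and `t`. -/
def slab (L s t : ℝ) : Set (ℝ × ℝ) := Ioc s t ×ˢ Ioo 0 L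

lemma measurableSet_slab (L s t : ℝ) : MeasurableSet (slab L s t) :=
  measurableSet_Ioc.prod measurableSet_Ioo

lemma restrict_slab (L s t : ℝ) : (volume : Measure (ℝ × ℝ)).restrict (slab L s t) =
    (volume.restrict (Ioc s t)).prod (volI L) := by
  rw [slab, Measure.volume_eq_prod, Measure.prod_restrict]

lemma restrict_cyl (L T : ℝ) : (volume : Measure (ℝ × ℝ)).restrict (cyl L T) =
    (volume : Measure (ℝ × ℝ)).restrict (slab L 0 T) := by
  rw [restrict_slab, cyl, Measure.volume_eq_prod, ← Measure.prod_restrict,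
    restrict_Ioo_eq_restrict_Ioc]

lemma integrableOn_slab_of_cyl {L T : ℝ} {F : ℝ × ℝ → ℝ} (h : IntegrableOn F (cyl L T)) {s t : ℝ}
    (hs : 0 ≤ s) (ht : t ≤ T) : IntegrableOn F (slab L s t) := by
  have h1 : IntegrableOn F (slab L 0 T) := by
    rw [IntegrableOn, ← restrict_cyl]
    exact h
  exact h1.mono_set (prod_mono (Ioc_subset_Ioc hs ht) le_rfl)

lemma integral_slab_add {L s t : ℝ} (hs : 0 ≤ s) (hst : s ≤ t) {F : ℝ × ℝ → ℝ}
    (hF : IntegrableOn F (slab L 0 t)) :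
    ∫ p in slab L 0 t, F p = (∫ p in slab L 0 s, F p) + ∫ p in slab L s t, F p := by
  have hU : slab L 0 t = slab L 0 s ∪ slab L s t := by
    simp only [slab]
    rw [← union_prod, Ioc_union_Ioc_eq_Ioc hs hst]
  have hd : Disjoint (slab L 0 s) (slab L s t) := by
    rw [slab, slab, Set.disjoint_prod]
    exact Or.inl (Ioc_disjoint_Ioc_of_le le_rfl)
  rw [hU] at hF ⊢
  exact setIntegral_union hd (measurableSet_slab L s t) hF.left_of_union hF.right_of_union

/-- The mode equations of a continuity equation `∂ₜv = -∂ₓH` with no-flux boundary conditions. -/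
structure IsModeSolution (L : ℝ) (v H : ℝ → ℝ → ℝ) : Prop where
  cont : Continuous fun p : ℝ × ℝ => v p.1 p.2
  int : ∀ T, IntegrableOn (fun p : ℝ × ℝ => H p.1 p.2) (cyl L T)
  eq : ∀ t, 0 ≤ t → ∀ k, ∫ x in (0)..L, (v t x - v 0 x) * cosMode L k x =
    ∫ p in cyl L t, H p.1 p.2 * -(freq L k * sinMode L k p.2)

lemma integrableOn_cyl_mul {L T : ℝ} {H : ℝ × ℝ → ℝ} (hH : IntegrableOn H (cyl L T))
    {ψ : ℝ → ℝ} (hψ : ContinuousOn ψ (Icc 0 L)) :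
    IntegrableOn (fun p : ℝ × ℝ => H p * ψ p.2) (cyl L T) := by
  refine hH.mul_continuousOn_of_subset (K := Icc 0 T ×ˢ Icc 0 L)
    (hψ.comp continuousOn_snd fun p hp => hp.2)
    (measurableSet_Ioo.prod measurableSet_Ioo) (isCompact_Icc.prod isCompact_Icc)
    (prod_mono Ioo_subset_Icc_self Ioo_subset_Icc_self)

/-- The mode equations imply the equation tested with functions of `x`. -/
lemma IsModeSolution.test {L : ℝ} (hL : 0 < L) {v H : ℝ → ℝ → ℝ} (h : IsModeSolution L v H)
    {φ φ' : ℝ → ℝ} (hφ : ∀ x ∈ Icc 0 L, HasDerivWithinAt φ (φ' x) (Icc 0 L) x)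
    (hφ' : ContinuousOn φ' (Icc 0 L)) {t : ℝ} (ht : 0 ≤ t) :
    ∫ x in (0)..L, (v t x - v 0 x) * φ x = ∫ p in cyl L t, H p.1 p.2 * φ' p.2 := by
  have hvc := h.cont
  let F : ℝ → ℝ := fun x => v t x - v 0 x
  have hF : Continuous F := by fun_prop
  -- The primitive of the increment of `v`. It vanishes at `L` by the equation for mode 0, so
  -- integrations by parts against it have no boundary terms.
  let G : ℝ → ℝ := fun x => ∫ y in (0)..x, F y
  have hGd : ∀ x, HasDerivAt G (F x) x := fun x =>
    intervalIntegral.integral_hasDerivAt_right (hF.intervalIntegrable _ _)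
      hF.stronglyMeasurable.stronglyMeasurableAtFilter hF.continuousAt
  have hGc : Continuous G := continuous_iff_continuousAt.2 fun x => (hGd x).continuousAt
  have hG0 : G 0 = 0 := intervalIntegral.integral_same
  have hGL : G L = 0 := by
    have := h.eq t ht 0
    simpa [cosMode_zero, freq_zero] using this
  have hparts : ∀ φ φ' : ℝ → ℝ, (∀ x ∈ Icc 0 L, HasDerivWithinAt φ (φ' x) (Icc 0 L) x) →
      ContinuousOn φ' (Icc 0 L) →
      ∫ x in (0)..L, F x * φ x = -∫ x in (0)..L, G x * φ' x := by
    intro φ φ' hφ hφ'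
    rw [← uIcc_of_le hL.le] at hφ hφ'
    rw [intervalIntegral.integral_mul_deriv_eq_deriv_mul_of_hasDerivWithinAt
      (fun x _ => (hGd x).hasDerivWithinAt) hφ (hF.intervalIntegrable _ _)
      hφ'.intervalIntegrable, hG0, hGL]
    simp
  let η : ℝ → ℝ := fun x => ∫ τ in Ioo 0 t, H τ x
  have hrestr : (volume : Measure (ℝ × ℝ)).restrict (cyl L t) =
      (volume.restrict (Ioo 0 t)).prod (volI L) := by
    rw [cyl, Measure.volume_eq_prod, Measure.prod_restrict]
  have hηi : IntegrableOn η (Ioo 0 L) := by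
    have h1 := h.int t
    rw [IntegrableOn, hrestr] at h1
    exact h1.integral_prod_right
  have hfub : ∀ ψ : ℝ → ℝ, ContinuousOn ψ (Icc 0 L) →
      ∫ p in cyl L t, H p.1 p.2 * ψ p.2 = ∫ x in Ioo 0 L, η x * ψ x := by
    intro ψ hψ
    have h1 := integrableOn_cyl_mul (h.int t) hψ
    rw [IntegrableOn, hrestr] at h1
    rw [hrestr, integral_prod_symm _ h1]
    refine integral_congr_ae (.of_forall fun x => ?_)
    simp only [η, integral_mul_const]
  have hGi : IntegrableOn G (Ioo 0 L) := continuous_integrableOn_Ioo hGc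
  -- The remaining mode equations say that the time-integrated flux `η` plus `G` is orthogonal to
  -- all sines. By completeness `η = -G` almost everywhere, which is the conservation law integrated
  -- in time and space.
  have hzero : (fun x => η x + G x) =ᵐ[volI L] 0 := by
    refine ae_eq_zero_of_integral_sinMode hL (hηi.add hGi) fun k => ?_
    rcases Nat.eq_zero_or_pos k with rfl | hk
    · simp [sinMode_zero]
    have h1 := h.eq t ht k
    rw [hparts (cosMode L k) (fun x => -(freq L k * sinMode L k x))
      (fun x _ => (hasDerivAt_cosMode L k x).hasDerivWithinAt) (by fun_prop),
      hfub (fun x => -(freq L k * sinMode L k x)) (by fun_prop),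
      ← setIntegral_Ioo_eq hL.le (fun x => G x * -(freq L k * sinMode L k x))] at h1
    have e1 : ∀ w : ℝ → ℝ, ∫ x in Ioo 0 L, w x * -(freq L k * sinMode L k x) =
        -freq L k * ∫ x in Ioo 0 L, w x * sinMode L k x := fun w => by
      rw [← integral_const_mul]
      refine integral_congr_ae (.of_forall fun x => ?_)
      simp only
      ring
    rw [e1, e1] at h1
    simp_rw [add_mul]
    rw [integral_add (integrableOn_mul_of_continuousOn hηi (by fun_prop))
      (integrableOn_mul_of_continuousOn hGi (by fun_prop))]
    have h2 := (freq_pos hL hk.ne').ne'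
    have h3 : freq L k * ((∫ x in Ioo 0 L, η x * sinMode L k x)
        + ∫ x in Ioo 0 L, G x * sinMode L k x) = 0 := by linarith
    exact (mul_eq_zero.1 h3).resolve_left h2
  change ∫ x in (0)..L, F x * φ x = _
  rw [hparts φ φ' hφ hφ', hfub φ' hφ', ← setIntegral_Ioo_eq hL.le (fun x => G x * φ' x),
    ← integral_neg]
  refine integral_congr_ae ?_
  filter_upwards [hzero] with x hx
  have : η x = -G x := by
    simp only [Pi.zero_apply] at hx
    linarith
  rw [this]
  ring

lemma IsModeSolution.test_slab {L : ℝ} (hL : 0 < L) {v H : ℝ → ℝ → ℝ} (h : IsModeSolution L v H)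
    {φ φ' : ℝ → ℝ} (hφ : ∀ x ∈ Icc 0 L, HasDerivWithinAt φ (φ' x) (Icc 0 L) x)
    (hφ' : ContinuousOn φ' (Icc 0 L)) {s t : ℝ} (hs : 0 ≤ s) (hst : s ≤ t) :
    ∫ x in (0)..L, (v t x - v s x) * φ x = ∫ p in slab L s t, H p.1 p.2 * φ' p.2 := by
  have hvc := h.cont
  have h1 := h.test hL hφ hφ' (hs.trans hst)
  have h2 := h.test hL hφ hφ' hs
  rw [restrict_cyl] at h1 h2
  rw [integral_slab_add hs hst
    (integrableOn_slab_of_cyl (integrableOn_cyl_mul (h.int t) hφ') le_rfl le_rfl), ← h2] at h1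
  have hφc : ContinuousOn φ (uIcc 0 L) := by
    rw [uIcc_of_le hL.le]
    exact fun x hx => (hφ x hx).continuousWithinAt
  have hi : ∀ r, IntervalIntegrable (fun x => (v r x - v 0 x) * φ x) volume 0 L := fun r =>
    (((by fun_prop : Continuous fun x => v r x - v 0 x).continuousOn).mul hφc).intervalIntegrable
  rw [← sub_eq_iff_eq_add', ← intervalIntegral.integral_sub (hi t) (hi s)] at h1
  rw [← h1]
  refine intervalIntegral.integral_congr fun x _ => ?_
  ring

/-- If the flux vanishes where the solution is negative, then the solution remains nonnegative. -/
lemma IsModeSolution.nonneg {L : ℝ} (hL : 0 < L) {v H : ℝ → ℝ → ℝ} (h : IsModeSolution L v H)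
    (hH : ∀ t x, v t x < 0 → H t x = 0) (h0 : ∀ x ∈ Ioo 0 L, 0 ≤ v 0 x) {t x : ℝ} (ht : 0 ≤ t)
    (hx : x ∈ Ioo 0 L) : 0 ≤ v t x := by
  by_contra hneg
  rw [not_le] at hneg
  have hvc := h.cont
  -- Consider the first time `r` at which the negative value is attained at `x`. It is positive
  -- because the initial value is nonnegative.
  let A : Set ℝ := Icc 0 t ∩ {s | v s x = v t x}
  have hA : IsCompact A := isCompact_Icc.inter_right
    (isClosed_eq (by fun_prop) continuous_const)
  have hne : A.Nonempty := ⟨t, ⟨ht, le_rfl⟩, rfl⟩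
  have hmem : sInf A ∈ A := hA.sInf_mem hne
  set r := sInf A with hr
  have hvr : v r x < 0 := by
    rw [hmem.2]
    exact hneg
  rcases hmem.1.1.eq_or_lt with hr0 | hr0
  · rw [← hr0] at hvr
    exact absurd (h0 x hx) (not_le.2 hvr)
  have hopen : IsOpen {p : ℝ × ℝ | v p.1 p.2 < 0} := isOpen_lt hvc continuous_const
  obtain ⟨δ, hδ, hball⟩ := Metric.isOpen_iff.1 hopen (r, x) hvr
  have hbox : ∀ s y, |s - r| < δ → |y - x| < δ → v s y < 0 := fun s y hs hy => by
    refine hball (a := (s, y)) ?_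
    rw [Metric.mem_ball, Prod.dist_eq]
    exact max_lt (by rwa [Real.dist_eq]) (by rwa [Real.dist_eq])
  obtain ⟨s, hs0, hsr, hsδ⟩ : ∃ s, 0 ≤ s ∧ s < r ∧ r - s < δ :=
    ⟨max 0 (r - δ / 2), le_max_left _ _, max_lt hr0 (by linarith), by
      have := le_max_right 0 (r - δ / 2)
      linarith⟩
  let J : Set ℝ := Ioo 0 L ∩ Metric.ball x δ
  have hJo : IsOpen J := isOpen_Ioo.inter Metric.isOpen_ball
  have hJm : x ∈ J := ⟨hx, Metric.mem_ball_self hδ⟩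
  have hw : Continuous fun y => v r y - v s y := by fun_prop
  -- On a box around `(r, x)` the solution is negative, so the flux is zero there. Testing with
  -- functions supported near `x` gives `v r = v s` near `x` for an earlier `s`, contradicting the
  -- choice of `r`.
  have hz := IsOpen.ae_eq_zero_of_integral_contDiff_smul_eq_zero (μ := volume) hJo
    (hw.locallyIntegrable.locallyIntegrableOn J) (fun φ hφ _ hsupp => by
      have h1 := h.test_slab hL (φ := φ) (φ' := deriv φ)
        (fun y _ => (hφ.differentiable (by simp) y).hasDerivAt.hasDerivWithinAt)
        (hφ.continuous_deriv (by simp)).continuousOn hs0 hsr.le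
      have h2 : ∫ p in slab L s r, H p.1 p.2 * deriv φ p.2 = 0 := by
        refine setIntegral_eq_zero_of_forall_eq_zero fun p hp => ?_
        by_cases hy : p.2 ∈ tsupport φ
        · have h3 := (hsupp hy).2
          rw [Metric.mem_ball, Real.dist_eq] at h3
          have h4 : |p.1 - r| < δ := by
            rw [abs_sub_comm, abs_of_nonneg (by linarith [hp.1.2])]
            linarith [hp.1.1]
          rw [hH _ _ (hbox _ _ h4 h3), zero_mul]
        · rw [image_eq_zero_of_notMem_tsupport fun h' => hy (tsupport_deriv_subset h'), mul_zero]
      rw [h2, ← setIntegral_Ioo_eq hL.le (fun x => (v r x - v s x) * φ x),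
        setIntegral_eq_integral_of_forall_compl_eq_zero] at h1
      · rw [← h1]
        refine integral_congr_ae (.of_forall fun y => ?_)
        simp only [smul_eq_mul]
        ring
      · intro y hy
        rw [image_eq_zero_of_notMem_tsupport fun h' => hy (hsupp h').1, mul_zero])
  have hae : (fun y => v r y - v s y) =ᵐ[volume.restrict J] fun _ => 0 :=
    (ae_restrict_iff' hJo.measurableSet).2 hz
  have heq := Measure.eqOn_open_of_ae_eq hae hJo hw.continuousOn continuousOn_const hJm
  have hsA : s ∈ A := ⟨⟨hs0, hsr.le.trans hmem.1.2⟩, by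
    have : v s x = v r x := by
      simp only at heq
      linarith
    exact this.trans hmem.2⟩
  exact absurd (csInf_le hA.bddBelow hsA) (not_le.2 hsr)

/-- Cut `[0, T]` into equal steps shorter than δ and telescope both sides. This replaces
differentiation in time, for which `m` need not be regular enough. -/
lemma eq_of_forall_abs_sub_le {T : ℝ} (hT : 0 ≤ T) {m Θ : ℝ → ℝ}
    (h : ∀ ε > 0, ∃ δ > 0, ∀ s t, 0 ≤ s → s ≤ t → t ≤ T → t - s ≤ δ →
      |m t - m s| ≤ ε * (Θ t - Θ s)) : m T = m 0 := by
  have key : ∀ ε > 0, |m T - m 0| ≤ ε * (Θ T - Θ 0) := by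
    intro ε hε
    obtain ⟨δ, hδ, hd⟩ := h ε hε
    obtain ⟨N, hN⟩ := exists_nat_gt (T / δ)
    have hN0 : (0 : ℝ) < N := lt_of_le_of_lt (by positivity) hN
    let τ : ℕ → ℝ := fun i => i * (T / N)
    have hstep : ∀ i, τ (i + 1) - τ i = T / N := fun i => by
      simp only [τ]
      push_cast
      ring
    have hτN : τ N = T := by
      simp only [τ]
      field_simp
    have hτ0 : τ 0 = 0 := by simp [τ]
    have hmono : ∀ i j, i ≤ j → τ i ≤ τ j := fun i j hij => by
      simp only [τ]
      gcongr
    have h1 : m T - m 0 = ∑ i ∈ Finset.range N, (m (τ (i + 1)) - m (τ i)) := by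
      rw [Finset.sum_range_sub (fun i => m (τ i)), hτN, hτ0]
    have h2 : Θ T - Θ 0 = ∑ i ∈ Finset.range N, (Θ (τ (i + 1)) - Θ (τ i)) := by
      rw [Finset.sum_range_sub (fun i => Θ (τ i)), hτN, hτ0]
    rw [h1, h2, Finset.mul_sum]
    refine (Finset.abs_sum_le_sum_abs _ _).trans (Finset.sum_le_sum fun i hi => ?_)
    refine hd _ _ ?_ (hmono _ _ (Nat.le_succ i)) ?_ ?_
    · rw [← hτ0]
      exact hmono _ _ (Nat.zero_le i)
    · rw [← hτN]
      exact hmono _ _ (Finset.mem_range.1 hi)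
    · rw [hstep, div_le_iff₀ hN0]
      rw [div_lt_iff₀ hδ] at hN
      linarith
  have hlim : Tendsto (fun ε => ε * (Θ T - Θ 0)) (𝓝[>] 0) (𝓝 0) := by
    have : Continuous fun ε => ε * (Θ T - Θ 0) := by fun_prop
    have h1 := this.tendsto 0
    rw [zero_mul] at h1
    exact h1.mono_left nhdsWithin_le_nhds
  have h0 : |m T - m 0| ≤ 0 :=
    ge_of_tendsto hlim (eventually_nhdsWithin_of_forall fun ε hε => key ε hε)
  exact sub_eq_zero.1 (abs_eq_zero.1 (le_antisymm h0 (abs_nonneg _)))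

/-- The equation tested with functions of `(t, x)`. -/
lemma IsModeSolution.test_cyl {L T : ℝ} (hL : 0 < L) (hT : 0 ≤ T) {v H : ℝ → ℝ → ℝ}
    (h : IsModeSolution L v H) {ξ ξt ξx : ℝ × ℝ → ℝ}
    (hξ : ContinuousOn ξ (Icc 0 T ×ˢ Icc 0 L)) (hξt : ContinuousOn ξt (Icc 0 T ×ˢ Icc 0 L))
    (hξx : ContinuousOn ξx (Icc 0 T ×ˢ Icc 0 L))
    (hdt : ∀ t ∈ Icc 0 T, ∀ x ∈ Icc 0 L,
      HasDerivWithinAt (fun s => ξ (s, x)) (ξt (t, x)) (Icc 0 T) t)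
    (hdx : ∀ t ∈ Icc 0 T, ∀ x ∈ Icc 0 L,
      HasDerivWithinAt (fun y => ξ (t, y)) (ξx (t, x)) (Icc 0 L) x) :
    (∫ p in cyl L T, v p.1 p.2 * ξt p) + (∫ p in cyl L T, H p.1 p.2 * ξx p)
      = (∫ x in Ioo 0 L, v T x * ξ (T, x)) - ∫ x in Ioo 0 L, v 0 x * ξ (0, x) := by
  have hvc := h.cont
  have hKc : IsCompact (Icc 0 T ×ˢ Icc 0 L) := isCompact_Icc.prod isCompact_Icc
  have hsub : ∀ {s t}, 0 ≤ s → t ≤ T → slab L s t ⊆ Icc 0 T ×ˢ Icc 0 L := fun hs ht p hp =>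
    ⟨⟨hs.trans hp.1.1.le, hp.1.2.trans ht⟩, Ioo_subset_Icc_self hp.2⟩
  have hci : ∀ {F : ℝ × ℝ → ℝ}, ContinuousOn F (Icc 0 T ×ˢ Icc 0 L) →
      ∀ {s t}, 0 ≤ s → t ≤ T → IntegrableOn F (slab L s t) := fun hF _ _ hs ht =>
    (hF.integrableOn_compact hKc).mono_set (hsub hs ht)
  have hHi : ∀ {F : ℝ × ℝ → ℝ}, ContinuousOn F (Icc 0 T ×ˢ Icc 0 L) →
      ∀ {s t}, 0 ≤ s → t ≤ T → IntegrableOn (fun p => H p.1 p.2 * F p) (slab L s t) :=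
    fun hF _ _ hs ht => (integrableOn_slab_of_cyl (h.int T) hs ht).mul_continuousOn_of_subset hF
      (measurableSet_slab _ _ _) hKc (hsub hs ht)
  have hslice : ∀ {F : ℝ × ℝ → ℝ}, ContinuousOn F (Icc 0 T ×ˢ Icc 0 L) → ∀ {t}, t ∈ Icc 0 T →
      ContinuousOn (fun p : ℝ × ℝ => F (t, p.2)) (Icc 0 T ×ˢ Icc 0 L) := fun hF _ ht =>
    hF.comp (f := fun p : ℝ × ℝ => (_, p.2)) (by fun_prop) fun p hp => ⟨ht, hp.2⟩
  have hslice₁ : ∀ {F : ℝ × ℝ → ℝ}, ContinuousOn F (Icc 0 T ×ˢ Icc 0 L) → ∀ {t}, t ∈ Icc 0 T →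
      ContinuousOn (fun x : ℝ => F (t, x)) (Icc 0 L) := fun hF _ ht =>
    hF.comp (f := fun x : ℝ => (_, x)) (by fun_prop) fun p hp => ⟨ht, hp⟩
  have hspace : ∀ {F : ℝ → ℝ}, ContinuousOn F (Icc 0 L) → IntegrableOn F (Ioo 0 L) := fun hF =>
    (hF.integrableOn_compact isCompact_Icc).mono_set Ioo_subset_Icc_self
  obtain ⟨C, hC⟩ := hKc.exists_bound_of_continuousOn hξt
  have hvξ : ContinuousOn (fun p : ℝ × ℝ => v p.1 p.2 * ξt p) (Icc 0 T ×ˢ Icc 0 L) :=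
    hvc.continuousOn.mul hξt
  -- The weak formulation on `[0, t]` amounts to `m t = m 0`. Only time-independent test functions
  -- are available so far, so on a short slab the test function is frozen at the final time and `v`
  -- at the initial time; `hincr` is the resulting error.
  let m : ℝ → ℝ := fun t => (∫ x in Ioo 0 L, v t x * ξ (t, x))
    - ∫ p in slab L 0 t, (H p.1 p.2 * ξx p + v p.1 p.2 * ξt p)
  let Θ : ℝ → ℝ := fun t => ∫ p in slab L 0 t, (|H p.1 p.2| + C)
  have hincr : ∀ s t, 0 ≤ s → s ≤ t → t ≤ T → m t - m s =
      ∫ p in slab L s t, (H p.1 p.2 * (ξx (t, p.2) - ξx p) + (v s p.2 - v p.1 p.2) * ξt p) := by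
    intro s t hs hst htT
    have hsT : s ∈ Icc 0 T := ⟨hs, hst.trans htT⟩
    have ht : t ∈ Icc 0 T := ⟨hs.trans hst, htT⟩
    have e1 := integral_slab_add hs hst (F := fun p => H p.1 p.2 * ξx p + v p.1 p.2 * ξt p)
      ((hHi hξx le_rfl htT).add (hci hvξ le_rfl htT))
    have e2 : ∫ x in Ioo 0 L, (v t x - v s x) * ξ (t, x) =
        ∫ p in slab L s t, H p.1 p.2 * ξx (t, p.2) := by
      rw [setIntegral_Ioo_eq hL.le (fun x => (v t x - v s x) * ξ (t, x))]
      exact h.test_slab hL (hdx t ht) (hslice₁ hξx ht) hs hst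
    have hvsc : ContinuousOn (fun p : ℝ × ℝ => v s p.2 * ξt p) (Icc 0 T ×ˢ Icc 0 L) :=
      (by fun_prop : Continuous fun p : ℝ × ℝ => v s p.2).continuousOn.mul hξt
    have e3 : ∫ x in Ioo 0 L, v s x * (ξ (t, x) - ξ (s, x)) =
        ∫ p in slab L s t, v s p.2 * ξt p := by
      have hi := hci hvsc hs htT
      rw [IntegrableOn, restrict_slab] at hi
      rw [restrict_slab, integral_prod_symm _ hi]
      refine setIntegral_congr_fun measurableSet_Ioo fun x hx => ?_
      simp only
      rw [integral_const_mul, ← intervalIntegral.integral_of_le hst]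
      congr 1
      have hc : ContinuousOn (fun τ => ξt (τ, x)) (Icc 0 T) :=
        hξt.comp (f := fun τ : ℝ => (τ, x)) (by fun_prop)
          fun τ hτ => ⟨hτ, Ioo_subset_Icc_self hx⟩
      have hst' : Icc s t ⊆ Icc 0 T := Icc_subset_Icc hs htT
      refine (intervalIntegral.integral_eq_sub_of_hasDeriv_right_of_le hst
        (fun τ hτ => (hdt τ (hst' hτ) x (Ioo_subset_Icc_self hx)).continuousWithinAt.mono hst')
        (fun τ hτ => ?_) ?_).symm
      · have := hdt τ (hst' (Ioo_subset_Icc_self hτ)) x (Ioo_subset_Icc_self hx)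
        exact (this.hasDerivAt (Icc_mem_nhds (hs.trans_lt hτ.1)
          (hτ.2.trans_le htT))).hasDerivWithinAt
      · refine ContinuousOn.intervalIntegrable ?_
        rw [uIcc_of_le hst]
        exact hc.mono hst'
    have hvt : ∀ r, Continuous (v r) := fun r => by fun_prop
    have e4 : (∫ x in Ioo 0 L, v t x * ξ (t, x)) - ∫ x in Ioo 0 L, v s x * ξ (s, x) =
        (∫ x in Ioo 0 L, (v t x - v s x) * ξ (t, x))
          + ∫ x in Ioo 0 L, v s x * (ξ (t, x) - ξ (s, x)) := by
      have c1 := hslice₁ hξ ht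
      have c2 := hslice₁ hξ hsT
      have a1 := integral_sub (hspace ((hvt t).continuousOn.mul c1))
        (hspace ((hvt s).continuousOn.mul c2))
      have a2 := integral_add (hspace (((hvt t).sub (hvt s)).continuousOn.mul c1))
        (hspace ((hvt s).continuousOn.mul (c1.sub c2)))
      simp only [Pi.mul_apply, Pi.sub_apply] at a1 a2
      rw [← a1, ← a2]
      refine integral_congr_ae (.of_forall fun x => ?_)
      simp only
      ring
    have e5 : (∫ p in slab L s t, H p.1 p.2 * ξx (t, p.2)) + (∫ p in slab L s t, v s p.2 * ξt p)
        - (∫ p in slab L s t, (H p.1 p.2 * ξx p + v p.1 p.2 * ξt p)) =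
      ∫ p in slab L s t, (H p.1 p.2 * (ξx (t, p.2) - ξx p) + (v s p.2 - v p.1 p.2) * ξt p) := by
      have i1 := hHi (hslice hξx ht) hs htT
      have i2 := hci hvsc hs htT
      have i3 := (hHi hξx hs htT).add (hci hvξ hs htT)
      have a1 := integral_add i1 i2
      have a2 := integral_sub (i1.add i2) i3
      simp only [Pi.add_apply] at a2
      rw [← a1, ← a2]
      refine integral_congr_ae (.of_forall fun p => ?_)
      simp only
      ring
    simp only [m]
    linarith
  have hm : m T = m 0 := by
    refine eq_of_forall_abs_sub_le (Θ := Θ) hT fun ε hε => ?_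
    -- Uniform continuity of `ξx` and `v` on the compact cylinder makes the integrand of the error
    -- at most ε times the integrand of `Θ`.
    obtain ⟨δ₁, hδ₁, h1⟩ := Metric.uniformContinuousOn_iff.1
      (hKc.uniformContinuousOn_of_continuous hξx) ε hε
    obtain ⟨δ₂, hδ₂, h2⟩ := Metric.uniformContinuousOn_iff.1
      (hKc.uniformContinuousOn_of_continuous hvc.continuousOn) ε hε
    refine ⟨min δ₁ δ₂ / 2, by positivity, fun s t hs hst htT hd => ?_⟩
    have hmin : min δ₁ δ₂ / 2 < min δ₁ δ₂ := half_lt_self (by positivity)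
    have hΘi : ∀ {s t}, 0 ≤ s → t ≤ T → IntegrableOn (fun p : ℝ × ℝ => |H p.1 p.2| + C)
        (slab L s t) := fun hs ht =>
      (integrableOn_slab_of_cyl (h.int T) hs ht).abs.add (hci continuousOn_const hs ht)
    have e1 : Θ t - Θ s = ∫ p in slab L s t, (|H p.1 p.2| + C) := by
      simp only [Θ]
      rw [integral_slab_add hs hst (hΘi le_rfl htT)]
      ring
    rw [hincr s t hs hst htT, e1, ← integral_const_mul]
    refine abs_integral_le_integral_abs.trans ?_
    refine integral_mono_of_nonneg (.of_forall fun p => abs_nonneg _)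
      ((hΘi hs htT).const_mul ε)
      ((ae_restrict_iff' (measurableSet_slab _ _ _)).2 (.of_forall fun p hp => ?_))
    have hpK := hsub hs htT hp
    have hdist : ∀ r ∈ Icc s t, dist (r, p.2) p < min δ₁ δ₂ := fun r hr => by
      rw [Prod.dist_eq, dist_self, max_eq_left dist_nonneg, Real.dist_eq]
      refine lt_of_le_of_lt ?_ (hd.trans_lt hmin)
      rw [abs_le]
      constructor <;> linarith [hp.1.1, hp.1.2, hr.1, hr.2]
    have b1 := h1 (t, p.2) ⟨⟨hs.trans hst, htT⟩, hpK.2⟩ p hpK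
      ((hdist t ⟨hst, le_rfl⟩).trans_le (min_le_left _ _))
    have b2 := h2 (s, p.2) ⟨⟨hs, hst.trans htT⟩, hpK.2⟩ p hpK
      ((hdist s ⟨le_rfl, hst⟩).trans_le (min_le_right _ _))
    rw [Real.dist_eq] at b1 b2
    have b3 := hC p hpK
    rw [Real.norm_eq_abs] at b3
    simp only
    calc |H p.1 p.2 * (ξx (t, p.2) - ξx p) + (v s p.2 - v p.1 p.2) * ξt p|
        ≤ |H p.1 p.2| * |ξx (t, p.2) - ξx p| + |v s p.2 - v p.1 p.2| * |ξt p| := by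
          rw [← abs_mul, ← abs_mul]
          exact abs_add_le _ _
      _ ≤ |H p.1 p.2| * ε + ε * C := by gcongr
      _ = ε * (|H p.1 p.2| + C) := by ring
  simp only [m] at hm
  have hz : slab L 0 0 = ∅ := by simp [slab]
  rw [hz, setIntegral_empty, integral_add (hHi hξx le_rfl le_rfl) (hci hvξ le_rfl le_rfl)] at hm
  rw [restrict_cyl]
  linarith

/-- The test function is smooth only on the closed cylinder, so its partial derivatives are first
taken within that set, where they are continuous up to the boundary; in the open cylinder they agree
with `deriv`. -/
lemma IsModeSolution.weakForm {L T : ℝ} (hL : 0 < L) (hT : 0 < T) {v H : ℝ → ℝ → ℝ}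
    (h : IsModeSolution L v H) {u₀ : ℝ → ℝ} (h0 : v 0 =ᵐ[volI L] u₀) : WeakForm L T v H u₀ := by
  intro ξ hξ
  have hud : UniqueDiffOn ℝ (Icc 0 T ×ˢ Icc 0 L) :=
    (uniqueDiffOn_Icc hT).prod (uniqueDiffOn_Icc hL)
  have hf := hξ.continuousOn_fderivWithin hud (by simp)
  have hfd : ∀ t ∈ Icc 0 T, ∀ x ∈ Icc 0 L, HasFDerivWithinAt ξ
      (fderivWithin ℝ ξ (Icc 0 T ×ˢ Icc 0 L) (t, x)) (Icc 0 T ×ˢ Icc 0 L) (t, x) :=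
    fun t ht x hx => ((hξ.differentiableOn (by simp)) (t, x) ⟨ht, hx⟩).hasFDerivWithinAt
  have hdt : ∀ t ∈ Icc 0 T, ∀ x ∈ Icc 0 L, HasDerivWithinAt (fun s => ξ (s, x))
      (fderivWithin ℝ ξ (Icc 0 T ×ˢ Icc 0 L) (t, x) (1, 0)) (Icc 0 T) t := fun t ht x hx =>
    (hfd t ht x hx).comp_hasDerivWithinAt (f := fun s => (s, x)) t
      ((hasDerivWithinAt_id t _).prodMk (hasDerivWithinAt_const t _ x)) fun s hs => ⟨hs, hx⟩
  have hdx : ∀ t ∈ Icc 0 T, ∀ x ∈ Icc 0 L, HasDerivWithinAt (fun y => ξ (t, y))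
      (fderivWithin ℝ ξ (Icc 0 T ×ˢ Icc 0 L) (t, x) (0, 1)) (Icc 0 L) x := fun t ht x hx =>
    (hfd t ht x hx).comp_hasDerivWithinAt (f := fun y => (t, y)) x
      ((hasDerivWithinAt_const x _ t).prodMk (hasDerivWithinAt_id x _)) fun s hs => ⟨ht, hs⟩
  have key := h.test_cyl hL hT.le hξ.continuousOn
    (ξt := fun p => fderivWithin ℝ ξ (Icc 0 T ×ˢ Icc 0 L) p (1, 0))
    (ξx := fun p => fderivWithin ℝ ξ (Icc 0 T ×ˢ Icc 0 L) p (0, 1))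
    (hf.clm_apply continuousOn_const) (hf.clm_apply continuousOn_const) hdt hdx
  have hm : MeasurableSet (cyl L T) := measurableSet_Ioo.prod measurableSet_Ioo
  have e0 : ∫ x in Ioo 0 L, v 0 x * ξ (0, x) = ∫ x in Ioo 0 L, u₀ x * ξ (0, x) := by
    refine integral_congr_ae ?_
    filter_upwards [h0] with x hx
    rw [hx]
  rw [e0] at key
  rw [← key]
  congr 1
  · refine setIntegral_congr_fun hm fun p hp => ?_
    rw [((hdt p.1 (Ioo_subset_Icc_self hp.1) p.2 (Ioo_subset_Icc_self hp.2)).hasDerivAt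
      (Icc_mem_nhds hp.1.1 hp.1.2)).deriv]
  · refine setIntegral_congr_fun hm fun p hp => ?_
    rw [((hdx p.1 (Ioo_subset_Icc_self hp.1) p.2 (Ioo_subset_Icc_self hp.2)).hasDerivAt
      (Icc_mem_nhds hp.2.1 hp.2.2)).deriv]

/-! ### Calculus of weak limits -/

/-- `J` is the weak limit in `L₂(ν)` of the sequence `j`, which is eventually bounded. -/
structure IsWeakLimit {α : Type*} [MeasurableSpace α] (ν : Measure α) (l : Filter ℕ)
    (j : ℕ → α → ℝ) (J : α → ℝ) : Prop where
  mem : ∀ᶠ n in l, MemLp (j n) 2 ν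
  mem_lim : MemLp J 2 ν
  bdd : ∃ C, ∀ᶠ n in l, ∫ a, j n a ^ 2 ∂ν ≤ C
  tendsto : ∀ φ : α → ℝ, MemLp φ 2 ν →
    Tendsto (fun n => ∫ a, j n a * φ a ∂ν) l (𝓝 (∫ a, J a * φ a ∂ν))

/-- `β` is the uniform limit on `A` of the sequence `b`, and bounded. -/
structure IsStrongLimit {α : Type*} [MeasurableSpace α] (ν : Measure α) (l : Filter ℕ)
    (A : Set α) (b : ℕ → α → ℝ) (β : α → ℝ) : Prop where
  unif : TendstoUniformlyOn b β l A
  meas : ∀ᶠ n in l, AEStronglyMeasurable (b n) (ν.restrict A)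
  meas_lim : AEStronglyMeasurable β (ν.restrict A)
  bdd : ∃ M, ∀ a ∈ A, |β a| ≤ M

section WeakLimit

variable {α : Type*} [MeasurableSpace α] {ν : Measure α} {l : Filter ℕ}

/-- A lower bound `c` for the limit gives the lower bound `c / 2` for the sequence from some index
on, and inversion is Lipschitz there. This is why `IsWeakLimit` and `IsStrongLimit` ask for
measurability and bounds only eventually. -/
lemma IsStrongLimit.inv {A : Set α} {b : ℕ → α → ℝ} {β : α → ℝ} (h : IsStrongLimit ν l A b β)
    {c : ℝ} (hc : 0 < c) (hβ : ∀ a ∈ A, c ≤ β a) :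
    (∀ᶠ n in l, ∀ a ∈ A, 0 < b n a) ∧
      IsStrongLimit ν l A (fun n a => (b n a)⁻¹) (fun a => (β a)⁻¹) := by
  have hev : ∀ᶠ n in l, ∀ a ∈ A, c / 2 ≤ b n a := by
    filter_upwards [Metric.tendstoUniformlyOn_iff.1 h.unif (c / 2) (by positivity)] with n hn a ha
    have h1 := hn a ha
    rw [Real.dist_eq, abs_lt] at h1
    linarith [hβ a ha, h1.2]
  refine ⟨hev.mono fun n hn a ha => lt_of_lt_of_le (by positivity) (hn a ha), ?_, ?_, ?_, ?_⟩
  · refine Metric.tendstoUniformlyOn_iff.2 fun ε hε => ?_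
    filter_upwards [hev, Metric.tendstoUniformlyOn_iff.1 h.unif (ε * (c * (c / 2)))
      (by positivity)] with n hn hn' a ha
    have h0 := hβ a ha
    have h1 := hn a ha
    have hβ0 : 0 < β a := hc.trans_le h0
    have hb0 : 0 < b n a := lt_of_lt_of_le (by positivity) h1
    have h2 := hn' a ha
    rw [Real.dist_eq] at h2 ⊢
    rw [inv_sub_inv hβ0.ne' hb0.ne', abs_div, abs_of_pos (mul_pos hβ0 hb0),
      div_lt_iff₀ (mul_pos hβ0 hb0), abs_sub_comm]
    refine h2.trans_le ?_
    gcongr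
  · exact h.meas.mono fun n hn => hn.inv₀
  · exact h.meas_lim.inv₀
  · refine ⟨c⁻¹, fun a ha => ?_⟩
    rw [abs_inv, abs_of_pos (hc.trans_le (hβ a ha))]
    exact inv_anti₀ hc (hβ a ha)

lemma IsStrongLimit.mono {A A' : Set α} {b : ℕ → α → ℝ} {β : α → ℝ}
    (h : IsStrongLimit ν l A b β) (hA : A' ⊆ A) : IsStrongLimit ν l A' b β := by
  obtain ⟨M, hM⟩ := h.bdd
  exact ⟨h.unif.mono hA, h.meas.mono fun n hn => hn.mono_set hA, h.meas_lim.mono_set hA,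
    M, fun a ha => hM a (hA ha)⟩

/-- The product of a strong and a weak limit is the weak limit of the products. Together with the
linear operations below, this gives the limit of every expression that is linear in the currents and
polynomial in the roots. -/
lemma IsWeakLimit.mul {A : Set α} (hA : MeasurableSet A) {j b : ℕ → α → ℝ} {J β : α → ℝ}
    (hb : IsStrongLimit ν l A b β) (h : IsWeakLimit (ν.restrict A) l j J) :
    IsWeakLimit (ν.restrict A) l (fun n a => b n a * j n a) (fun a => β a * J a) := by
  obtain ⟨M, hM⟩ := hb.bdd
  obtain ⟨C, hC⟩ := h.bdd
  have hβ : ∀ {φ : α → ℝ}, MemLp φ 2 (ν.restrict A) →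
      MemLp (fun a => β a * φ a) 2 (ν.restrict A) := fun {φ} hφ => by
    refine hφ.of_le_mul (c := M) (hb.meas_lim.mul hφ.1)
      ((ae_restrict_iff' hA).2 (.of_forall fun a ha => ?_))
    rw [norm_mul]
    exact mul_le_mul_of_nonneg_right (hM a ha) (norm_nonneg _)
  have hev : ∀ᶠ n in l, ∀ a ∈ A, |b n a| ≤ M + 1 := by
    filter_upwards [Metric.tendstoUniformlyOn_iff.1 hb.unif 1 one_pos] with n hn a ha
    have h1 := hn a ha
    rw [Real.dist_eq, abs_sub_comm] at h1
    have h2 := abs_sub_abs_le_abs_sub (b n a) (β a)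
    linarith [hM a ha]
  have hmem : ∀ᶠ n in l, MemLp (fun a => b n a * j n a) 2 (ν.restrict A) := by
    filter_upwards [hev, h.mem, hb.meas] with n hn hj hm
    refine hj.of_le_mul (c := M + 1) (hm.mul hj.1)
      ((ae_restrict_iff' hA).2 (.of_forall fun a ha => ?_))
    rw [norm_mul]
    exact mul_le_mul_of_nonneg_right (hn a ha) (norm_nonneg _)
  refine ⟨hmem, hβ h.mem_lim, ⟨(M + 1) ^ 2 * C, ?_⟩, fun φ hφ => ?_⟩
  · filter_upwards [hev, h.mem, hC] with n hn hj hCn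
    refine le_trans ?_ (mul_le_mul_of_nonneg_left hCn (sq_nonneg _))
    rw [← integral_const_mul]
    refine integral_mono_of_nonneg (.of_forall fun a => sq_nonneg _)
      (hj.integrable_sq.const_mul _) ((ae_restrict_iff' hA).2 (.of_forall fun a ha => ?_))
    simp only
    rw [mul_pow, ← sq_abs (b n a)]
    have := hn a ha
    gcongr
  -- Uniform convergence is known on `A` only, so the test function is first set to zero elsewhere.
  · have hind : (A.indicator φ) =ᵐ[ν.restrict A] φ := indicator_ae_eq_restrict hA
    have hψ : MemLp (A.indicator φ) 2 (ν.restrict A) := (memLp_congr_ae hind).2 hφ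
    have h1 := tendsto_integral_mul_of_uniform h.mem hC h.tendsto hb.unif hb.meas hψ
      (fun a ha => indicator_of_notMem ha φ) (hβ hψ)
    have e : ∀ u w : α → ℝ, ∫ a in A, u a * (w a * A.indicator φ a) ∂ν =
        ∫ a in A, w a * u a * φ a ∂ν := fun u w => by
      refine integral_congr_ae ?_
      filter_upwards [hind] with a ha
      rw [ha]
      ring
    simpa only [e] using h1

lemma IsWeakLimit.add {j j' : ℕ → α → ℝ} {J J' : α → ℝ} (h : IsWeakLimit ν l j J)
    (h' : IsWeakLimit ν l j' J') :
    IsWeakLimit ν l (fun n a => j n a + j' n a) (fun a => J a + J' a) := by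
  obtain ⟨C, hC⟩ := h.bdd
  obtain ⟨C', hC'⟩ := h'.bdd
  refine ⟨?_, h.mem_lim.add h'.mem_lim, ⟨2 * C + 2 * C', ?_⟩, fun φ hφ => ?_⟩
  · filter_upwards [h.mem, h'.mem] with n h1 h2
    exact h1.add h2
  · filter_upwards [h.mem, h'.mem, hC, hC'] with n h1 h2 h3 h4
    have h5 : ∫ a, (j n a + j' n a) ^ 2 ∂ν ≤ ∫ a, (2 * j n a ^ 2 + 2 * j' n a ^ 2) ∂ν :=
      integral_mono (h1.add h2).integrable_sq
        ((h1.integrable_sq.const_mul 2).add (h2.integrable_sq.const_mul 2)) fun a => by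
          simp only
          nlinarith [sq_nonneg (j n a - j' n a)]
    rw [integral_add (h1.integrable_sq.const_mul 2) (h2.integrable_sq.const_mul 2),
      integral_const_mul, integral_const_mul] at h5
    linarith
  · have h1 := (h.tendsto φ hφ).add (h'.tendsto φ hφ)
    have e : ∀ {u w : α → ℝ}, MemLp u 2 ν → MemLp w 2 ν → ∫ a, u a * φ a ∂ν + ∫ a, w a * φ a ∂ν
        = ∫ a, (u a + w a) * φ a ∂ν := fun {u w} hu hw => by
      have e1 := integral_add (hu.integrable_mul hφ) (hw.integrable_mul hφ)
      simp only [Pi.mul_apply] at e1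
      rw [← e1]
      simp_rw [add_mul]
    rw [e h.mem_lim h'.mem_lim] at h1
    refine h1.congr' ?_
    filter_upwards [h.mem, h'.mem] with n h2 h3
    exact e h2 h3

lemma IsWeakLimit.const_mul {j : ℕ → α → ℝ} {J : α → ℝ} (h : IsWeakLimit ν l j J) (c : ℝ) :
    IsWeakLimit ν l (fun n a => c * j n a) (fun a => c * J a) := by
  obtain ⟨C, hC⟩ := h.bdd
  refine ⟨h.mem.mono fun n hn => hn.const_mul c, h.mem_lim.const_mul c, ⟨c ^ 2 * C, ?_⟩,
    fun φ hφ => ?_⟩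
  · filter_upwards [hC] with n hn
    simp_rw [mul_pow]
    rw [integral_const_mul]
    gcongr
  · simpa only [mul_assoc, integral_const_mul] using (h.tendsto φ hφ).const_mul c

lemma IsWeakLimit.sub {j j' : ℕ → α → ℝ} {J J' : α → ℝ} (h : IsWeakLimit ν l j J)
    (h' : IsWeakLimit ν l j' J') :
    IsWeakLimit ν l (fun n a => j n a - j' n a) (fun a => J a - J' a) := by
  have := h.add (h'.const_mul (-1))
  simpa only [neg_one_mul, ← sub_eq_add_neg] using this

lemma IsWeakLimit.congr {j j' : ℕ → α → ℝ} {J : α → ℝ} (h : IsWeakLimit ν l j J)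
    (hj : ∀ᶠ n in l, j n =ᵐ[ν] j' n) : IsWeakLimit ν l j' J := by
  obtain ⟨C, hC⟩ := h.bdd
  refine ⟨?_, h.mem_lim, ⟨C, ?_⟩, fun φ hφ => (h.tendsto φ hφ).congr' ?_⟩
  · filter_upwards [hj, h.mem] with n h1 h2
    exact (memLp_congr_ae h1).1 h2
  · filter_upwards [hj, hC] with n h1 h2
    rwa [integral_congr_ae (g := fun a => j n a ^ 2) (h1.mono fun a ha => by simp only [ha])]
  · filter_upwards [hj] with n h1
    exact integral_congr_ae (h1.mono fun a ha => by simp only [ha])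

lemma IsWeakLimit.mono {A A' : Set α} (hA' : MeasurableSet A') (hA : A' ⊆ A) {j : ℕ → α → ℝ}
    {J : α → ℝ} (h : IsWeakLimit (ν.restrict A) l j J) : IsWeakLimit (ν.restrict A') l j J := by
  obtain ⟨C, hC⟩ := h.bdd
  have hle : ν.restrict A' ≤ ν.restrict A := Measure.restrict_mono hA le_rfl
  refine ⟨h.mem.mono fun n hn => hn.mono_measure hle, h.mem_lim.mono_measure hle, ⟨C, ?_⟩,
    fun φ hφ => ?_⟩
  · filter_upwards [h.mem, hC] with n h1 h2
    exact (setIntegral_mono_set h1.integrable_sq (.of_forall fun a => sq_nonneg _)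
      hA.eventuallyLE).trans h2
  · have hm : MemLp (A'.indicator φ) 2 (ν.restrict A) := by
      rw [memLp_indicator_iff_restrict hA', Measure.restrict_restrict hA', inter_eq_left.2 hA]
      exact hφ
    have e : ∀ u : α → ℝ, ∫ a in A, u a * A'.indicator φ a ∂ν = ∫ a in A', u a * φ a ∂ν :=
      fun u => by
        have : ∀ a, u a * A'.indicator φ a = A'.indicator (fun a => u a * φ a) a := fun a => by
          by_cases ha : a ∈ A' <;> simp [ha]
        simp_rw [this]
        rw [integral_indicator hA', Measure.restrict_restrict hA', inter_eq_left.2 hA]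
    simpa only [e] using h.tendsto _ hm

lemma IsWeakLimit.unique [l.NeBot] {j : ℕ → α → ℝ} {J J' : α → ℝ} (h : IsWeakLimit ν l j J)
    (h' : IsWeakLimit ν l j J') : J =ᵐ[ν] J' := by
  have hd := h.mem_lim.sub h'.mem_lim
  have h1 := tendsto_nhds_unique (h.tendsto _ hd) (h'.tendsto _ hd)
  have h2 := integral_sub (h.mem_lim.integrable_mul hd) (h'.mem_lim.integrable_mul hd)
  simp only [Pi.mul_apply, Pi.sub_apply] at h1 h2
  rw [h1, sub_self] at h2
  have h3 : ∫ a, (J a - J' a) ^ 2 ∂ν = 0 := by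
    rw [← h2]
    refine integral_congr_ae (.of_forall fun a => ?_)
    simp only
    ring
  have h4 := (integral_eq_zero_iff_of_nonneg (fun a => sq_nonneg _) hd.integrable_sq).1 h3
  filter_upwards [h4] with a ha
  simpa [sub_eq_zero] using ha

/-- Weak lower semicontinuity of the norm. -/
lemma IsWeakLimit.eventually_integral_sq_le {j : ℕ → α → ℝ} {J : α → ℝ}
    (h : IsWeakLimit ν l j J) {ε : ℝ} (hε : 0 < ε) :
    ∀ᶠ n in l, ∫ a, J a ^ 2 ∂ν ≤ ∫ a, j n a ^ 2 ∂ν + ε := by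
  have h1 := h.tendsto J h.mem_lim
  have e0 : ∫ a, J a * J a ∂ν = ∫ a, J a ^ 2 ∂ν := by simp_rw [sq]
  rw [e0] at h1
  filter_upwards [h.mem, h1.eventually_const_le (sub_lt_self _ (half_pos hε))] with n hj hn
  have hm := hj.integrable_mul h.mem_lim
  simp only [Pi.mul_def] at hm
  have h2 : 0 ≤ ∫ a, (j n a - J a) ^ 2 ∂ν := integral_nonneg fun a => sq_nonneg _
  have h3 : ∫ a, (j n a - J a) ^ 2 ∂ν =
      ∫ a, j n a ^ 2 ∂ν - 2 * (∫ a, j n a * J a ∂ν) + ∫ a, J a ^ 2 ∂ν := by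
    have e1 := integral_add (hj.integrable_sq.sub (hm.const_mul 2)) h.mem_lim.integrable_sq
    have e2 := integral_sub hj.integrable_sq (hm.const_mul 2)
    simp only [Pi.sub_apply] at e1 e2
    rw [← integral_const_mul, ← e2, ← e1]
    refine integral_congr_ae (.of_forall fun a => ?_)
    simp only
    ring
  linarith

end WeakLimit

/-! ### Weak limits on space-time cylinders -/

lemma measurableSet_cyl (L T : ℝ) : MeasurableSet (cyl L T) :=
  measurableSet_Ioo.prod measurableSet_Ioo

lemma continuous_integrableOn_cyl (L T : ℝ) {F : ℝ × ℝ → ℝ} (hF : Continuous F) :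
    IntegrableOn F (cyl L T) :=
  (hF.continuousOn.integrableOn_compact (isCompact_Icc.prod isCompact_Icc)).mono_set
    (prod_mono Ioo_subset_Icc_self Ioo_subset_Icc_self)

lemma continuous_memLp_cyl (L T : ℝ) {F : ℝ × ℝ → ℝ} (hF : Continuous F) :
    MemLp F 2 (volume.restrict (cyl L T)) := by
  rw [memLp_two_iff_integrable_sq hF.aestronglyMeasurable]
  exact continuous_integrableOn_cyl L T (hF.pow 2)

lemma setIntegral_cyl_eq {L T : ℝ} (hL : 0 ≤ L) (hT : 0 ≤ T) {F : ℝ × ℝ → ℝ}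
    (hF : Continuous F) :
    ∫ p in cyl L T, F p = ∫ t in (0)..T, ∫ x in (0)..L, F (t, x) := by
  have h := continuous_integrableOn_cyl L T hF
  rw [IntegrableOn, cyl, Measure.volume_eq_prod, ← Measure.prod_restrict] at h
  rw [cyl, Measure.volume_eq_prod, ← Measure.prod_restrict, integral_prod _ h,
    setIntegral_Ioo_eq hT (fun t => ∫ x in Ioo 0 L, F (t, x))]
  exact intervalIntegral.integral_congr fun t _ => setIntegral_Ioo_eq hL (fun x => F (t, x))

/-- Currents with bounded dissipation converge weakly on all bounded cylinders. -/
lemma exists_current_limit {L C : ℝ} {U : Ultrafilter ℕ} (hU : (U : Filter ℕ) ≤ atTop)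
    {c : ℕ → ℝ × ℝ → ℝ} (hc : ∀ n, Continuous (c n))
    (hb : ∀ n : ℕ, ∫ p in cyl L n, c n p ^ 2 ≤ C) :
    ∃ J : ℝ × ℝ → ℝ, ∀ T, IsWeakLimit (volume.restrict (cyl L T)) U c J := by
  -- Extension by zero outside the cylinder of length `n` gives a bounded sequence in L₂ of the
  -- plane. Its single weak limit serves every `T`, because the cylinder up to time `T` lies inside
  -- for large `n`.
  obtain ⟨J, hJm, hJ⟩ := exists_weak_limit (ν := volume) U
    (fun n : ℕ => (cyl L n).indicator (c n)) (C := C)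
    (fun n => (memLp_indicator_iff_restrict (measurableSet_cyl L n)).2
      (continuous_memLp_cyl L n (hc n))) (fun n => by
      have : ∀ p, (cyl L n).indicator (c n) p ^ 2 =
          (cyl L n).indicator (fun p => c n p ^ 2) p := fun p => by
        by_cases hp : p ∈ cyl L n <;> simp [hp]
      simp_rw [this]
      rw [integral_indicator (measurableSet_cyl L n)]
      exact hb n)
  refine ⟨J, fun T => ?_⟩
  have hev : ∀ᶠ n : ℕ in U, cyl L T ⊆ cyl L n :=
    ((eventually_ge_atTop ⌈T⌉₊).filter_mono hU).mono fun n hn =>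
      prod_mono (Ioo_subset_Ioo le_rfl (Nat.ceil_le.1 hn)) le_rfl
  refine ⟨.of_forall fun n => continuous_memLp_cyl L T (hc n),
    hJm.mono_measure Measure.restrict_le_self, ⟨C, ?_⟩, fun φ hφ => ?_⟩
  · filter_upwards [hev] with n hn
    exact (setIntegral_mono_set (continuous_memLp_cyl L n (hc n)).integrable_sq
      (.of_forall fun a => sq_nonneg _) hn.eventuallyLE).trans (hb n)
  · have h1 := hJ ((cyl L T).indicator φ)
      ((memLp_indicator_iff_restrict (measurableSet_cyl L T)).2 hφ)
    have e : ∀ u : ℝ × ℝ → ℝ, ∫ p, u p * (cyl L T).indicator φ p = ∫ p in cyl L T, u p * φ p :=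
      fun u => by
        rw [← integral_indicator (measurableSet_cyl L T)]
        refine integral_congr_ae (.of_forall fun p => ?_)
        by_cases hp : p ∈ cyl L T <;> simp [hp]
    simp_rw [e] at h1
    refine h1.congr' ?_
    filter_upwards [hev] with n hn
    refine setIntegral_congr_fun (measurableSet_cyl L T) fun p hp => ?_
    rw [indicator_of_mem (hn hp)]

/-! ### Third derivatives in the space variable -/

/-- The partial derivative in the second variable. -/
def derivX (φ : ℝ × ℝ → ℝ) (p : ℝ × ℝ) : ℝ := fderiv ℝ φ p (0, 1)

lemma contDiff_derivX {φ : ℝ × ℝ → ℝ} (hφ : ContDiff ℝ ∞ φ) : ContDiff ℝ ∞ (derivX φ) :=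
  (hφ.fderiv_right (m := ∞) (by simp)).clm_apply contDiff_const

lemma hasDerivAt_derivX {φ : ℝ × ℝ → ℝ} (hφ : ContDiff ℝ ∞ φ) (t x : ℝ) :
    HasDerivAt (fun y => φ (t, y)) (derivX φ (t, x)) x :=
  (hφ.differentiable (by simp) (t, x)).hasFDerivAt.comp_hasDerivAt (f := fun y => (t, y)) x
    ((hasDerivAt_const x t).prodMk (hasDerivAt_id x))

lemma tsupport_derivX_subset (φ : ℝ × ℝ → ℝ) : tsupport (derivX φ) ⊆ tsupport φ := by
  refine closure_minimal (fun p hp => ?_) (isClosed_tsupport φ)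
  by_contra h
  refine hp ?_
  have h1 : fderiv ℝ φ p = 0 :=
    image_eq_zero_of_notMem_tsupport fun h' => h (tsupport_fderiv_subset ℝ h')
  simp [derivX, h1]

lemma iteratedDeriv_three_eq_derivX {φ : ℝ × ℝ → ℝ} (hφ : ContDiff ℝ ∞ φ) (t x : ℝ) :
    iteratedDeriv 3 (fun y => φ (t, y)) x = derivX (derivX (derivX φ)) (t, x) := by
  have h : ∀ {ψ : ℝ × ℝ → ℝ}, ContDiff ℝ ∞ ψ →
      deriv (fun y => ψ (t, y)) = fun y => derivX ψ (t, y) := fun hψ =>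
    funext fun y => (hasDerivAt_derivX hψ t y).deriv
  have h1 := contDiff_derivX hφ
  rw [iteratedDeriv_succ, iteratedDeriv_succ, iteratedDeriv_succ, iteratedDeriv_zero, h hφ, h h1,
    h (contDiff_derivX h1)]

lemma integrable_mul_of_hasCompactSupport {u φ : ℝ × ℝ → ℝ} (hu : Continuous u)
    (hφ : Continuous φ) (hc : HasCompactSupport φ) : Integrable fun p => u p * φ p :=
  (hu.mul hφ).integrable_of_hasCompactSupport hc.mul_left

lemma integral_mul_derivX {u u₁ : ℝ → ℝ → ℝ} (hu : Continuous fun p : ℝ × ℝ => u p.1 p.2)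
    (hu₁ : Continuous fun p : ℝ × ℝ => u₁ p.1 p.2) (hd : ∀ t x, HasDerivAt (u t) (u₁ t x) x)
    {φ : ℝ × ℝ → ℝ} (hφ : ContDiff ℝ ∞ φ) (hc : HasCompactSupport φ) :
    ∫ p, u p.1 p.2 * derivX φ p = -∫ p, u₁ p.1 p.2 * φ p := by
  have hcx : HasCompactSupport (derivX φ) := hc.mono' (subset_closure.trans
    (tsupport_derivX_subset φ))
  have hφx := (contDiff_derivX hφ).continuous
  have i1 := integrable_mul_of_hasCompactSupport hu hφx hcx
  have i2 := integrable_mul_of_hasCompactSupport hu₁ hφ.continuous hc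
  rw [Measure.volume_eq_prod] at i1 i2 ⊢
  rw [integral_prod _ i1, integral_prod _ i2, ← integral_neg]
  refine integral_congr_ae (.of_forall fun t => ?_)
  have hφt : Continuous fun x : ℝ => φ (t, x) := hφ.continuous.comp (by fun_prop)
  have hcomp : ∀ {ψ : ℝ × ℝ → ℝ}, HasCompactSupport ψ → HasCompactSupport fun x => ψ (t, x) :=
    fun {ψ} hψ => HasCompactSupport.intro (hψ.isCompact.image continuous_snd) fun x hx =>
      image_eq_zero_of_notMem_tsupport fun h' => hx ⟨(t, x), h', rfl⟩
  have hinteg : ∀ {w : ℝ → ℝ → ℝ} {ψ : ℝ × ℝ → ℝ}, Continuous (fun p : ℝ × ℝ => w p.1 p.2) →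
      Continuous ψ → HasCompactSupport ψ → Integrable fun x => w t x * ψ (t, x) :=
    fun {w ψ} hw hψ hψc => by
      have h1 : Continuous fun x => w t x * ψ (t, x) := by fun_prop
      exact h1.integrable_of_hasCompactSupport (hcomp hψc).mul_left
  exact integral_mul_deriv_eq_deriv_mul_of_integrable (fun x _ => hd t x)
    (fun x _ => hasDerivAt_derivX hφ t x) (hinteg hu hφx hcx) (hinteg hu₁ hφ.continuous hc)
    (hinteg hu hφ.continuous hc)

/-- Integrate by parts three times at level `n`. One side converges because the functions do so
uniformly, the other because the third derivatives converge weakly on the support of the test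
function, which is a compact subset of `Ω`. -/
lemma isWeakDerivX3_of_tendsto {L : ℝ} {l : Filter ℕ} [l.NeBot] {T : ℝ}
    {u u₁ u₂ u₃ : ℕ → ℝ → ℝ → ℝ} {v v₃ : ℝ → ℝ → ℝ} {Ω : Set (ℝ × ℝ)}
    (hu : ∀ n, Continuous fun p : ℝ × ℝ => u n p.1 p.2)
    (hu₁ : ∀ n, Continuous fun p : ℝ × ℝ => u₁ n p.1 p.2)
    (hu₂ : ∀ n, Continuous fun p : ℝ × ℝ => u₂ n p.1 p.2)
    (hu₃ : ∀ n, Continuous fun p : ℝ × ℝ => u₃ n p.1 p.2)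
    (hd : ∀ n t x, HasDerivAt (u n t) (u₁ n t x) x)
    (hd₁ : ∀ n t x, HasDerivAt (u₁ n t) (u₂ n t x) x)
    (hd₂ : ∀ n t x, HasDerivAt (u₂ n t) (u₃ n t x) x)
    (hv : Continuous fun p : ℝ × ℝ => v p.1 p.2)
    (hΩ : Ω ⊆ Icc 0 T ×ˢ Icc 0 L)
    (hlim : TendstoUniformlyOn (fun n (p : ℝ × ℝ) => u n p.1 p.2) (fun p => v p.1 p.2) l
      (Icc 0 T ×ˢ Icc 0 L))
    (hlim₃ : ∀ K, IsCompact K → K ⊆ Ω → IsWeakLimit (volume.restrict K) l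
      (fun n (p : ℝ × ℝ) => u₃ n p.1 p.2) fun p => v₃ p.1 p.2) :
    IsWeakDerivX3 Ω v v₃ := by
  intro φ hφ hc hs
  have h1 := contDiff_derivX hφ
  have h2 := contDiff_derivX h1
  have h3 := contDiff_derivX h2
  have s1 := tsupport_derivX_subset φ
  have s2 := (tsupport_derivX_subset (derivX φ)).trans s1
  have s3 := (tsupport_derivX_subset (derivX (derivX φ))).trans s2
  have c1 : HasCompactSupport (derivX φ) := hc.mono' (subset_closure.trans s1)
  have c2 : HasCompactSupport (derivX (derivX φ)) := hc.mono' (subset_closure.trans s2)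
  have hK : IsCompact (tsupport φ) := hc
  have hKm : MeasurableSet (tsupport φ) := hK.measurableSet
  have hsupp : ∀ (w : ℝ × ℝ → ℝ) {ψ : ℝ × ℝ → ℝ}, tsupport ψ ⊆ tsupport φ →
      ∀ p, p ∉ tsupport φ → w p * ψ p = 0 := fun w ψ hψ p hp => by
    rw [image_eq_zero_of_notMem_tsupport fun h' => hp (hψ h'), mul_zero]
  have eK : ∀ (w : ℝ × ℝ → ℝ) {ψ : ℝ × ℝ → ℝ}, tsupport ψ ⊆ tsupport φ →
      ∫ p in tsupport φ, w p * ψ p = ∫ p, w p * ψ p := fun w ψ hψ =>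
    setIntegral_eq_integral_of_forall_compl_eq_zero (hsupp w hψ)
  have eΩ : ∀ (w : ℝ × ℝ → ℝ) {ψ : ℝ × ℝ → ℝ}, tsupport ψ ⊆ tsupport φ →
      ∫ p in Ω, w p * ψ p = ∫ p, w p * ψ p := fun w ψ hψ =>
    setIntegral_eq_integral_of_forall_compl_eq_zero fun p hp => hsupp w hψ p fun h' => hp (hs h')
  simp_rw [iteratedDeriv_three_eq_derivX hφ]
  rw [eΩ (fun p => v p.1 p.2) s3, eΩ (fun p => v₃ p.1 p.2) le_rfl, ← eK (fun p => v p.1 p.2) s3,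
    ← eK (fun p => v₃ p.1 p.2) le_rfl]
  have hm : MemLp φ 2 (volume.restrict (tsupport φ)) :=
    (hφ.continuous.memLp_of_hasCompactSupport hc).mono_measure Measure.restrict_le_self
  have t1 := ((hlim₃ _ hK hs).tendsto φ hm).neg
  have hinteg : ∀ {w : ℝ × ℝ → ℝ}, Continuous w → IntegrableOn w (tsupport φ) := fun hw =>
    hw.continuousOn.integrableOn_compact hK
  have t2 := tendsto_setIntegral_mul_of_tendstoUniformlyOn (ν := volume) hKm
    (hlim.mono (hs.trans hΩ)) (fun n => hinteg ((hu n).mul h3.continuous))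
    (hinteg (hv.mul h3.continuous)) (hinteg h3.continuous)
  refine tendsto_nhds_unique t2 (t1.congr fun n => ?_)
  rw [eK (fun p => u₃ n p.1 p.2) le_rfl, eK (fun p => u n p.1 p.2) s3,
    integral_mul_derivX (hu n) (hu₁ n) (hd n) h2 c2,
    integral_mul_derivX (hu₁ n) (hu₂ n) (hd₁ n) h1 c1,
    integral_mul_derivX (hu₂ n) (hu₃ n) (hd₂ n) hφ hc, neg_neg]

/-! ### Passage to the limit, one component -/

lemma IsWeakLimit.of_eq {α : Type*} [MeasurableSpace α] {ν : Measure α} {l : Filter ℕ}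
    {j j' : ℕ → α → ℝ} {J J' : α → ℝ} (h : IsWeakLimit ν l j J) (hj : ∀ n a, j n a = j' n a)
    (hJ : ∀ a, J a = J' a) : IsWeakLimit ν l j' J' := by
  obtain rfl : j = j' := funext fun n => funext (hj n)
  obtain rfl : J = J' := funext hJ
  exact h

/-- Hölder continuity of the square root carries uniform convergence across the points where the
height vanishes; the regularization error tends to zero uniformly. -/
lemma IsUniformLimit.isStrongLimit_sqrt {L K B D : ℝ} {U : Ultrafilter ℕ}
    (hU : (U : Filter ℕ) ≤ atTop) {u a : ℕ → ℝ → ℝ → ℝ} {v : ℝ → ℝ → ℝ}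
    (hv : IsUniformLimit L K B D U u v) (ha : ∀ n, Continuous fun p : ℝ × ℝ => a n p.1 p.2)
    (hau : ∀ n t x, |a n t x - Real.sqrt (u n t x)| ≤ Real.sqrt (1 / (n + 1))) (T : ℝ) :
    IsStrongLimit volume U (Icc 0 T ×ˢ Icc 0 L) (fun n (p : ℝ × ℝ) => a n p.1 p.2)
      (fun p => Real.sqrt (v p.1 p.2)) := by
  have hvc := hv.cont
  refine ⟨?_, .of_forall fun n => (ha n).aestronglyMeasurable,
    (by fun_prop : Continuous fun p : ℝ × ℝ => Real.sqrt (v p.1 p.2)).aestronglyMeasurable,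
    Real.sqrt B, fun p hp => ?_⟩
  · refine Metric.tendstoUniformlyOn_iff.2 fun ε hε => ?_
    have h0 : Tendsto (fun n : ℕ => Real.sqrt (1 / ((n : ℝ) + 1))) U (𝓝 0) := by
      have := (Real.continuous_sqrt.tendsto 0).comp tendsto_one_div_add_atTop_nhds_zero_nat
      rw [Real.sqrt_zero] at this
      exact this.mono_left hU
    filter_upwards [h0.eventually_lt_const (half_pos hε),
      Metric.tendstoUniformlyOn_iff.1 (hv.unif T) ((ε / 2) ^ 2) (by positivity)] with n h1 h2 p hp
    have h3 := h2 p hp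
    rw [Real.dist_eq] at h3 ⊢
    have h4 := hau n p.1 p.2
    rw [abs_sub_comm] at h4
    have h5 : Real.sqrt |v p.1 p.2 - u n p.1 p.2| < ε / 2 := by
      rw [Real.sqrt_lt' (by positivity)]
      exact h3
    have h6 := abs_sqrt_sub_sqrt_le (v p.1 p.2) (u n p.1 p.2)
    have h7 := abs_sub_le (Real.sqrt (v p.1 p.2)) (Real.sqrt (u n p.1 p.2)) (a n p.1 p.2)
    linarith
  · rw [abs_of_nonneg (Real.sqrt_nonneg _)]
    exact Real.sqrt_le_sqrt ((le_abs_self _).trans (hv.bound _ _ hp.2))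

/-- For fixed `k` and `t` the mode equation holds at every level `n` with `n ≥ k` and `n ≥ t`, and
both sides are integrals against fixed continuous functions. -/
lemma isModeSolution_of_tendsto {L K B D : ℝ} (hL : 0 < L) {U : Ultrafilter ℕ}
    (hU : (U : Filter ℕ) ≤ atTop) {u u₁ : ℕ → ℝ → ℝ → ℝ} {v : ℝ → ℝ → ℝ}
    (hu : IsBoundedSeq L K B D u u₁) (hv : IsUniformLimit L K B D U u v)
    {h : ℕ → ℝ × ℝ → ℝ} {H : ℝ → ℝ → ℝ} (hc : ∀ n, Continuous (h n))
    (hH : ∀ T, IsWeakLimit (volume.restrict (cyl L T)) U h fun p => H p.1 p.2)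
    (heq : ∀ n k : ℕ, k ≤ n → ∀ t ∈ Icc (0 : ℝ) n,
      ∫ x in (0)..L, (u n t x - u n 0 x) * cosMode L k x =
        ∫ τ in (0)..t, ∫ x in (0)..L, h n (τ, x) * -(freq L k * sinMode L k x)) :
    IsModeSolution L v H := by
  have hfin : ∀ T, IsFiniteMeasure ((volume : Measure (ℝ × ℝ)).restrict (cyl L T)) := fun T => by
    refine ⟨?_⟩
    rw [Measure.restrict_apply_univ]
    exact ((isCompact_Icc.prod isCompact_Icc).measure_lt_top (μ := volume)).trans_le'
      (measure_mono (prod_mono (Ioo_subset_Icc_self (a := (0 : ℝ)) (b := T))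
        (Ioo_subset_Icc_self (a := (0 : ℝ)) (b := L))))
  refine ⟨hv.cont, fun T => (hH T).mem_lim.integrable (by norm_num), fun t ht k => ?_⟩
  have hcos : Continuous (cosMode L k) := by fun_prop
  have hφ : Continuous fun p : ℝ × ℝ => -(freq L k * sinMode L k p.2) := by fun_prop
  have t1 := (hv.tendsto_integral hu ht hcos).sub (hv.tendsto_integral hu le_rfl hcos)
  have t2 := (hH t).tendsto _ (continuous_memLp_cyl L t hφ)
  have hsub : ∀ {y z : ℝ → ℝ}, Continuous y → Continuous z →
      (∫ x in Ioo 0 L, y x * cosMode L k x) - ∫ x in Ioo 0 L, z x * cosMode L k x =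
        ∫ x in (0)..L, (y x - z x) * cosMode L k x := fun {y z} hy hz => by
    rw [← setIntegral_Ioo_eq hL.le (fun x => (y x - z x) * cosMode L k x)]
    simp_rw [sub_mul]
    exact (integral_sub (continuous_integrableOn_Ioo (hy.mul hcos))
      (continuous_integrableOn_Ioo (hz.mul hcos))).symm
  have huc : ∀ n s, Continuous (u n s) := fun n s =>
    (hu.cont n).comp (by fun_prop : Continuous fun x => (s, x))
  rw [hsub (hv.cont_slice t) (hv.cont_slice 0)] at t1
  refine tendsto_nhds_unique t1 (t2.congr' ?_)
  filter_upwards [(eventually_ge_atTop (max k ⌈t⌉₊)).filter_mono hU] with n hn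
  rw [hsub (huc n t) (huc n 0), heq n k ((le_max_left _ _).trans hn) t
    ⟨ht, Nat.ceil_le.1 ((le_max_right _ _).trans hn)⟩]
  exact setIntegral_cyl_eq hL.le ht ((hc n).mul hφ)

/-- The derivative of the limit at time 0 has the same sine coefficients as `z₁`, so the two
functions differ by a constant; equality of the integrals makes it zero. -/
lemma IsUniformLimit.initial {L K B D : ℝ} (hL : 0 < L) {U : Ultrafilter ℕ}
    (hU : (U : Filter ℕ) ≤ atTop) {u u₁ : ℕ → ℝ → ℝ → ℝ} {v : ℝ → ℝ → ℝ}
    (hu : IsBoundedSeq L K B D u u₁) (hv : IsUniformLimit L K B D U u v) {z z₁ : ℝ → ℝ}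
    (hz : MemLp z 2 (volI L)) (hz₁ : MemLp z₁ 2 (volI L)) (hw : IsWeakDeriv L z z₁)
    (hinit : ∀ n k : ℕ, k ≤ n →
      ∫ x in (0)..L, u₁ n 0 x * sinMode L k x = ∫ x in Ioo 0 L, z₁ x * sinMode L k x)
    (hmass : ∀ n, ∫ x in (0)..L, u n 0 x = ∫ x in Ioo 0 L, z x) : v 0 =ᵐ[volI L] z := by
  obtain ⟨v₁, hv₁⟩ := hv.exists_weakDeriv hL hu
  obtain ⟨hm, hwd, -, -, hlim⟩ := hv₁ 0 le_rfl
  have hsin : ∀ k, ∫ x in Ioo 0 L, v₁ 0 x * sinMode L k x =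
      ∫ x in Ioo 0 L, z₁ x * sinMode L k x := fun k => by
    refine tendsto_nhds_unique (hlim _ (continuous_memLp_volI (by fun_prop)))
      (tendsto_const_nhds.congr' ?_)
    filter_upwards [(eventually_ge_atTop k).filter_mono hU] with n hn
    rw [← hinit n k hn, setIntegral_Ioo_eq hL.le (fun x => u₁ n 0 x * sinMode L k x)]
  have hz₁i := integrableOn_of_memLp hz₁
  have hzi := integrableOn_of_memLp hz
  have hmi := integrableOn_of_memLp hm
  have hvi : IntegrableOn (v 0) (Ioo 0 L) := continuous_integrableOn_Ioo (hv.cont_slice 0)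
  have hd : (fun x => v₁ 0 x - z₁ x) =ᵐ[volI L] 0 := by
    refine ae_eq_zero_of_integral_sinMode hL (hmi.sub hz₁i) fun k => ?_
    simp_rw [sub_mul]
    rw [integral_sub (integrableOn_mul_of_continuousOn hmi (by fun_prop))
      (integrableOn_mul_of_continuousOn hz₁i (by fun_prop)), hsin k, sub_self]
  have hzero : IsWeakDeriv L (fun x => v 0 x - z x) 0 := by
    intro φ hφ hφc hs
    have hφ' : Continuous (deriv φ) := hφ.continuous_deriv (by simp)
    simp_rw [sub_mul]
    rw [integral_sub (integrableOn_mul_of_continuousOn hvi hφ'.continuousOn)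
      (integrableOn_mul_of_continuousOn hzi hφ'.continuousOn), hwd φ hφ hφc hs, hw φ hφ hφc hs]
    have : ∫ x in Ioo 0 L, v₁ 0 x * φ x = ∫ x in Ioo 0 L, z₁ x * φ x := by
      refine integral_congr_ae ?_
      filter_upwards [hd] with x hx
      simp only [Pi.zero_apply] at hx
      rw [sub_eq_zero.1 hx]
    rw [this]
    simp
  obtain ⟨c, hc⟩ := ae_eq_const_of_isWeakDeriv_zero hL (hvi.sub hzi) hzero
  have hmass' : ∫ x in Ioo 0 L, v 0 x = ∫ x in Ioo 0 L, z x := by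
    have t1 := hv.tendsto_integral hu le_rfl (φ := fun _ => 1) continuous_const
    simp only [mul_one] at t1
    refine tendsto_nhds_unique t1 (tendsto_const_nhds.congr fun n => ?_)
    rw [← hmass n, setIntegral_Ioo_eq hL.le (u n 0)]
  have hc0 : c * L = 0 := by
    have h1 := integral_congr_ae hc
    have h2 := integral_sub hvi hzi
    simp only [Pi.sub_apply] at h1
    rw [h2, hmass', sub_self, setIntegral_const] at h1
    simp [hL.le] at h1
    rcases h1 with h1 | h1 <;> simp [h1]
  have hc1 : c = 0 := (mul_eq_zero.1 hc0).resolve_right hL.ne'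
  filter_upwards [hc] with x hx
  rw [hc1] at hx
  exact sub_eq_zero.1 hx

lemma nonneg_of_ae_nonneg {L : ℝ} {u : ℝ → ℝ} (hu : Continuous u)
    (h : ∀ᵐ x ∂(volI L), 0 ≤ u x) : ∀ x ∈ Ioo 0 L, 0 ≤ u x := by
  have hae : (fun x => min (u x) 0) =ᵐ[volI L] fun _ => 0 := by
    filter_upwards [h] with x hx
    exact min_eq_right hx
  have := Measure.eqOn_open_of_ae_eq hae isOpen_Ioo (by fun_prop) continuousOn_const
  intro x hx
  exact min_eq_right_iff.1 (this hx)

lemma eLpNorm_one_eq_of_integral_eq {L : ℝ} {u v : ℝ → ℝ} (hu : IntegrableOn u (Ioo 0 L))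
    (hv : IntegrableOn v (Ioo 0 L)) (hu0 : ∀ᵐ x ∂(volI L), 0 ≤ u x)
    (hv0 : ∀ᵐ x ∂(volI L), 0 ≤ v x) (h : ∫ x in Ioo 0 L, u x = ∫ x in Ioo 0 L, v x) :
    eLpNorm u 1 (volI L) = eLpNorm v 1 (volI L) := by
  have key : ∀ {w : ℝ → ℝ}, IntegrableOn w (Ioo 0 L) → (∀ᵐ x ∂(volI L), 0 ≤ w x) →
      eLpNorm w 1 (volI L) = ENNReal.ofReal (∫ x in Ioo 0 L, w x) := fun {w} hw hw0 => by
    rw [eLpNorm_one_eq_lintegral_enorm, ofReal_integral_eq_lintegral_ofReal hw hw0]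
    refine lintegral_congr_ae ?_
    filter_upwards [hw0] with x hx
    exact Real.enorm_of_nonneg hx
  rw [key hu hu0, key hv hv0, h]

lemma IsModeSolution.integral_eq {L : ℝ} (hL : 0 < L) {v H : ℝ → ℝ → ℝ}
    (h : IsModeSolution L v H) {t : ℝ} (ht : 0 ≤ t) :
    ∫ x in Ioo 0 L, v t x = ∫ x in Ioo 0 L, v 0 x := by
  have hvc := h.cont
  have hs : ∀ s, Continuous (v s) := fun s => by fun_prop
  have h1 := h.eq t ht 0
  simp only [cosMode_zero, freq_zero, mul_one, zero_mul, neg_zero, mul_zero, integral_zero] at h1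
  rw [intervalIntegral.integral_sub ((hs t).intervalIntegrable _ _)
    ((hs 0).intervalIntegrable _ _)] at h1
  rw [setIntegral_Ioo_eq hL.le, setIntegral_Ioo_eq hL.le]
  linarith

/-! ### Passage to the limit in the system -/

/-- The sum of the third derivatives in terms of the current `j_g`. -/
def solveSum (b jg : ℝ) : ℝ := b⁻¹ ^ 3 * jg

/-- The third derivative of the first component in terms of the currents `j_f` and `j_g`. -/
def solveF (R a b jf jg : ℝ) : ℝ :=
  a⁻¹ ^ 2 * (a⁻¹ * jf - R / 2 * (2 * a ^ 2 + 3 * b ^ 2) * solveSum b jg)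

lemma solveSum_curG {b : ℝ} (hb : b ≠ 0) (y z : ℝ) : solveSum b (curG b y z) = y + z := by
  unfold solveSum curG
  field_simp

lemma solveF_curF {R a b : ℝ} (ha : a ≠ 0) (hb : b ≠ 0) (y z : ℝ) :
    solveF R a b (curF R a b y z) (curG b y z) = y := by
  rw [solveF, solveSum_curG hb, curF]
  field_simp
  ring

lemma curG_solve {b : ℝ} (hb : b ≠ 0) (jg : ℝ) : b ^ 3 * solveSum b jg = jg := by
  unfold solveSum
  field_simp

lemma curF_solve {R a b : ℝ} (ha : a ≠ 0) (jf jg : ℝ) :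
    a * (a ^ 2 * solveF R a b jf jg + R / 2 * (2 * a ^ 2 + 3 * b ^ 2) * solveSum b jg) = jf := by
  unfold solveF
  field_simp
  ring

section Limit

variable {L R μ : ℝ} {v w : ℝ → ℝ} {m l E : ℝ}

/-- The current `j_f` of an approximate solution. -/
def ApproxSeq.jF (S : ApproxSeq L R μ v w m l E) (n : ℕ) (p : ℝ × ℝ) : ℝ :=
  curF R (S.a n p.1 p.2) (S.b n p.1 p.2) (S.f₃ n p.1 p.2) (S.g₃ n p.1 p.2)

/-- The current `j_g` of an approximate solution. -/
def ApproxSeq.jG (S : ApproxSeq L R μ v w m l E) (n : ℕ) (p : ℝ × ℝ) : ℝ :=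
  curG (S.b n p.1 p.2) (S.f₃ n p.1 p.2) (S.g₃ n p.1 p.2)

/-- The current `j_{f,g}` of an approximate solution. -/
def ApproxSeq.jFG (S : ApproxSeq L R μ v w m l E) (n : ℕ) (p : ℝ × ℝ) : ℝ :=
  curFG (S.a n p.1 p.2) (S.b n p.1 p.2) (S.f₃ n p.1 p.2) (S.g₃ n p.1 p.2)

lemma ApproxSeq.continuous_jF (S : ApproxSeq L R μ v w m l E) (n : ℕ) : Continuous (S.jF n) := by
  have h1 := S.cont_a n
  have h2 := S.cont_b n
  have h3 := S.cont_f₃ n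
  have h4 := S.cont_g₃ n
  unfold ApproxSeq.jF curF
  fun_prop

lemma ApproxSeq.continuous_jG (S : ApproxSeq L R μ v w m l E) (n : ℕ) : Continuous (S.jG n) := by
  have h2 := S.cont_b n
  have h3 := S.cont_f₃ n
  have h4 := S.cont_g₃ n
  unfold ApproxSeq.jG curG
  fun_prop

lemma ApproxSeq.continuous_jFG (S : ApproxSeq L R μ v w m l E) (n : ℕ) :
    Continuous (S.jFG n) := by
  have h1 := S.cont_a n
  have h2 := S.cont_b n
  have h3 := S.cont_f₃ n
  have h4 := S.cont_g₃ n
  unfold ApproxSeq.jFG curFG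
  fun_prop

lemma ApproxSeq.energy_cyl_le (hL : 0 < L) (S : ApproxSeq L R μ v w m l E) (n : ℕ) {T : ℝ}
    (hT : T ∈ Icc (0 : ℝ) n) :
    1 / 2 * ((∫ x in Ioo 0 L, S.f₁ n T x ^ 2)
        + R * ∫ x in Ioo 0 L, (S.f₁ n T x + S.g₁ n T x) ^ 2)
      + (μ * R ^ 2 * (∫ p in cyl L T, S.jG n p ^ 2)
        + 3 * R ^ 2 / 4 * (∫ p in cyl L T, S.jFG n p ^ 2) + ∫ p in cyl L T, S.jF n p ^ 2) ≤ E := by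
  have h := S.energy_le n T hT
  have c1 := S.continuous_jF n
  have c2 := S.continuous_jG n
  have c3 := S.continuous_jFG n
  have hc : Continuous fun p => dissip R μ (S.jF n p) (S.jG n p) (S.jFG n p) := by
    unfold dissip
    fun_prop
  have e1 := setIntegral_cyl_eq hL.le hT.1 hc
  have i1 : IntegrableOn (fun p => μ * R ^ 2 * S.jG n p ^ 2) (cyl L T) :=
    continuous_integrableOn_cyl L T (by fun_prop)
  have i2 : IntegrableOn (fun p => 3 * R ^ 2 / 4 * S.jFG n p ^ 2) (cyl L T) :=
    continuous_integrableOn_cyl L T (by fun_prop)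
  have i3 : IntegrableOn (fun p => S.jF n p ^ 2) (cyl L T) :=
    continuous_integrableOn_cyl L T (by fun_prop)
  have e2 := integral_add (i1.add i2) i3
  have e3 := integral_add i1 i2
  simp only [Pi.add_apply] at e2
  rw [integral_const_mul, integral_const_mul] at e3
  have e4 : ∫ p in cyl L T, dissip R μ (S.jF n p) (S.jG n p) (S.jFG n p) =
      μ * R ^ 2 * (∫ p in cyl L T, S.jG n p ^ 2)
        + 3 * R ^ 2 / 4 * (∫ p in cyl L T, S.jFG n p ^ 2) + ∫ p in cyl L T, S.jF n p ^ 2 := by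
    rw [← e3]
    exact e2
  rw [setIntegral_Ioo_eq hL.le (fun x => S.f₁ n T x ^ 2),
    setIntegral_Ioo_eq hL.le (fun x => (S.f₁ n T x + S.g₁ n T x) ^ 2), ← e4, e1]
  exact h

/-- The limit of a sequence of approximate solutions along an ultrafilter. -/
structure ApproxSeq.IsLimit (S : ApproxSeq L R μ v w m l E) (U : Ultrafilter ℕ)
    (f g jf jg jfg : ℝ → ℝ → ℝ) : Prop where
  le_atTop : (U : Filter ℕ) ≤ atTop
  lim_f : IsUniformLimit L S.K S.B S.D U S.f f
  lim_g : IsUniformLimit L S.K S.B S.D U S.g g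
  lim_jf : ∀ T, IsWeakLimit (volume.restrict (cyl L T)) U S.jF fun p => jf p.1 p.2
  lim_jg : ∀ T, IsWeakLimit (volume.restrict (cyl L T)) U S.jG fun p => jg p.1 p.2
  lim_jfg : ∀ T, IsWeakLimit (volume.restrict (cyl L T)) U S.jFG fun p => jfg p.1 p.2

/-- All weights in the dissipation are positive, so the energy bound controls each current
separately, uniformly in `n` on the cylinder of length `n`. -/
lemma ApproxSeq.exists_isLimit (hL : 0 < L) (hR : 0 < R) (hμ : 0 < μ)
    (S : ApproxSeq L R μ v w m l E) :
    ∃ U f g jf jg jfg, S.IsLimit U f g jf jg jfg := by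
  let U : Ultrafilter ℕ := hyperfilter ℕ
  have hU : (U : Filter ℕ) ≤ atTop := Nat.hyperfilter_le_atTop
  obtain ⟨f, hf⟩ := S.bdd_f.exists_limit hL U
  obtain ⟨g, hg⟩ := S.bdd_g.exists_limit hL U
  have hsq : ∀ (n : ℕ) (j : ℝ × ℝ → ℝ), 0 ≤ ∫ p in cyl L n, j p ^ 2 := fun n j =>
    integral_nonneg fun p => sq_nonneg _
  have hb : ∀ n : ℕ, μ * R ^ 2 * (∫ p in cyl L n, S.jG n p ^ 2)
        + 3 * R ^ 2 / 4 * (∫ p in cyl L n, S.jFG n p ^ 2) + ∫ p in cyl L n, S.jF n p ^ 2 ≤ E :=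
    fun n => by
      have h1 := S.energy_cyl_le hL n (T := n) ⟨n.cast_nonneg, le_rfl⟩
      have h2 : 0 ≤ ∫ x in Ioo 0 L, S.f₁ n n x ^ 2 := integral_nonneg fun x => sq_nonneg _
      have h3 : 0 ≤ R * ∫ x in Ioo 0 L, (S.f₁ n n x + S.g₁ n n x) ^ 2 :=
        mul_nonneg hR.le (integral_nonneg fun x => sq_nonneg _)
      linarith
  have hbG : ∀ n : ℕ, ∫ p in cyl L n, S.jG n p ^ 2 ≤ E / (μ * R ^ 2) := fun n => by
    rw [le_div_iff₀ (by positivity), mul_comm]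
    have h1 : 0 ≤ 3 * R ^ 2 / 4 * (∫ p in cyl L n, S.jFG n p ^ 2) :=
      mul_nonneg (by positivity) (hsq n _)
    linarith [hb n, hsq n (S.jF n)]
  have hbFG : ∀ n : ℕ, ∫ p in cyl L n, S.jFG n p ^ 2 ≤ E / (3 * R ^ 2 / 4) := fun n => by
    rw [le_div_iff₀ (by positivity), mul_comm]
    have h1 : 0 ≤ μ * R ^ 2 * (∫ p in cyl L n, S.jG n p ^ 2) :=
      mul_nonneg (by positivity) (hsq n _)
    linarith [hb n, hsq n (S.jF n)]
  have hbF : ∀ n : ℕ, ∫ p in cyl L n, S.jF n p ^ 2 ≤ E := fun n => by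
    have h1 : 0 ≤ 3 * R ^ 2 / 4 * (∫ p in cyl L n, S.jFG n p ^ 2) :=
      mul_nonneg (by positivity) (hsq n _)
    have h2 : 0 ≤ μ * R ^ 2 * (∫ p in cyl L n, S.jG n p ^ 2) :=
      mul_nonneg (by positivity) (hsq n _)
    linarith [hb n]
  obtain ⟨jf, hjf⟩ := exists_current_limit hU S.continuous_jF hbF
  obtain ⟨jg, hjg⟩ := exists_current_limit hU S.continuous_jG hbG
  obtain ⟨jfg, hjfg⟩ := exists_current_limit hU S.continuous_jFG hbFG
  exact ⟨U, f, g, fun t x => jf (t, x), fun t x => jg (t, x), fun t x => jfg (t, x),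
    hU, hf, hg, hjf, hjg, hjfg⟩

variable {S : ApproxSeq L R μ v w m l E} {U : Ultrafilter ℕ} {f g jf jg jfg : ℝ → ℝ → ℝ}

lemma cyl_subset_Icc (L T : ℝ) : cyl L T ⊆ Icc 0 T ×ˢ Icc 0 L :=
  prod_mono Ioo_subset_Icc_self Ioo_subset_Icc_self

lemma ApproxSeq.IsLimit.strong_a (h : S.IsLimit U f g jf jg jfg) {T : ℝ} {A : Set (ℝ × ℝ)}
    (hA : A ⊆ Icc 0 T ×ˢ Icc 0 L) :
    IsStrongLimit volume U A (fun n p => S.a n p.1 p.2) fun p => Real.sqrt (f p.1 p.2) :=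
  (h.lim_f.isStrongLimit_sqrt h.le_atTop S.cont_a S.near_a T).mono hA

lemma ApproxSeq.IsLimit.strong_b (h : S.IsLimit U f g jf jg jfg) {T : ℝ} {A : Set (ℝ × ℝ)}
    (hA : A ⊆ Icc 0 T ×ˢ Icc 0 L) :
    IsStrongLimit volume U A (fun n p => S.b n p.1 p.2) fun p => Real.sqrt (g p.1 p.2) :=
  (h.lim_g.isStrongLimit_sqrt h.le_atTop S.cont_b S.near_b T).mono hA

lemma ApproxSeq.IsLimit.weak_hF (h : S.IsLimit U f g jf jg jfg) (T : ℝ) :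
    IsWeakLimit (volume.restrict (cyl L T)) U (fun n p => hF (S.a n p.1 p.2) (S.jF n p))
      fun p => hF (Real.sqrt (f p.1 p.2)) (jf p.1 p.2) := by
  have hm := measurableSet_cyl L T
  have ha := h.strong_a (cyl_subset_Icc L T)
  refine (((h.lim_jf T).mul hm ha).mul hm ha |>.mul hm ha).of_eq (fun n p => ?_) fun p => ?_
  all_goals
    simp only [hF]
    ring

lemma ApproxSeq.IsLimit.weak_hG (h : S.IsLimit U f g jf jg jfg) (T : ℝ) :
    IsWeakLimit (volume.restrict (cyl L T)) U
      (fun n p => hG R μ (S.a n p.1 p.2) (S.b n p.1 p.2) (S.jF n p) (S.jG n p) (S.jFG n p))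
      fun p => hG R μ (Real.sqrt (f p.1 p.2)) (Real.sqrt (g p.1 p.2)) (jf p.1 p.2) (jg p.1 p.2)
        (jfg p.1 p.2) := by
  have hm := measurableSet_cyl L T
  have ha := h.strong_a (cyl_subset_Icc L T)
  have hb := h.strong_b (cyl_subset_Icc L T)
  have h1 := ((((h.lim_jg T).mul hm hb).mul hm hb).mul hm hb).const_mul (μ * R)
  have h2 := ((((h.lim_jfg T).mul hm hb).mul hm hb).mul hm ha).const_mul (3 * R / 4)
  have h3 := ((((h.lim_jf T).mul hm hb).mul hm hb).mul hm ha).const_mul (3 / 2)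
  refine ((h1.add h2).add h3).of_eq (fun n p => ?_) fun p => ?_
  all_goals
    simp only [hG]
    ring

lemma ApproxSeq.IsLimit.isModeSolution_f (hL : 0 < L) (h : S.IsLimit U f g jf jg jfg) :
    IsModeSolution L f fun t x => hF (Real.sqrt (f t x)) (jf t x) := by
  refine isModeSolution_of_tendsto hL h.le_atTop S.bdd_f h.lim_f (fun n => ?_) h.weak_hF S.eq_f
  have h1 := S.cont_a n
  have h2 := S.continuous_jF n
  unfold hF
  fun_prop

lemma ApproxSeq.IsLimit.isModeSolution_g (hL : 0 < L) (h : S.IsLimit U f g jf jg jfg) :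
    IsModeSolution L g fun t x =>
      hG R μ (Real.sqrt (f t x)) (Real.sqrt (g t x)) (jf t x) (jg t x) (jfg t x) := by
  refine isModeSolution_of_tendsto hL h.le_atTop S.bdd_g h.lim_g (fun n => ?_) h.weak_hG S.eq_g
  have h1 := S.cont_a n
  have h2 := S.cont_b n
  have h3 := S.continuous_jF n
  have h4 := S.continuous_jG n
  have h5 := S.continuous_jFG n
  unfold hG
  fun_prop

/-- The relation between the currents `j_g` and `j_{f,g}`. -/
lemma ApproxSeq.IsLimit.sqrt_mul_jfg (h : S.IsLimit U f g jf jg jfg) (T : ℝ) :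
    ∀ᵐ p ∂((volume : Measure (ℝ × ℝ)).restrict (cyl L T)),
      Real.sqrt (g p.1 p.2) * jfg p.1 p.2 = Real.sqrt (f p.1 p.2) * jg p.1 p.2 := by
  have hm := measurableSet_cyl L T
  -- At level `n` both products equal `a * b ^ 3 * (y + z)`, with `y`, `z` the third derivatives,
  -- and weak limits are unique. No division is needed, so the relation holds on the whole cylinder.
  refine ((h.lim_jfg T).mul hm (h.strong_b (cyl_subset_Icc L T))).unique
    (((h.lim_jg T).mul hm (h.strong_a (cyl_subset_Icc L T))).of_eq (fun n p => ?_) fun p => rfl)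
  simp only [ApproxSeq.jG, ApproxSeq.jFG, curG, curFG]
  ring

/-- The third derivatives converge weakly on compact subsets of the positivity set. -/
lemma ApproxSeq.IsLimit.weak_third (h : S.IsLimit U f g jf jg jfg) {T : ℝ} {K : Set (ℝ × ℝ)}
    (hK : IsCompact K) (hKs : K ⊆ posSet L T f g) :
    IsWeakLimit (volume.restrict K) U (fun n p => S.f₃ n p.1 p.2)
      (fun p => solveF R (Real.sqrt (f p.1 p.2)) (Real.sqrt (g p.1 p.2)) (jf p.1 p.2)
        (jg p.1 p.2)) ∧
    IsWeakLimit (volume.restrict K) U (fun n p => S.g₃ n p.1 p.2)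
      (fun p => solveSum (Real.sqrt (g p.1 p.2)) (jg p.1 p.2)
        - solveF R (Real.sqrt (f p.1 p.2)) (Real.sqrt (g p.1 p.2)) (jf p.1 p.2)
          (jg p.1 p.2)) := by
  have hm := hK.measurableSet
  have hKc : K ⊆ cyl L T := fun p hp => (hKs hp).1
  have ha := h.strong_a (hKc.trans (cyl_subset_Icc L T))
  have hb := h.strong_b (hKc.trans (cyl_subset_Icc L T))
  have hfc := h.lim_f.cont
  have hgc := h.lim_g.cont
  -- On a compact subset of the positivity set both square roots are bounded below, so their
  -- inverses converge uniformly.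
  have hlow : ∀ {u : ℝ × ℝ → ℝ}, Continuous u → (∀ p ∈ K, 0 < u p) →
      ∃ c, 0 < c ∧ ∀ p ∈ K, c ≤ Real.sqrt (u p) := fun {u} hu hpos => by
    rcases K.eq_empty_or_nonempty with hE | hE
    · exact ⟨1, one_pos, fun p hp => absurd hp (by simp [hE])⟩
    · obtain ⟨q, hq, hmin⟩ := hK.exists_isMinOn hE hu.continuousOn
      exact ⟨Real.sqrt (u q), Real.sqrt_pos.2 (hpos q hq), fun p hp =>
        Real.sqrt_le_sqrt (hmin hp)⟩
  obtain ⟨c, hc, hcf⟩ := hlow hfc fun p hp => (hKs hp).2.1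
  obtain ⟨d, hd, hdg⟩ := hlow hgc fun p hp => (hKs hp).2.2
  obtain ⟨pa, ia⟩ := ha.inv hc hcf
  obtain ⟨pb, ib⟩ := hb.inv hd hdg
  have w1 : IsWeakLimit (volume.restrict K) U
      (fun n p => solveSum (S.b n p.1 p.2) (S.jG n p))
      (fun p => solveSum (Real.sqrt (g p.1 p.2)) (jg p.1 p.2)) := by
    refine (((((h.lim_jg T).mono hm hKc).mul hm ib).mul hm ib).mul hm ib).of_eq
      (fun n p => ?_) fun p => ?_
    all_goals
      simp only [solveSum]
      ring
  have w2 : IsWeakLimit (volume.restrict K) U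
      (fun n p => solveF R (S.a n p.1 p.2) (S.b n p.1 p.2) (S.jF n p) (S.jG n p))
      (fun p => solveF R (Real.sqrt (f p.1 p.2)) (Real.sqrt (g p.1 p.2)) (jf p.1 p.2)
        (jg p.1 p.2)) := by
    have x1 := ((h.lim_jf T).mono hm hKc).mul hm ia
    have x2 := ((w1.mul hm ha).mul hm ha).const_mul R
    have x3 := ((w1.mul hm hb).mul hm hb).const_mul (3 * R / 2)
    refine ((((x1.sub x2).sub x3).mul hm ia).mul hm ia).of_eq (fun n p => ?_) fun p => ?_
    all_goals
      simp only [solveF]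
      ring
  -- For large `n` the approximate roots are positive on `K`, and the solution formulas applied to
  -- the approximate currents return the true third derivatives.
  have e1 : ∀ᶠ n in (U : Filter ℕ), ∀ p ∈ K,
      solveSum (S.b n p.1 p.2) (S.jG n p) = S.f₃ n p.1 p.2 + S.g₃ n p.1 p.2 := by
    filter_upwards [pb] with n hn p hp
    exact solveSum_curG (hn p hp).ne' _ _
  have e2 : ∀ᶠ n in (U : Filter ℕ), ∀ p ∈ K,
      solveF R (S.a n p.1 p.2) (S.b n p.1 p.2) (S.jF n p) (S.jG n p) = S.f₃ n p.1 p.2 := by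
    filter_upwards [pa, pb] with n hn hn' p hp
    exact solveF_curF (hn p hp).ne' (hn' p hp).ne' _ _
  refine ⟨w2.congr (e2.mono fun n hn => (ae_restrict_iff' hm).2 (.of_forall hn)),
    (w1.sub w2).congr ?_⟩
  filter_upwards [e1, e2] with n h1 h2
  refine (ae_restrict_iff' hm).2 (.of_forall fun p hp => ?_)
  simp only [h1 p hp, h2 p hp]
  ring

/-- Stronger than what is finally needed: it holds at every time, with the dissipation of the limit
currents integrated over the whole cylinder. -/
lemma ApproxSeq.IsLimit.energy_le (hL : 0 < L) (hR : 0 < R) (hμ : 0 < μ)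
    (h : S.IsLimit U f g jf jg jfg) {T : ℝ} (hT : 0 ≤ T) :
    MemH1 L (f T) ∧ MemH1 L (g T) ∧
      energy L R (f T) (g T) + (∫ p in cyl L T,
        (μ * R ^ 2 * jg p.1 p.2 ^ 2 + 3 * R ^ 2 / 4 * jfg p.1 p.2 ^ 2 + jf p.1 p.2 ^ 2)) ≤ E := by
  obtain ⟨f₁, hf₁⟩ := h.lim_f.exists_weakDeriv hL S.bdd_f
  obtain ⟨g₁, hg₁⟩ := h.lim_g.exists_weakDeriv hL S.bdd_g
  obtain ⟨mf, df, -, -, tf⟩ := hf₁ T hT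
  obtain ⟨mg, dg, -, -, tg⟩ := hg₁ T hT
  have hfm := continuous_memLp_volI (L := L) (h.lim_f.cont_slice T)
  have hgm := continuous_memLp_volI (L := L) (h.lim_g.cont_slice T)
  refine ⟨⟨hfm, _, mf, df⟩, ⟨hgm, _, mg, dg⟩, ?_⟩
  have hslice : ∀ {y : ℝ → ℝ → ℝ}, Continuous (fun p : ℝ × ℝ => y p.1 p.2) →
      Continuous (y T) := fun hy => by fun_prop
  have w1 : IsWeakLimit (volI L) U (fun n => S.f₁ n T) (f₁ T) :=
    ⟨.of_forall fun n => continuous_memLp_volI (hslice (S.bdd_f.cont₁ n)), mf,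
      ⟨S.K ^ 2, .of_forall fun n => by
        rw [setIntegral_Ioo_eq hL.le (fun x => S.f₁ n T x ^ 2)]
        exact S.bdd_f.bound₁ n T⟩, tf⟩
  have w2 : IsWeakLimit (volI L) U (fun n => S.g₁ n T) (g₁ T) :=
    ⟨.of_forall fun n => continuous_memLp_volI (hslice (S.bdd_g.cont₁ n)), mg,
      ⟨S.K ^ 2, .of_forall fun n => by
        rw [setIntegral_Ioo_eq hL.le (fun x => S.g₁ n T x ^ 2)]
        exact S.bdd_g.bound₁ n T⟩, tg⟩
  have w3 := w1.add w2
  rw [energy_eq R hfm hgm mf mg df dg, integral_add mf.integrable_sq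
    (w3.mem_lim.integrable_sq.const_mul R), integral_const_mul]
  have jfm := (h.lim_jf T).mem_lim
  have jgm := (h.lim_jg T).mem_lim
  have jfgm := (h.lim_jfg T).mem_lim
  have e2 := integral_add ((jgm.integrable_sq.const_mul (μ * R ^ 2)).add
    (jfgm.integrable_sq.const_mul (3 * R ^ 2 / 4))) jfm.integrable_sq
  have e3 := integral_add (jgm.integrable_sq.const_mul (μ * R ^ 2))
    (jfgm.integrable_sq.const_mul (3 * R ^ 2 / 4))
  simp only [Pi.add_apply] at e2
  rw [e2, e3, integral_const_mul, integral_const_mul]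
  -- `M` is the sum of the weights of the five squared norms. Each is lower semicontinuous up to an
  -- error ε/M, and one index `n` satisfies all five inequalities together with the energy bound at
  -- level `n`.
  set M := 1 / 2 + R / 2 + μ * R ^ 2 + 3 * R ^ 2 / 4 + 1 with hM
  have hM0 : 0 < M := by positivity
  refine le_of_forall_pos_le_add fun ε hε => ?_
  have hε' : 0 < ε / M := by positivity
  obtain ⟨n, h1, h2, h3, h4, h5, h6⟩ := ((w1.eventually_integral_sq_le hε').and
    ((w3.eventually_integral_sq_le hε').and (((h.lim_jf T).eventually_integral_sq_le hε').and
    (((h.lim_jg T).eventually_integral_sq_le hε').and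
    (((h.lim_jfg T).eventually_integral_sq_le hε').and
      ((eventually_ge_atTop ⌈T⌉₊).filter_mono h.le_atTop)))))).exists
  have h7 := S.energy_cyl_le hL n (T := T) ⟨hT, Nat.ceil_le.1 h6⟩
  have h2' := mul_le_mul_of_nonneg_left h2 hR.le
  have h4' := mul_le_mul_of_nonneg_left h4 (by positivity : 0 ≤ μ * R ^ 2)
  have h5' := mul_le_mul_of_nonneg_left h5 (by positivity : 0 ≤ 3 * R ^ 2 / 4)
  have hMε : M * (ε / M) = ε := by field_simp
  rw [← hMε, hM]
  linarith

end Limit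

/-! ### The fluxes of the limit -/

lemma rpow_three_halves {x : ℝ} (hx : 0 ≤ x) : x ^ (3 / 2 : ℝ) = Real.sqrt x ^ 3 := by
  rw [Real.sqrt_eq_rpow, ← Real.rpow_natCast, ← Real.rpow_mul hx]
  norm_num

/-- The limit is studied with `Real.sqrt`, which vanishes at negative heights, while the statement
uses real powers; the two agree once non-negativity is known. -/
lemma fluxF_eq {f jf : ℝ → ℝ → ℝ} {t x : ℝ} (hf : 0 ≤ f t x) :
    fluxF f jf t x = hF (Real.sqrt (f t x)) (jf t x) := by
  rw [fluxF, hF, rpow_three_halves hf]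

lemma fluxG_eq (R μ : ℝ) {f g jf jg jfg : ℝ → ℝ → ℝ} {t x : ℝ} (hg : 0 ≤ g t x) :
    fluxG R μ f g jf jg jfg t x =
      hG R μ (Real.sqrt (f t x)) (Real.sqrt (g t x)) (jf t x) (jg t x) (jfg t x) := by
  rw [fluxG, hG, rpow_three_halves hg, ← Real.sqrt_eq_rpow, Real.sq_sqrt hg]

lemma WeakForm.congr {L T : ℝ} {u H H' : ℝ → ℝ → ℝ} {u₀ : ℝ → ℝ} (h : WeakForm L T u H u₀)
    (hH : ∀ p ∈ cyl L T, H p.1 p.2 = H' p.1 p.2) : WeakForm L T u H' u₀ := by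
  intro ξ hξ
  rw [← h ξ hξ]
  congr 1
  exact setIntegral_congr_fun (measurableSet_cyl L T) fun p hp => by simp only [hH p hp]

lemma memL2Cyl_of_eqOn {L T : ℝ} {F : ℝ × ℝ → ℝ} {u : ℝ → ℝ → ℝ}
    (h : MemLp F 2 (volume.restrict (cyl L T))) (hu : ∀ p ∈ cyl L T, F p = u p.1 p.2) :
    MemL2Cyl L T u :=
  (memLp_congr_ae ((ae_restrict_iff' (measurableSet_cyl L T)).2 (.of_forall hu))).1 h

section Limit

variable {L R μ : ℝ} {v w : ℝ → ℝ} {m l E : ℝ}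
  {S : ApproxSeq L R μ v w m l E} {U : Ultrafilter ℕ} {f g jf jg jfg : ℝ → ℝ → ℝ}

/-- Here the value 0 of `Real.sqrt` at negative numbers does the work: the limit flux vanishes
wherever the height is negative. For the second component the same holds because each term of `hG`
contains a power of its own root. -/
lemma ApproxSeq.IsLimit.nonneg_f (hL : 0 < L) (h : S.IsLimit U f g jf jg jfg)
    (h0 : ∀ᵐ x ∂(volI L), 0 ≤ f 0 x) {t x : ℝ} (ht : 0 ≤ t) (hx : x ∈ Ioo 0 L) : 0 ≤ f t x :=
  (h.isModeSolution_f hL).nonneg hL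
    (fun t x hn => by simp [hF, Real.sqrt_eq_zero_of_nonpos hn.le])
    (nonneg_of_ae_nonneg (h.lim_f.cont_slice 0) h0) ht hx

lemma ApproxSeq.IsLimit.nonneg_g (hL : 0 < L) (h : S.IsLimit U f g jf jg jfg)
    (h0 : ∀ᵐ x ∂(volI L), 0 ≤ g 0 x) {t x : ℝ} (ht : 0 ≤ t) (hx : x ∈ Ioo 0 L) : 0 ≤ g t x :=
  (h.isModeSolution_g hL).nonneg hL
    (fun t x hn => by simp [hG, Real.sqrt_eq_zero_of_nonpos hn.le])
    (nonneg_of_ae_nonneg (h.lim_g.cont_slice 0) h0) ht hx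

lemma measurableSet_posSet (L T : ℝ) {f g : ℝ → ℝ → ℝ}
    (hf : Continuous fun p : ℝ × ℝ => f p.1 p.2) (hg : Continuous fun p : ℝ × ℝ => g p.1 p.2) :
    MeasurableSet (posSet L T f g) :=
  (measurableSet_cyl L T).inter ((isOpen_lt continuous_const hf).measurableSet.inter
    (isOpen_lt continuous_const hg).measurableSet)

lemma posSet_subset_cyl (L T : ℝ) (f g : ℝ → ℝ → ℝ) : posSet L T f g ⊆ cyl L T :=
  fun _ hp => hp.1

/-- The currents on the positivity set. -/
lemma ApproxSeq.IsLimit.currents_eq (h : S.IsLimit U f g jf jg jfg) (T : ℝ) :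
    ∀ᵐ p ∂((volume : Measure (ℝ × ℝ)).restrict (posSet L T f g)),
      jf p.1 p.2 = f p.1 p.2 ^ (1 / 2 : ℝ) *
        (f p.1 p.2 * solveF R (Real.sqrt (f p.1 p.2)) (Real.sqrt (g p.1 p.2)) (jf p.1 p.2)
            (jg p.1 p.2)
          + R / 2 * (2 * f p.1 p.2 + 3 * g p.1 p.2)
            * solveSum (Real.sqrt (g p.1 p.2)) (jg p.1 p.2)) ∧
      jg p.1 p.2 = g p.1 p.2 ^ (3 / 2 : ℝ) * solveSum (Real.sqrt (g p.1 p.2)) (jg p.1 p.2) ∧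
      jfg p.1 p.2 = f p.1 p.2 ^ (1 / 2 : ℝ) * g p.1 p.2
        * solveSum (Real.sqrt (g p.1 p.2)) (jg p.1 p.2) := by
  have h1 := ae_restrict_of_ae_restrict_of_subset (posSet_subset_cyl L T f g) (h.sqrt_mul_jfg T)
  filter_upwards [h1, ae_restrict_mem (measurableSet_posSet L T h.lim_f.cont h.lim_g.cont)]
    with p hp hpos
  obtain ⟨-, hf, hg⟩ := hpos
  have sf := Real.sqrt_pos.2 hf
  have sg := Real.sqrt_pos.2 hg
  have qf := Real.sq_sqrt hf.le
  have qg := Real.sq_sqrt hg.le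
  rw [rpow_three_halves hg.le, ← Real.sqrt_eq_rpow]
  refine ⟨?_, (curG_solve sg.ne' _).symm, ?_⟩
  · have := curF_solve (R := R) (b := Real.sqrt (g p.1 p.2)) sf.ne' (jf p.1 p.2) (jg p.1 p.2)
    rw [qf, qg] at this
    exact this.symm
  -- The third current is not used to solve for the third derivatives; it is identified through its
  -- relation to `jg`, cancelling a root that is positive on this set.
  · refine mul_left_cancel₀ sg.ne' (hp.trans ?_)
    linear_combination -Real.sqrt (f p.1 p.2) * curG_solve sg.ne' (jg p.1 p.2)
      + Real.sqrt (g p.1 p.2) * Real.sqrt (f p.1 p.2)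
        * solveSum (Real.sqrt (g p.1 p.2)) (jg p.1 p.2) * qg

end Limit

end ThinFilm

end

/-! ### The main theorem -/

theorem theorem1p1 (L R μ : ℝ) (hL : 0 < L) (hR : 0 < R) (hμ : 0 < μ)
    (f₀ g₀ : ℝ → ℝ) (hf₀ : ThinFilm.MemH1 L f₀) (hg₀ : ThinFilm.MemH1 L g₀)
    (hf₀_nonneg : ∀ᵐ x ∂(ThinFilm.volI L), 0 ≤ f₀ x)
    (hg₀_nonneg : ∀ᵐ x ∂(ThinFilm.volI L), 0 ≤ g₀ x) :
    ∃ f g : ℝ → ℝ → ℝ,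
      -- (a) regularity
      (∀ T : ℝ, 0 < T →
        ThinFilm.MemLinftyH1 L T f ∧ ThinFilm.MemLinftyH1 L T g ∧
        ∀ α : ℝ≥0, α < 1 / 2 →
          ThinFilm.MemCHolder L T α f ∧ ThinFilm.MemCHolder L T α g) ∧
      -- (b) initial values and non-negativity
      (f 0 =ᵐ[ThinFilm.volI L] f₀ ∧ g 0 =ᵐ[ThinFilm.volI L] g₀) ∧
      (∀ t : ℝ, 0 < t → ∀ x ∈ Ioo 0 L, 0 ≤ f t x ∧ 0 ≤ g t x) ∧
      -- (c) conservation of mass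
      (∀ t : ℝ, 0 < t →
        eLpNorm (f t) 1 (ThinFilm.volI L) = eLpNorm f₀ 1 (ThinFilm.volI L) ∧
        eLpNorm (g t) 1 (ThinFilm.volI L) = eLpNorm g₀ 1 (ThinFilm.volI L)) ∧
      -- `f₃ = ∂ₓ³f`, `g₃ = ∂ₓ³g` on the set where `f` and `g` are both positive
      ∃ f₃ g₃ jf jg jfg : ℝ → ℝ → ℝ,
        -- (d) fluxes and weak formulation
        (∀ T : ℝ, 0 < T →
          (ThinFilm.MemL2Loc (ThinFilm.posSet L T f g) f₃ ∧
            ThinFilm.IsWeakDerivX3 (ThinFilm.posSet L T f g) f f₃) ∧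
          (ThinFilm.MemL2Loc (ThinFilm.posSet L T f g) g₃ ∧
            ThinFilm.IsWeakDerivX3 (ThinFilm.posSet L T f g) g g₃) ∧
          ThinFilm.MemL2Cyl L T jf ∧ ThinFilm.MemL2Cyl L T jg ∧ ThinFilm.MemL2Cyl L T jfg ∧
          (∀ᵐ p ∂((volume : Measure (ℝ × ℝ)).restrict (ThinFilm.posSet L T f g)),
            jf p.1 p.2 = f p.1 p.2 ^ (1 / 2 : ℝ) *
              (f p.1 p.2 * f₃ p.1 p.2
                + R / 2 * (2 * f p.1 p.2 + 3 * g p.1 p.2) * (f₃ p.1 p.2 + g₃ p.1 p.2)) ∧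
            jg p.1 p.2 = g p.1 p.2 ^ (3 / 2 : ℝ) * (f₃ p.1 p.2 + g₃ p.1 p.2) ∧
            jfg p.1 p.2 =
              f p.1 p.2 ^ (1 / 2 : ℝ) * g p.1 p.2 * (f₃ p.1 p.2 + g₃ p.1 p.2)) ∧
          ThinFilm.MemL2Cyl L T (ThinFilm.fluxF f jf) ∧
          ThinFilm.MemL2Cyl L T (ThinFilm.fluxG R μ f g jf jg jfg) ∧
          ThinFilm.WeakForm L T f (ThinFilm.fluxF f jf) f₀ ∧
          ThinFilm.WeakForm L T g (ThinFilm.fluxG R μ f g jf jg jfg) g₀) ∧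
        -- (e) energy inequality
        (∀ᵐ T ∂((volume : Measure ℝ).restrict (Ioi 0)),
          ThinFilm.MemH1 L (f T) ∧ ThinFilm.MemH1 L (g T) ∧
          ThinFilm.energy L R (f T) (g T)
            + (∫ p in ThinFilm.posSet L T f g,
                (μ * R ^ 2 * jg p.1 p.2 ^ 2 + 3 * R ^ 2 / 4 * jfg p.1 p.2 ^ 2
                  + jf p.1 p.2 ^ 2))
            ≤ ThinFilm.energy L R f₀ g₀) := by
  obtain ⟨hf₀m, v, hv, hv'⟩ := hf₀
  obtain ⟨hg₀m, w, hw, hw'⟩ := hg₀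
  obtain ⟨S⟩ := ThinFilm.exists_approxSeq hL hR hμ hv hw (∫ x in Ioo 0 L, f₀ x)
    (∫ x in Ioo 0 L, g₀ x)
  -- The energy bound is a parameter of the type of `S`; this turns it into the energy of the
  -- initial data.
  rw [← ThinFilm.energy_eq R hf₀m hg₀m hv hw hv' hw'] at S
  obtain ⟨U, f, g, jf, jg, jfg, h⟩ := S.exists_isLimit hL hR hμ
  have hf0 := h.lim_f.initial hL h.le_atTop S.bdd_f hf₀m hv hv' S.init_f S.mass_f
  have hg0 := h.lim_g.initial hL h.le_atTop S.bdd_g hg₀m hw hw' S.init_g S.mass_g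
  have hf0n : ∀ᵐ x ∂(ThinFilm.volI L), 0 ≤ f 0 x := by
    filter_upwards [hf0, hf₀_nonneg] with x h1 h2
    rwa [h1]
  have hg0n : ∀ᵐ x ∂(ThinFilm.volI L), 0 ≤ g 0 x := by
    filter_upwards [hg0, hg₀_nonneg] with x h1 h2
    rwa [h1]
  have hfn : ∀ t : ℝ, 0 ≤ t → ∀ x ∈ Ioo 0 L, 0 ≤ f t x := fun t ht x hx =>
    h.nonneg_f hL hf0n ht hx
  have hgn : ∀ t : ℝ, 0 ≤ t → ∀ x ∈ Ioo 0 L, 0 ≤ g t x := fun t ht x hx =>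
    h.nonneg_g hL hg0n ht hx
  have hF : ∀ T, ∀ p ∈ ThinFilm.cyl L T, ThinFilm.hF (Real.sqrt (f p.1 p.2)) (jf p.1 p.2) =
      ThinFilm.fluxF f jf p.1 p.2 := fun T p hp =>
    (ThinFilm.fluxF_eq (hfn p.1 hp.1.1.le p.2 hp.2)).symm
  have hG : ∀ T, ∀ p ∈ ThinFilm.cyl L T, ThinFilm.hG R μ (Real.sqrt (f p.1 p.2))
      (Real.sqrt (g p.1 p.2)) (jf p.1 p.2) (jg p.1 p.2) (jfg p.1 p.2) =
      ThinFilm.fluxG R μ f g jf jg jfg p.1 p.2 := fun T p hp =>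
    (ThinFilm.fluxG_eq R μ (hgn p.1 hp.1.1.le p.2 hp.2)).symm
  have hae : ∀ {u : ℝ → ℝ}, (∀ x ∈ Ioo 0 L, 0 ≤ u x) → ∀ᵐ x ∂(ThinFilm.volI L), 0 ≤ u x :=
    fun hu => (ae_restrict_iff' measurableSet_Ioo).2 (.of_forall hu)
  have hcyl : ∀ T, ThinFilm.posSet L T f g ⊆ Icc 0 T ×ˢ Icc 0 L := fun T =>
    (ThinFilm.posSet_subset_cyl L T f g).trans (ThinFilm.cyl_subset_Icc L T)
  refine ⟨f, g, fun T _ => ⟨h.lim_f.memLinftyH1 hL S.bdd_f T, h.lim_g.memLinftyH1 hL S.bdd_g T,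
    fun α hα => ⟨h.lim_f.memCHolder S.bdd_f.K_pos.le T hα,
      h.lim_g.memCHolder S.bdd_f.K_pos.le T hα⟩⟩, ⟨hf0, hg0⟩,
    fun t ht x hx => ⟨hfn t ht.le x hx, hgn t ht.le x hx⟩, fun t ht => ⟨?_, ?_⟩,
    fun t x => ThinFilm.solveF R (Real.sqrt (f t x)) (Real.sqrt (g t x)) (jf t x) (jg t x),
    fun t x => ThinFilm.solveSum (Real.sqrt (g t x)) (jg t x)
      - ThinFilm.solveF R (Real.sqrt (f t x)) (Real.sqrt (g t x)) (jf t x) (jg t x),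
    jf, jg, jfg, fun T hT => ⟨⟨fun K hK hKs => (h.weak_third hK hKs).1.mem_lim, ?_⟩,
      ⟨fun K hK hKs => (h.weak_third hK hKs).2.mem_lim, ?_⟩, (h.lim_jf T).mem_lim,
      (h.lim_jg T).mem_lim, (h.lim_jfg T).mem_lim, ?_,
      ThinFilm.memL2Cyl_of_eqOn (h.weak_hF T).mem_lim (hF T),
      ThinFilm.memL2Cyl_of_eqOn (h.weak_hG T).mem_lim (hG T),
      ((h.isModeSolution_f hL).weakForm hL hT hf0).congr (hF T),
      ((h.isModeSolution_g hL).weakForm hL hT hg0).congr (hG T)⟩, ?_⟩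
  · exact ThinFilm.eLpNorm_one_eq_of_integral_eq
      (ThinFilm.continuous_integrableOn_Ioo (h.lim_f.cont_slice t))
      (ThinFilm.integrableOn_of_memLp hf₀m) (hae (hfn t ht.le)) hf₀_nonneg
      (((h.isModeSolution_f hL).integral_eq hL ht.le).trans (integral_congr_ae hf0))
  · exact ThinFilm.eLpNorm_one_eq_of_integral_eq
      (ThinFilm.continuous_integrableOn_Ioo (h.lim_g.cont_slice t))
      (ThinFilm.integrableOn_of_memLp hg₀m) (hae (hgn t ht.le)) hg₀_nonneg
      (((h.isModeSolution_g hL).integral_eq hL ht.le).trans (integral_congr_ae hg0))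
  · exact ThinFilm.isWeakDerivX3_of_tendsto S.bdd_f.cont S.bdd_f.cont₁ S.cont_f₂ S.cont_f₃
      S.bdd_f.deriv S.deriv_f₁ S.deriv_f₂ h.lim_f.cont (hcyl T) (h.lim_f.unif T)
      fun K hK hKs => (h.weak_third hK hKs).1
  · exact ThinFilm.isWeakDerivX3_of_tendsto S.bdd_g.cont S.bdd_g.cont₁ S.cont_g₂ S.cont_g₃
      S.bdd_g.deriv S.deriv_g₁ S.deriv_g₂ h.lim_g.cont (hcyl T) (h.lim_g.unif T)
      fun K hK hKs => (h.weak_third hK hKs).2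
  -- The second third derivative was chosen as the recovered sum minus the first, so the sum in the
  -- formulas collapses to `solveSum`.
  · simpa only [add_sub_cancel] using h.currents_eq T
  · refine (ae_restrict_iff' measurableSet_Ioi).2 (.of_forall fun T hT => ?_)
    obtain ⟨h1, h2, h3⟩ := h.energy_le hL hR hμ (le_of_lt hT)
    refine ⟨h1, h2, le_trans ?_ h3⟩
    -- The dissipation density is nonnegative, so shrinking the cylinder to the positivity set only
    -- decreases the left-hand side.
    refine add_le_add le_rfl (setIntegral_mono_set ?_ (.of_forall fun p => ?_)
      (ThinFilm.posSet_subset_cyl L T f g).eventuallyLE)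
    · exact (((h.lim_jg T).mem_lim.integrable_sq.const_mul _).add
        ((h.lim_jfg T).mem_lim.integrable_sq.const_mul _)).add (h.lim_jf T).mem_lim.integrable_sq
    · simp only [Pi.zero_apply]
      positivity
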